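/- **Setting.** Let $n,m\ge 1$ be integers and let $\mathbb F_n^+$ be the free semigroup with identity $g_0$ on $g_1,\dots,g_n$, with length $|\alpha|$; $\tilde\alpha$ is the reverse of the word $\alpha$, and $X_\alpha=X_{i_1}\cdots X_{i_k}$ for $\alpha=g_{i_1}\cdots g_{i_k}$, $X_{g_0}=I$. Let $f=\sum_\alpha a_\alpha X_\alpha$ be a positive regular free holomorphic function: $a_\alpha\ge 0$, $a_{g_0}=0$, $a_{g_i}>0$ for $i=1,\dots,n$, and $\limsup_{k}\big(\sum_{|\alpha|=k}|a_\alpha|^2\big)^{1/2k}<\infty$. For a (complex) Hilbert space $\mathcal K$ put $\Phi_{f,X}(Y)=\sum_{k\ge1}\sum_{|\alpha|=k}a_\alpha X_\alpha YX_\alpha^*$ (weak operator topology), $$\mathbf D_f^m(\mathcal K)=\{X\in B(\mathcal K)^n:\ \Phi_{f,X}\text{ is well defined and }(\mathrm{id}-\Phi_{f,X})^k(I)\ge 0,\ 1\le k\le m\},\qquad \mathbf D_{f,\mathrm{rad}}^m(\mathcal K)=\bigcup_{0\le r<1}r\,\mathbf D_f^m(\mathcal K).$$ Assume that for a separable infinite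 dimensional Hilbert space $\mathcal H$ the set $\mathbf D_f^m(\mathcal H)$ is norm closed and starlike ($r\mathbf D_f^m(\mathcal H)\subset\mathbf D_f^m(\mathcal H)$ for $0\le r<1$). *Model.* Let $b_{g_0}=1$ and $b_\alpha=\sum_{j=1}^{|\alpha|}\binom{j+m-1}{m-1}\sum_{\gamma_1\cdots\gamma_j=\alpha,\ |\gamma_i|\ge1}a_{\gamma_1}\cdots a_{\gamma_j}$ for $|\alpha|\ge1$. On the full Fock space $F^2(H_n)$ with orthonormal basis $(e_\alpha)_{\alpha\in\mathbb F_n^+}$, $e_{g_0}=1$, let $W_ie_\alpha=\sqrt{b_\alpha/b_{g_i\alpha}}\;e_{g_i\alpha}$ and $\Lambda_ie_\alpha=\sqrt{b_\alpha/b_{\alpha g_i}}\;e_{\alpha g_i}$. $F_n^\infty(\mathbf D_f^m)$ is the algebra of all $A\in B(F^2(H_n))$ for which there are $c_\beta\in\mathbb C$ with $\sum_\beta|c_\beta|^2/b_\beta<\infty$ and $Ap=\sum_\beta c_\beta W_\beta p$ for all $p\in\mathrm{span}\{e_\alpha\}$; one writes $A=\sum_\beta c_\beta W_\beta$. $\mathcal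 A_n(\mathbf D_f^m)$ is the norm closed algebra generated by $W_1,\dots,W_n$ and $I$. *Function algebras.* A formal power series $G=\sum_\alpha c_\alpha Z_\alpha$ ($c_\alpha\in\mathbb C$) is free holomorphic on $\mathbf D_{f,\mathrm{rad}}^m$ if $G(X)=\sum_{k\ge 0}\sum_{|\alpha|=k}c_\alpha X_\alpha$ converges in norm for every Hilbert space $\mathcal K$ and $X\in\mathbf D_{f,\mathrm{rad}}^m(\mathcal K)$. $H^\infty(\mathbf D_{f,\mathrm{rad}}^m)$ consists of the free holomorphic $G$ with $\sup\|G(X)\|<\infty$, the supremum being over all such $\mathcal K$ and $X$; $A(\mathbf D_{f,\mathrm{rad}}^m)$ consists of the free holomorphic $G$ such that $X\mapsto G(X)$ extends norm continuously to $\mathbf D_f^m(\mathcal K)$ for every $\mathcal K$. Matrices over both algebras carry the norms $\|[G_{ij}]\|_p=\sup\|[G_{ij}(X)]\|_{B(\mathcal K^{(p)})}$, with the same supremum. *Berezin transform.* For $X\in\mathbf D_{f,\mathrm{rad}}^m(\mathcal K)$ and $g\in B(F^2(H_n))$, $\mathbf B_X[g]\in B(\mathcal K)$ is given by $$\langle \mathbf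 B_X[g]x,y\rangle=\big\langle (I-R^*)^{-m}\,\big(g\otimes(\mathrm{id}-\Phi_{f,X})^m(I)\big)\,(I-R)^{-m}(1\otimes x),\,1\otimes y\big\rangle,\qquad R=\sum_{|\alpha|\ge1}a_{\tilde\alpha}\Lambda_\alpha\otimes X_{\tilde\alpha}^*,$$ and $G=\mathbf B[\varphi]$ means $G(X)=\mathbf B_X[\varphi]$ for all $\mathcal K$ and all $X\in\mathbf D_{f,\mathrm{rad}}^m(\mathcal K)$. **Theorem.** (1) The map $\Phi\big(\sum c_\alpha Z_\alpha\big):=\sum c_\alpha W_\alpha$ is a well defined completely isometric isomorphism of algebras from $H^\infty(\mathbf D_{f,\mathrm{rad}}^m)$ onto $F_n^\infty(\mathbf D_f^m)$. For $G=\sum c_\alpha Z_\alpha$ free holomorphic on $\mathbf D_{f,\mathrm{rad}}^m$ the following are equivalent: (i) $G\in H^\infty(\mathbf D_{f,\mathrm{rad}}^m)$; (ii) $\sup_{0\le r<1}\|G(rW_1,\dots,rW_n)\|<\infty$, where $G(rW_1,\dots,rW_n)=\sum_{k}\sum_{|\alpha|=k}c_\alpha r^{|\alpha|}W_\alpha$;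 (iii) there is $\varphi\in F_n^\infty(\mathbf D_f^m)$ with $G=\mathbf B[\varphi]$. In this case $\Phi(G)=\mathrm{SOT}\text{-}\lim_{r\to1}G(rW_1,\dots,rW_n)$, and $\Phi^{-1}(\varphi)=\mathbf B[\varphi]$ for all $\varphi\in F_n^\infty(\mathbf D_f^m)$. (2) The map $\Phi\big(\sum c_\alpha Z_\alpha\big):=\sum c_\alpha W_\alpha$ is a well defined completely isometric isomorphism of algebras from $A(\mathbf D_{f,\mathrm{rad}}^m)$ onto $\mathcal A_n(\mathbf D_f^m)$. For $G$ free holomorphic on $\mathbf D_{f,\mathrm{rad}}^m$ the following are equivalent: (i) $G\in A(\mathbf D_{f,\mathrm{rad}}^m)$; (ii) $G(rW_1,\dots,rW_n)$ converges in the operator norm as $r\to1$; (iii) there is $\varphi\in\mathcal A_n(\mathbf D_f^m)$ with $G=\mathbf B[\varphi]$. In this case $\Phi(G)=\lim_{r\to1}G(rW_1,\dots,rW_n)$ in norm, and $\Phi^{-1}(\varphi)=\mathbf B[\varphi]$ for all $\varphi\in\mathcal A_n(\mathbf D_f^m)$. -/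

import Mathlib

open Filter Topology
open scoped ENNReal TensorProduct

universe u

noncomputable section

namespace FreeHol

/-- Words in `n` letters: the free semigroup with identity on `n` generators. -/
abbrev Word (n : ℕ) := FreeMonoid (Fin n)

instance (n : ℕ) : DecidableEq (Word n) := inferInstanceAs (DecidableEq (List (Fin n)))

/-- The finite set of words of length `k`. -/
def words (n k : ℕ) : Finset (Word n) :=
  Finset.univ.image fun v : Fin k → Fin n => FreeMonoid.ofList (List.ofFn v)

theorem mem_words {n k : ℕ} {α : Word n} : α ∈ words n k ↔ α.length = k := by
  constructor
  · intro h
    obtain ⟨v, -, rfl⟩ := Finset.mem_image.1 h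
    exact List.length_ofFn
  · rintro rfl
    exact Finset.mem_image.2 ⟨fun i => (FreeMonoid.toList α).get i, Finset.mem_univ _,
      List.ofFn_get _⟩

/-- The finite set of factorizations `α = β γ` of a word. -/
instance (n : ℕ) : Finset.HasMulAntidiagonal (Word n) where
  mulAntidiagonal α := (Finset.range (α.length + 1)).image fun i =>
    (FreeMonoid.ofList ((FreeMonoid.toList α).take i),
      FreeMonoid.ofList ((FreeMonoid.toList α).drop i))
  mem_mulAntidiagonal := by
    rintro α ⟨β, γ⟩
    constructor
    · intro h
      obtain ⟨i, -, h⟩ := Finset.mem_image.1 h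
      obtain ⟨rfl, rfl⟩ := Prod.mk.inj h
      exact List.take_append_drop _ _
    · rintro rfl
      refine Finset.mem_image.2 ⟨β.length, ?_, ?_⟩
      · simp [FreeMonoid.length_mul]
      · refine Prod.ext ?_ ?_
        · exact List.take_left
        · exact List.drop_left

/-- Formal power series `∑ c_α Z_α` in `n` noncommuting indeterminates. -/
@[ext]
structure NCSeries (n : ℕ) (R : Type*) where
  /-- The coefficient of `Z_α`. -/
  coeff : Word n → R

namespace NCSeries

variable {n : ℕ} {R : Type*} [Ring R]

instance : Zero (NCSeries n R) := ⟨⟨fun _ => 0⟩⟩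

instance : One (NCSeries n R) := ⟨⟨fun α => if α = 1 then 1 else 0⟩⟩

instance : Add (NCSeries n R) := ⟨fun F G => ⟨fun α => F.coeff α + G.coeff α⟩⟩

instance : Neg (NCSeries n R) := ⟨fun F => ⟨fun α => -F.coeff α⟩⟩

/-- The Cauchy product: the coefficient of `F G` at `α` is the sum of `F_β G_γ` over all
factorizations `α = β γ`. -/
instance : Mul (NCSeries n R) :=
  ⟨fun F G => ⟨fun α => ∑ p ∈ Finset.HasMulAntidiagonal.mulAntidiagonal α,
    F.coeff p.1 * G.coeff p.2⟩⟩

instance : SMul R (NCSeries n R) := ⟨fun c F => ⟨fun α => c * F.coeff α⟩⟩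

theorem coeff_zero (α : Word n) : (0 : NCSeries n R).coeff α = 0 := rfl

theorem coeff_one (α : Word n) : (1 : NCSeries n R).coeff α = if α = 1 then 1 else 0 := rfl

theorem coeff_add (F G : NCSeries n R) (α : Word n) :
    (F + G).coeff α = F.coeff α + G.coeff α := rfl

theorem coeff_neg (F : NCSeries n R) (α : Word n) : (-F).coeff α = -F.coeff α := rfl

theorem coeff_mul (F G : NCSeries n R) (α : Word n) :
    (F * G).coeff α = ∑ p ∈ Finset.HasMulAntidiagonal.mulAntidiagonal α,
      F.coeff p.1 * G.coeff p.2 := rfl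

theorem coeff_smul (c : R) (F : NCSeries n R) (α : Word n) :
    (c • F).coeff α = c * F.coeff α := rfl

instance : Ring (NCSeries n R) :=
  Ring.ofMinimalAxioms
    (fun F G H => by ext α; simp only [coeff_add, add_assoc])
    (fun F => by ext α; simp only [coeff_add, coeff_zero, zero_add])
    (fun F => by ext α; simp only [coeff_add, coeff_neg, coeff_zero, neg_add_cancel])
    (fun F G H => by
      ext α
      simp only [coeff_mul, Finset.sum_mul, Finset.mul_sum, Finset.sum_sigma']
      apply Finset.sum_nbij' (fun ⟨⟨_i, j⟩, ⟨k, l⟩⟩ ↦ ⟨(k, l * j), (l, j)⟩)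
        (fun ⟨⟨i, _j⟩, ⟨k, l⟩⟩ ↦ ⟨(i * k, l), (i, k)⟩) <;>
        rintro ⟨⟨i, j⟩, ⟨k, l⟩⟩ <;>
        simp only [Finset.mem_sigma, Finset.HasMulAntidiagonal.mem_mulAntidiagonal] <;>
        rintro ⟨rfl, rfl⟩ <;> simp [mul_assoc])
    (fun F => by
      ext α
      rw [coeff_mul, Finset.sum_eq_single (1, α)]
      · simp [coeff_one]
      · rintro ⟨β, γ⟩ h h'
        rw [Finset.HasMulAntidiagonal.mem_mulAntidiagonal] at h
        rw [coeff_one, if_neg, zero_mul]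
        rintro h0
        apply h'
        simp only at h h0
        subst h0
        simpa using h
      · simp)
    (fun F => by
      ext α
      rw [coeff_mul, Finset.sum_eq_single (α, 1)]
      · simp [coeff_one]
      · rintro ⟨β, γ⟩ h h'
        rw [Finset.HasMulAntidiagonal.mem_mulAntidiagonal] at h
        rw [coeff_one, if_neg, mul_zero]
        rintro h0
        apply h'
        simp only at h h0
        subst h0
        simpa using h
      · simp)
    (fun F G H => by
      ext α
      simp only [coeff_mul, coeff_add, mul_add, Finset.sum_add_distrib])
    (fun F G H => by
      ext α
      simp only [coeff_mul, coeff_add, add_mul, Finset.sum_add_distrib])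

instance : Module R (NCSeries n R) where
  one_smul F := by ext α; simp only [coeff_smul, one_mul]
  mul_smul c d F := by ext α; simp only [coeff_smul, mul_assoc]
  smul_zero c := by ext α; simp only [coeff_smul, coeff_zero, mul_zero]
  smul_add c F G := by ext α; simp only [coeff_smul, coeff_add, mul_add]
  add_smul c d F := by ext α; simp only [coeff_smul, coeff_add, add_mul]
  zero_smul F := by ext α; simp only [coeff_smul, coeff_zero, zero_mul]

instance : Algebra ℂ (NCSeries n ℂ) :=
  Algebra.ofModule
    (fun c F G => by
      ext α
      simp only [coeff_mul, coeff_smul, Finset.mul_sum, mul_assoc])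
    (fun c F G => by
      ext α
      simp only [coeff_mul, coeff_smul, Finset.mul_sum]
      exact Finset.sum_congr rfl fun p _ => by ring)

variable {A : Type*} [Ring A] [Algebra ℂ A]

/-- `∑_{|α| = k} c_α X_α`, the homogeneous part of degree `k` of a series, at a tuple `X`;
here `X_α = FreeMonoid.lift X α` is the product of the entries of `X` along the word `α`. -/
def homog (F : NCSeries n ℂ) (X : Fin n → A) (k : ℕ) : A :=
  ∑ α ∈ words n k, F.coeff α • FreeMonoid.lift X α

theorem homog_mul (F G : NCSeries n ℂ) (X : Fin n → A) (k : ℕ) :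
    (F * G).homog X k = ∑ p ∈ Finset.HasAntidiagonal.antidiagonal k, F.homog X p.1 * G.homog X p.2 := by
  simp only [homog, coeff_mul, Finset.sum_smul, Finset.sum_mul_sum]
  simp only [← Finset.sum_product', Finset.sum_sigma']
  apply Finset.sum_nbij' (fun x : (_ : Word n) × (Word n × Word n) =>
      (⟨(x.2.1.length, x.2.2.length), x.2⟩ : (_ : ℕ × ℕ) × (Word n × Word n)))
    (fun x : (_ : ℕ × ℕ) × (Word n × Word n) =>
      (⟨x.2.1 * x.2.2, x.2⟩ : (_ : Word n) × (Word n × Word n)))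
  · rintro ⟨α, β, γ⟩ h
    simp only [Finset.mem_sigma, mem_words, Finset.HasMulAntidiagonal.mem_mulAntidiagonal] at h
    obtain ⟨h1, rfl⟩ := h
    simpa [mem_words, FreeMonoid.length_mul] using h1
  · rintro ⟨⟨i, j⟩, β, γ⟩ h
    simp only [Finset.mem_sigma, Finset.HasAntidiagonal.mem_antidiagonal, Finset.mem_product, mem_words] at h
    obtain ⟨h1, rfl, rfl⟩ := h
    simpa [mem_words, FreeMonoid.length_mul] using h1
  · rintro ⟨α, β, γ⟩ h
    simp only [Finset.mem_sigma, mem_words, Finset.HasMulAntidiagonal.mem_mulAntidiagonal] at h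
    obtain ⟨h1, rfl⟩ := h
    rfl
  · rintro ⟨⟨i, j⟩, β, γ⟩ h
    simp only [Finset.mem_sigma, Finset.HasAntidiagonal.mem_antidiagonal, Finset.mem_product, mem_words] at h
    obtain ⟨h1, rfl, rfl⟩ := h
    rfl
  · rintro ⟨α, β, γ⟩ h
    simp only [Finset.mem_sigma, mem_words, Finset.HasMulAntidiagonal.mem_mulAntidiagonal] at h
    obtain ⟨h1, rfl⟩ := h
    rw [map_mul, smul_mul_smul_comm]

theorem homog_add (F G : NCSeries n ℂ) (X : Fin n → A) (k : ℕ) :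
    (F + G).homog X k = F.homog X k + G.homog X k := by
  simp [homog, coeff_add, add_smul, Finset.sum_add_distrib]

theorem homog_algebraMap (c : ℂ) (X : Fin n → A) (k : ℕ) :
    (algebraMap ℂ (NCSeries n ℂ) c).homog X k = if k = 0 then algebraMap ℂ A c else 0 := by
  have hc : algebraMap ℂ (NCSeries n ℂ) c = c • 1 := Algebra.algebraMap_eq_smul_one c
  have hs : ∀ α : Word n, (c • (1 : NCSeries n ℂ)).coeff α = c * (1 : NCSeries n ℂ).coeff α :=
    fun α => rfl
  split_ifs with hk
  · subst hk
    rw [homog, Finset.sum_eq_single (1 : Word n)]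
    · simp [hc, hs, coeff_one, Algebra.algebraMap_eq_smul_one]
    · intro α hα h1
      exact absurd (FreeMonoid.length_eq_zero.1 (mem_words.1 hα)) h1
    · intro h
      exact absurd (mem_words.2 FreeMonoid.length_one) h
  · refine Finset.sum_eq_zero fun α hα => ?_
    have : α ≠ 1 := by
      rintro rfl
      exact hk (by simpa using (mem_words.1 hα).symm)
    simp [hc, hs, coeff_one, this]

theorem homog_smul (F : NCSeries n ℂ) (X : Fin n → A) (r : ℂ) (k : ℕ) :
    F.homog (r • X) k = r ^ k • F.homog X k := by
  have key : ∀ α : Word n, FreeMonoid.lift (r • X) α = r ^ α.length • FreeMonoid.lift X α := by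
    intro α
    induction α using FreeMonoid.inductionOn' with
    | one => simp
    | of_mul i β ih =>
      rw [map_mul, ih, FreeMonoid.length_mul, map_mul, pow_add]
      simp [smul_smul, mul_comm]
  rw [homog, homog, Finset.smul_sum]
  refine Finset.sum_congr rfl fun α hα => ?_
  rw [key, mem_words.1 hα, smul_comm]

end NCSeries

/-! ### Free holomorphic functions on the radial domains -/

section Domain

variable {n : ℕ}

/-- The coefficients of a positive regular free holomorphic function `f = ∑ a_α X_α`. -/
structure RegularFunction (n : ℕ) where
  /-- The series `f` itself. -/
  series : NCSeries n ℝ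
  nonneg : ∀ α, 0 ≤ series.coeff α
  coeff_one : series.coeff 1 = 0
  coeff_of_pos : ∀ i, 0 < series.coeff (FreeMonoid.of i)
  /-- The series is free holomorphic on some ball of positive radius:
  `limsup_k (∑_{|α| = k} |a_α|²)^{1/2k} < ∞`. -/
  limsup_lt_top : limsup (fun k : ℕ => ENNReal.ofReal
    ((∑ α ∈ words n k, series.coeff α ^ 2) ^ (1 / (2 * k : ℝ)))) atTop < ⊤

namespace RegularFunction

variable (f : RegularFunction n) (m : ℕ)
variable {K : Type u} [NormedAddCommGroup K] [InnerProductSpace ℂ K] [CompleteSpace K]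

/-- `Φ` is the map `Y ↦ ∑_{k ≥ 1} ∑_{|α| = k} a_α X_α Y X_α^*` on `B(K)`, the series being
convergent in the weak operator topology for every `Y`. -/
def IsPhi (X : Fin n → K →L[ℂ] K) (Φ : Module.End ℂ (K →L[ℂ] K)) : Prop :=
  ∀ (Y : K →L[ℂ] K) (x y : K), Tendsto (fun N : ℕ => ∑ k ∈ Finset.Icc 1 N, ∑ α ∈ words n k,
      (f.series.coeff α : ℂ) * inner ℂ y ((FreeMonoid.lift X α * Y *
        ContinuousLinearMap.adjoint (FreeMonoid.lift X α)) x))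
    atTop (𝓝 (inner ℂ y (Φ Y x)))

open Classical in
/-- The map `Φ_{f,X}` on `B(K)`; the value is only meaningful if the defining series converges. -/
def phi (X : Fin n → K →L[ℂ] K) : Module.End ℂ (K →L[ℂ] K) :=
  if h : ∃ Φ, f.IsPhi X Φ then h.choose else 0

/-- The operator `(id - Φ_{f,X})^k (I)`. -/
def defect (X : Fin n → K →L[ℂ] K) (k : ℕ) : K →L[ℂ] K := ((1 - f.phi X) ^ k) 1

variable (K) in
/-- The noncommutative domain `D_f^m(K)`. -/
def domain : Set (Fin n → K →L[ℂ] K) :=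
  {X | (∃ Φ, f.IsPhi X Φ) ∧ ∀ k, 1 ≤ k → k ≤ m → (f.defect X k).IsPositive}

variable (K) in
/-- The radial domain `⋃_{0 ≤ r < 1} r D_f^m(K)`. -/
def radDomain : Set (Fin n → K →L[ℂ] K) :=
  {X | ∃ r : ℝ, 0 ≤ r ∧ r < 1 ∧ ∃ Y ∈ f.domain m K, X = (r : ℂ) • Y}

end RegularFunction

/-- The value `∑_{k ≥ 0} ∑_{|α| = k} c_α X_α` of a series at a tuple, as a limit of partial sums
in the operator norm; only meaningful if the limit exists. -/
def NCSeries.eval {A : Type*} [NormedRing A] [NormedAlgebra ℂ A]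
    (F : NCSeries n ℂ) (X : Fin n → A) : A :=
  limUnder atTop (fun N : ℕ => ∑ k ∈ Finset.range N, F.homog X k)

theorem NCSeries.eval_eq {A : Type*} [NormedRing A] [NormedAlgebra ℂ A]
    {F : NCSeries n ℂ} {X : Fin n → A} {T : A} (h : HasSum (F.homog X) T) : F.eval X = T :=
  h.tendsto_sum_nat.limUnder_eq

variable (f : RegularFunction n) (m : ℕ)

/-- `F` is a free holomorphic function on the radial domain: on every Hilbert space, the series
`∑_k ∑_{|α| = k} c_α X_α` converges in the operator norm at every point of the domain. -/
def IsFreeHol (F : NCSeries n ℂ) : Prop :=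
  ∀ (K : Type u) [NormedAddCommGroup K] [InnerProductSpace ℂ K] [CompleteSpace K],
    ∀ X ∈ f.radDomain m K, ∃ T : K →L[ℂ] K,
      Tendsto (fun N : ℕ => ∑ k ∈ Finset.range N, F.homog X k) atTop (𝓝 T)

variable {f m}

theorem IsFreeHol.summable {F : NCSeries n ℂ} (hF : IsFreeHol.{u} f m F)
    {K : Type u} [NormedAddCommGroup K] [InnerProductSpace ℂ K] [CompleteSpace K]
    {X : Fin n → K →L[ℂ] K} (hX : X ∈ f.radDomain m K) :
    Summable fun k => ‖F.homog X k‖ := by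
  obtain ⟨r, hr0, hr1, Y, hY, rfl⟩ := hX
  obtain ⟨s, hrs, hs1⟩ := exists_between hr1
  have hs0 : 0 < s := hr0.trans_lt hrs
  obtain ⟨T, hT⟩ := hF K ((s : ℂ) • Y) ⟨s, hs0.le, hs1, Y, hY, rfl⟩
  have h0 : Tendsto (fun k => F.homog ((s : ℂ) • Y) k) atTop (𝓝 0) := by
    have h1 := ((tendsto_add_atTop_iff_nat 1).2 hT).sub hT
    rw [sub_self] at h1
    refine h1.congr fun N => ?_
    rw [Finset.sum_range_succ, add_sub_cancel_left]
  obtain ⟨C, hC⟩ := h0.norm.bddAbove_range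
  have hrs' : r / s < 1 := (div_lt_one hs0).2 hrs
  refine Summable.of_nonneg_of_le (fun _ => norm_nonneg _) (fun k => ?_)
    ((summable_geometric_of_lt_one (div_nonneg hr0 hs0.le) hrs').mul_right C)
  have hk : F.homog ((r : ℂ) • Y) k = ((r / s : ℝ) : ℂ) ^ k • F.homog ((s : ℂ) • Y) k := by
    rw [← NCSeries.homog_smul, smul_smul, ← Complex.ofReal_mul, div_mul_cancel₀ _ hs0.ne']
  rw [hk, norm_smul, norm_pow, Complex.norm_real, Real.norm_of_nonneg (div_nonneg hr0 hs0.le)]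
  exact mul_le_mul_of_nonneg_left (hC ⟨k, rfl⟩) (by positivity)

theorem IsFreeHol.hasSum {F : NCSeries n ℂ} (hF : IsFreeHol.{u} f m F)
    {K : Type u} [NormedAddCommGroup K] [InnerProductSpace ℂ K] [CompleteSpace K]
    {X : Fin n → K →L[ℂ] K} (hX : X ∈ f.radDomain m K) :
    HasSum (F.homog X) (F.eval X) := by
  have h := (hF.summable hX).of_norm.hasSum
  rwa [← NCSeries.eval_eq h] at h

section

variable {F G : NCSeries n ℂ} {K : Type u} [NormedAddCommGroup K] [InnerProductSpace ℂ K]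
  [CompleteSpace K] {X : Fin n → K →L[ℂ] K}

theorem IsFreeHol.hasSum_mul (hF : IsFreeHol.{u} f m F) (hG : IsFreeHol.{u} f m G)
    (hX : X ∈ f.radDomain m K) :
    HasSum ((F * G).homog X) (F.eval X * G.eval X) := by
  have hs := (summable_norm_sum_mul_antidiagonal_of_summable_norm (hF.summable hX)
    (hG.summable hX)).of_norm.hasSum
  rw [← tsum_mul_tsum_eq_tsum_sum_antidiagonal_of_summable_norm (hF.summable hX)
    (hG.summable hX), (hF.hasSum hX).tsum_eq, (hG.hasSum hX).tsum_eq] at hs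
  exact hs.congr_fun fun k => NCSeries.homog_mul F G X k

theorem IsFreeHol.hasSum_add (hF : IsFreeHol.{u} f m F) (hG : IsFreeHol.{u} f m G)
    (hX : X ∈ f.radDomain m K) :
    HasSum ((F + G).homog X) (F.eval X + G.eval X) := by
  have := (hF.hasSum hX).add (hG.hasSum hX)
  simpa only [← NCSeries.homog_add] using this

end

theorem hasSum_algebraMap {K : Type u} [NormedAddCommGroup K] [InnerProductSpace ℂ K]
    (c : ℂ) (X : Fin n → K →L[ℂ] K) :
    HasSum ((algebraMap ℂ (NCSeries n ℂ) c).homog X) (algebraMap ℂ (K →L[ℂ] K) c) := by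
  have := hasSum_ite_eq (0 : ℕ) (algebraMap ℂ (K →L[ℂ] K) c)
  exact this.congr_fun fun k => NCSeries.homog_algebraMap c X k

theorem IsFreeHol.mul {F G : NCSeries n ℂ} (hF : IsFreeHol.{u} f m F)
    (hG : IsFreeHol.{u} f m G) : IsFreeHol.{u} f m (F * G) :=
  fun _ _ _ _ _ hX => ⟨_, (hF.hasSum_mul hG hX).tendsto_sum_nat⟩

theorem IsFreeHol.add {F G : NCSeries n ℂ} (hF : IsFreeHol.{u} f m F)
    (hG : IsFreeHol.{u} f m G) : IsFreeHol.{u} f m (F + G) :=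
  fun _ _ _ _ _ hX => ⟨_, (hF.hasSum_add hG hX).tendsto_sum_nat⟩

theorem isFreeHol_algebraMap (c : ℂ) : IsFreeHol.{u} f m (algebraMap ℂ (NCSeries n ℂ) c) :=
  fun _ _ _ _ X _ => ⟨_, (hasSum_algebraMap c X).tendsto_sum_nat⟩

/-- The operator on the direct sum of `p` copies of `K` given by a `p × p` matrix of operators. -/
def matrixOp {K : Type*} [NormedAddCommGroup K] [InnerProductSpace ℂ K] {p : ℕ}
    (A : Matrix (Fin p) (Fin p) (K →L[ℂ] K)) :
    PiLp 2 (fun _ : Fin p => K) →L[ℂ] PiLp 2 (fun _ : Fin p => K) :=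
  (PiLp.continuousLinearEquiv 2 ℂ (fun _ : Fin p => K)).symm.toContinuousLinearMap ∘L
    (ContinuousLinearMap.pi fun i => ∑ j, A i j ∘L PiLp.proj 2 (fun _ : Fin p => K) j)

theorem matrixOp_apply {K : Type*} [NormedAddCommGroup K] [InnerProductSpace ℂ K] {p : ℕ}
    (A : Matrix (Fin p) (Fin p) (K →L[ℂ] K)) (x : PiLp 2 (fun _ : Fin p => K)) (i : Fin p) :
    matrixOp A x i = ∑ j, A i j (x j) := by
  simp [matrixOp]

variable (f m)

/-- `‖F‖_∞`, the supremum of `‖F(X)‖` over all points `X` of the radial domain on all Hilbert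
spaces, as an extended real. -/
def supNorm (F : NCSeries n ℂ) : ℝ≥0∞ :=
  ⨆ (K : Type u) (_ : NormedAddCommGroup K) (_ : InnerProductSpace ℂ K) (_ : CompleteSpace K)
    (X : Fin n → K →L[ℂ] K) (_ : X ∈ f.radDomain m K), ‖F.eval X‖ₑ

/-- `‖[F_ij]‖_p`, the supremum of the norms of the operator matrices `[F_ij(X)]` over all points
`X` of the radial domain on all Hilbert spaces, as an extended real. -/
def supMatrixNorm {p : ℕ} (F : Matrix (Fin p) (Fin p) (NCSeries n ℂ)) : ℝ≥0∞ :=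
  ⨆ (K : Type u) (_ : NormedAddCommGroup K) (_ : InnerProductSpace ℂ K) (_ : CompleteSpace K)
    (X : Fin n → K →L[ℂ] K) (_ : X ∈ f.radDomain m K), ‖matrixOp (F.map fun G => G.eval X)‖ₑ

variable {f m}

theorem enorm_eval_le_supNorm (F : NCSeries n ℂ) {K : Type u} [i1 : NormedAddCommGroup K]
    [i2 : InnerProductSpace ℂ K] [i3 : CompleteSpace K] {X : Fin n → K →L[ℂ] K}
    (hX : X ∈ f.radDomain m K) : ‖F.eval X‖ₑ ≤ supNorm.{u} f m F := by
  unfold supNorm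
  refine le_iSup_of_le K (le_iSup_of_le i1 (le_iSup_of_le i2 (le_iSup_of_le i3
    (le_iSup_of_le X (le_iSup_of_le hX le_rfl)))))

variable (f m)

/-- The Hardy algebra `H^∞` of bounded free holomorphic functions on the radial domain. -/
def hardyAlgebra : Subalgebra ℂ (NCSeries n ℂ) where
  carrier := {F | IsFreeHol.{u} f m F ∧ supNorm.{u} f m F < ⊤}
  mul_mem' := by
    rintro F G ⟨hF, hF'⟩ ⟨hG, hG'⟩
    refine ⟨hF.mul hG, lt_of_le_of_lt ?_ (ENNReal.mul_lt_top hF' hG')⟩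
    refine iSup_le fun K => iSup_le fun _ => iSup_le fun _ => iSup_le fun _ => iSup_le fun X =>
      iSup_le fun hX => ?_
    rw [NCSeries.eval_eq (hF.hasSum_mul hG hX)]
    refine le_trans ?_ (mul_le_mul' (enorm_eval_le_supNorm F hX) (enorm_eval_le_supNorm G hX))
    rw [← ofReal_norm, ← ofReal_norm, ← ofReal_norm,
      ← ENNReal.ofReal_mul (norm_nonneg _)]
    exact ENNReal.ofReal_le_ofReal (norm_mul_le _ _)
  add_mem' := by
    rintro F G ⟨hF, hF'⟩ ⟨hG, hG'⟩
    refine ⟨hF.add hG, lt_of_le_of_lt ?_ (ENNReal.add_lt_top.2 ⟨hF', hG'⟩)⟩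
    refine iSup_le fun K => iSup_le fun _ => iSup_le fun _ => iSup_le fun _ => iSup_le fun X =>
      iSup_le fun hX => ?_
    rw [NCSeries.eval_eq (hF.hasSum_add hG hX)]
    exact (enorm_add_le _ _).trans
      (add_le_add (enorm_eval_le_supNorm F hX) (enorm_eval_le_supNorm G hX))
  algebraMap_mem' := by
    intro c
    refine ⟨isFreeHol_algebraMap c, lt_of_le_of_lt ?_ (ENNReal.ofReal_lt_top (r := ‖c‖))⟩
    refine iSup_le fun K => iSup_le fun _ => iSup_le fun _ => iSup_le fun _ => iSup_le fun X =>
      iSup_le fun hX => ?_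
    rw [NCSeries.eval_eq (hasSum_algebraMap c X), ← ofReal_norm,
      Algebra.algebraMap_eq_smul_one, norm_smul]
    refine ENNReal.ofReal_le_ofReal (mul_le_of_le_one_right (norm_nonneg _) ?_)
    exact ContinuousLinearMap.norm_id_le

/-- The domain algebra `A` of free holomorphic functions on the radial domain which, on every
Hilbert space `K`, extend to a norm continuous map on `D_f^m(K)`. -/
def discAlgebra : Subalgebra ℂ (NCSeries n ℂ) where
  carrier := {F | IsFreeHol.{u} f m F ∧
    ∀ (K : Type u) [NormedAddCommGroup K] [InnerProductSpace ℂ K] [CompleteSpace K],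
      ∃ g : (Fin n → K →L[ℂ] K) → (K →L[ℂ] K), ContinuousOn g (f.domain m K) ∧
        ∀ X ∈ f.radDomain m K, g X = F.eval X}
  mul_mem' := by
    rintro F G ⟨hF, hF'⟩ ⟨hG, hG'⟩
    refine ⟨hF.mul hG, fun K _ _ _ => ?_⟩
    obtain ⟨g, hg, hg'⟩ := hF' K
    obtain ⟨h, hh, hh'⟩ := hG' K
    refine ⟨fun X => g X * h X, hg.mul hh, fun X hX => ?_⟩
    simp only
    rw [hg' X hX, hh' X hX, NCSeries.eval_eq (hF.hasSum_mul hG hX)]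
  add_mem' := by
    rintro F G ⟨hF, hF'⟩ ⟨hG, hG'⟩
    refine ⟨hF.add hG, fun K _ _ _ => ?_⟩
    obtain ⟨g, hg, hg'⟩ := hF' K
    obtain ⟨h, hh, hh'⟩ := hG' K
    refine ⟨fun X => g X + h X, hg.add hh, fun X hX => ?_⟩
    simp only
    rw [hg' X hX, hh' X hX, NCSeries.eval_eq (hF.hasSum_add hG hX)]
  algebraMap_mem' := by
    intro c
    refine ⟨isFreeHol_algebraMap c, fun K _ _ _ => ⟨fun _ => algebraMap ℂ _ c,
      continuousOn_const, fun X _ => ?_⟩⟩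
    rw [NCSeries.eval_eq (hasSum_algebraMap c X)]

end Domain

/-! ### The universal model on the full Fock space -/

section Fock

/-- The full Fock space on `n` generators, realized as `ℓ²` of the set of words; the orthonormal
basis vector `e_α = e_{i_1} ⊗ ⋯ ⊗ e_{i_k}` is the point mass at the word `α`. -/
abbrev Fock (n : ℕ) := lp (fun _ : Word n => ℂ) 2

variable {n : ℕ}

/-- The basis vector `e_α` of the Fock space. -/
def basisVec (α : Word n) : Fock n := lp.single 2 α 1

theorem basisVec_apply (α β : Word n) : (basisVec α : Fock n) β = if β = α then 1 else 0 := by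
  by_cases h : β = α
  · subst h; simp [basisVec, lp.single_apply]
  · simp [basisVec, lp.single_apply, h]

theorem single_eq_smul_basisVec (α : Word n) (z : ℂ) :
    (lp.single 2 α z : Fock n) = z • basisVec α := by
  ext β
  rw [lp.coeFn_smul, Pi.smul_apply, basisVec_apply, smul_eq_mul]
  by_cases h : β = α
  · subst h; simp [lp.single_apply]
  · simp [lp.single_apply, h]

theorem inner_basisVec (α : Word n) (ξ : Fock n) : inner ℂ (basisVec α) ξ = ξ α := by
  simp [basisVec, lp.inner_single_left]

theorem orthonormal_basisVec : Orthonormal ℂ (basisVec : Word n → Fock n) := by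
  rw [orthonormal_iff_ite]
  intro α β
  rw [inner_basisVec, basisVec_apply]

theorem exists_weightedShift (σ : Word n → Word n) (hσ : Function.Injective σ) (w : Word n → ℝ)
    (C : ℝ) (hw : ∀ α, |w α| ≤ C) :
    ∃ T : Fock n →L[ℂ] Fock n, ∀ α, T (basisVec α) = (w α : ℂ) • basisVec (σ α) := by
  have hC : 0 ≤ C := (abs_nonneg _).trans (hw 1)
  have hle : ∀ (ξ : Fock n) α, ‖(w α : ℂ) * ξ α‖ ≤ ‖((C : ℂ) • ξ : Fock n) α‖ := fun ξ α => by
    rw [norm_mul, Complex.norm_real, lp.coeFn_smul, Pi.smul_apply, norm_smul, Complex.norm_real,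
      Real.norm_of_nonneg hC]
    exact mul_le_mul_of_nonneg_right (hw α) (norm_nonneg _)
  have hmem : ∀ ξ : Fock n, Memℓp (fun α => (w α : ℂ) * ξ α) 2 := fun ξ =>
    (lp.memℓp ((C : ℂ) • ξ : Fock n)).mono' (hle ξ)
  let D : Fock n →ₗ[ℂ] Fock n :=
    { toFun := fun ξ => ⟨fun α => (w α : ℂ) * ξ α, hmem ξ⟩
      map_add' := fun ξ η => by
        ext α
        exact mul_add _ _ _
      map_smul' := fun c ξ => by
        ext α
        exact mul_left_comm _ _ _ }
  have hD : ∀ ξ, ‖D ξ‖ ≤ C * ‖ξ‖ := fun ξ => by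
    have h : ‖D ξ‖ ≤ ‖((C : ℂ) • ξ : Fock n)‖ := lp.norm_mono (by norm_num) (hle ξ)
    rwa [norm_smul, Complex.norm_real, Real.norm_of_nonneg hC] at h
  have hDe : ∀ α, D (basisVec α) = (w α : ℂ) • basisVec α := fun α => by
    ext β
    have h1 : D (basisVec α) β = (w β : ℂ) * basisVec α β := rfl
    rw [h1, lp.coeFn_smul, Pi.smul_apply, basisVec_apply, smul_eq_mul]
    split_ifs with h
    · rw [h]
    · simp
  have hO := (orthonormal_basisVec.comp σ hσ).orthogonalFamily
  refine ⟨hO.linearIsometry.toContinuousLinearMap ∘L D.mkContinuous C hD, fun α => ?_⟩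
  have h2 : hO.linearIsometry (basisVec α) = basisVec (σ α) := by
    rw [basisVec, hO.linearIsometry_apply_single]
    simp
  have h3 : (hO.linearIsometry.toContinuousLinearMap ∘L D.mkContinuous C hD) (basisVec α) =
      hO.linearIsometry (D (basisVec α)) := rfl
  rw [h3, hDe, map_smul, h2]

theorem clm_ext {E : Type*} [NormedAddCommGroup E] [NormedSpace ℂ E] {S T : Fock n →L[ℂ] E}
    (h : ∀ α, S (basisVec α) = T (basisVec α)) : S = T := by
  refine lp.ext_continuousLinearMap (by norm_num) fun α => ?_
  ext
  simpa [basisVec] using h α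

end Fock

/-! ### The weights and the weighted creation operators -/

namespace RegularFunction

variable {n : ℕ} (f : RegularFunction n) (m : ℕ)

/-- The weights `b_α^{(m)} = ∑_j C(j+m-1, m-1) ∑_{γ_1 ⋯ γ_j = α} a_{γ_1} ⋯ a_{γ_j}`, where `j`
runs over `1, …, |α|` and the `γ_i` are words of length at least one, and `b^{(m)} = 1` at the empty
word. Since `f` has no constant term, the inner sum is the coefficient of the power `f ^ j`
at `α`; the term `j = 0` is `1` at the empty word and vanishes at every other word. -/
def weight (α : Word n) : ℝ :=
  ∑ j ∈ Finset.range (α.length + 1), ((j + m - 1).choose (m - 1) : ℝ) * (f.series ^ j).coeff α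

theorem pow_nonneg (j : ℕ) (α : Word n) : 0 ≤ (f.series ^ j).coeff α := by
  induction j generalizing α with
  | zero =>
    rw [pow_zero, NCSeries.coeff_one]
    split_ifs <;> norm_num
  | succ j ih =>
    rw [pow_succ, NCSeries.coeff_mul]
    exact Finset.sum_nonneg fun p _ => mul_nonneg (ih _) (f.nonneg _)

theorem weight_nonneg (α : Word n) : 0 ≤ f.weight m α :=
  Finset.sum_nonneg fun j _ => mul_nonneg (Nat.cast_nonneg _) (f.pow_nonneg j α)

theorem weight_one : f.weight m 1 = 1 := by
  simp [weight, NCSeries.coeff_one]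

theorem weight_le_aux (i : Fin n) (α β : Word n) (hβ : β.length = α.length + 1)
    (h : ∀ j, f.series.coeff (FreeMonoid.of i) * (f.series ^ j).coeff α ≤
      (f.series ^ (j + 1)).coeff β) :
    f.series.coeff (FreeMonoid.of i) * f.weight m α ≤ f.weight m β := by
  rw [weight, weight, Finset.mul_sum, hβ, Finset.sum_range_succ' _ (α.length + 1)]
  refine le_add_of_le_of_nonneg (Finset.sum_le_sum fun j _ => ?_)
    (mul_nonneg (Nat.cast_nonneg _) (f.pow_nonneg _ _))
  calc f.series.coeff (FreeMonoid.of i) *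
        (((j + m - 1).choose (m - 1) : ℝ) * (f.series ^ j).coeff α)
      = ((j + m - 1).choose (m - 1) : ℝ) *
        (f.series.coeff (FreeMonoid.of i) * (f.series ^ j).coeff α) := by ring
    _ ≤ ((j + m - 1).choose (m - 1) : ℝ) * (f.series ^ (j + 1)).coeff β :=
        mul_le_mul_of_nonneg_left (h j) (Nat.cast_nonneg _)
    _ ≤ ((j + 1 + m - 1).choose (m - 1) : ℝ) * (f.series ^ (j + 1)).coeff β := by
        refine mul_le_mul_of_nonneg_right ?_ (f.pow_nonneg _ _)
        exact_mod_cast Nat.choose_le_choose _ (by omega)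

theorem weight_of_mul (i : Fin n) (α : Word n) :
    f.series.coeff (FreeMonoid.of i) * f.weight m α ≤ f.weight m (FreeMonoid.of i * α) := by
  refine f.weight_le_aux m i α _ (by rw [FreeMonoid.length_mul, FreeMonoid.length_of, add_comm])
    fun j => ?_
  rw [pow_succ', NCSeries.coeff_mul]
  exact Finset.single_le_sum
    (f := fun p : Word n × Word n => f.series.coeff p.1 * (f.series ^ j).coeff p.2)
    (fun p _ => mul_nonneg (f.nonneg _) (f.pow_nonneg _ _))
    (a := (FreeMonoid.of i, α)) (by simp)

theorem weight_mul_of (i : Fin n) (α : Word n) :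
    f.series.coeff (FreeMonoid.of i) * f.weight m α ≤ f.weight m (α * FreeMonoid.of i) := by
  refine f.weight_le_aux m i α _ (by rw [FreeMonoid.length_mul, FreeMonoid.length_of])
    fun j => ?_
  rw [pow_succ, NCSeries.coeff_mul, mul_comm]
  exact Finset.single_le_sum
    (f := fun p : Word n × Word n => (f.series ^ j).coeff p.1 * f.series.coeff p.2)
    (fun p _ => mul_nonneg (f.pow_nonneg _ _) (f.nonneg _))
    (a := (α, FreeMonoid.of i)) (by simp)

theorem weight_pos (α : Word n) : 0 < f.weight m α := by
  induction α using FreeMonoid.inductionOn' with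
  | one => rw [weight_one]; exact one_pos
  | of_mul i β ih => exact (mul_pos (f.coeff_of_pos i) ih).trans_le (f.weight_of_mul m i β)

theorem abs_sqrt_weight_le (i : Fin n) {α β : Word n}
    (h : f.series.coeff (FreeMonoid.of i) * f.weight m α ≤ f.weight m β) :
    |√(f.weight m α / f.weight m β)| ≤ √(1 / f.series.coeff (FreeMonoid.of i)) := by
  rw [abs_of_nonneg (Real.sqrt_nonneg _)]
  refine Real.sqrt_le_sqrt ?_
  rw [div_le_div_iff₀ (f.weight_pos m β) (f.coeff_of_pos i), one_mul, mul_comm]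
  exact h

/-- The weighted left creation operators of `D_f^m`: `W_i e_α = √(b_α / b_{g_i α}) e_{g_i α}`. -/
def W (i : Fin n) : Fock n →L[ℂ] Fock n :=
  (exists_weightedShift (fun α => FreeMonoid.of i * α) (mul_right_injective _)
    (fun α => √(f.weight m α / f.weight m (FreeMonoid.of i * α))) _
    fun α => f.abs_sqrt_weight_le m i (f.weight_of_mul m i α)).choose

theorem W_basisVec (i : Fin n) (α : Word n) : f.W m i (basisVec α) =
    (√(f.weight m α / f.weight m (FreeMonoid.of i * α)) : ℂ) • basisVec (FreeMonoid.of i * α) :=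
  (exists_weightedShift (fun α => FreeMonoid.of i * α) (mul_right_injective _)
    (fun α => √(f.weight m α / f.weight m (FreeMonoid.of i * α))) _
    fun α => f.abs_sqrt_weight_le m i (f.weight_of_mul m i α)).choose_spec α

/-- The weighted right creation operators of `D_f^m`:
`Λ_i e_α = √(b_α / b_{α g_i}) e_{α g_i}`. Under the flip `e_α ↦ e_α̃` they are the weighted left
creation operators of the domain of the reversed series `∑ a_α̃ Z_α`. -/
def Lam (i : Fin n) : Fock n →L[ℂ] Fock n :=
  (exists_weightedShift (fun α => α * FreeMonoid.of i) (mul_left_injective _)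
    (fun α => √(f.weight m α / f.weight m (α * FreeMonoid.of i))) _
    fun α => f.abs_sqrt_weight_le m i (f.weight_mul_of m i α)).choose

theorem Lam_basisVec (i : Fin n) (α : Word n) : f.Lam m i (basisVec α) =
    (√(f.weight m α / f.weight m (α * FreeMonoid.of i)) : ℂ) • basisVec (α * FreeMonoid.of i) :=
  (exists_weightedShift (fun α => α * FreeMonoid.of i) (mul_left_injective _)
    (fun α => √(f.weight m α / f.weight m (α * FreeMonoid.of i))) _
    fun α => f.abs_sqrt_weight_le m i (f.weight_mul_of m i α)).choose_spec α

/-- `W_β e_γ = √(b_γ / b_{βγ}) e_{βγ}`. -/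
theorem lift_W_basisVec (β γ : Word n) : FreeMonoid.lift (f.W m) β (basisVec γ) =
    (√(f.weight m γ / f.weight m (β * γ)) : ℂ) • basisVec (β * γ) := by
  induction β using FreeMonoid.inductionOn' with
  | one => simp [(f.weight_pos m γ).ne']
  | of_mul i β ih =>
    have h1 := (f.weight_pos m (β * γ)).ne'
    rw [map_mul, mul_apply_eq_comp, ih, map_smul, FreeMonoid.lift_eval_of, W_basisVec,
      smul_smul, ← Complex.ofReal_mul, ← Real.sqrt_mul (div_nonneg (f.weight_nonneg m _)
        (f.weight_nonneg m _)), div_mul_div_cancel₀ h1, mul_assoc]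

end RegularFunction

/-! ### The noncommutative Hardy algebra, the domain algebra and the Berezin transform -/

namespace RegularFunction

variable {n : ℕ} (f : RegularFunction n) (m : ℕ)

/-- `A` is the bounded operator with formal Fourier representation `∑ c_β W_β`: the coefficients
satisfy `∑ |c_β|² / b_β < ∞`, and `A p = ∑ c_β W_β p` for every polynomial `p` in the Fock
space. -/
def HasFourier (A : Fock n →L[ℂ] Fock n) (c : NCSeries n ℂ) : Prop :=
  (Summable fun β => ‖c.coeff β‖ ^ 2 / f.weight m β) ∧
    ∀ p ∈ Submodule.span ℂ (Set.range (basisVec : Word n → Fock n)),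
      HasSum (fun β => c.coeff β • FreeMonoid.lift (f.W m) β p) (A p)

/-- Auxiliary: the series `∑ √b_α ξ_α Z_α` attached to a vector `ξ` of the Fock space. -/
def toSeries (ξ : Fock n) : NCSeries n ℂ := ⟨fun α => (√(f.weight m α) : ℂ) * ξ α⟩

theorem toSeries_add (ξ η : Fock n) :
    f.toSeries m (ξ + η) = f.toSeries m ξ + f.toSeries m η := by
  ext α
  exact mul_add _ _ _

theorem toSeries_smul (c : ℂ) (ξ : Fock n) :
    f.toSeries m (c • ξ) = c • f.toSeries m ξ := by
  ext α
  exact mul_left_comm _ _ _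

theorem coeff_mul_toSeries_basisVec (c : NCSeries n ℂ) (β γ : Word n) :
    (c * f.toSeries m (basisVec γ)).coeff (β * γ) = c.coeff β * (√(f.weight m γ) : ℂ) := by
  rw [NCSeries.coeff_mul, Finset.sum_eq_single (β, γ)]
  · simp [toSeries, basisVec_apply]
  · rintro ⟨β', γ'⟩ h h'
    rw [Finset.HasMulAntidiagonal.mem_mulAntidiagonal] at h
    have : γ' ≠ γ := by
      rintro rfl
      exact h' (by simpa using h)
    simp [toSeries, basisVec_apply, this]
  · simp

theorem coeff_mul_toSeries_basisVec_of_notMem (c : NCSeries n ℂ) (γ δ : Word n)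
    (h : δ ∉ Set.range fun β => β * γ) : (c * f.toSeries m (basisVec γ)).coeff δ = 0 := by
  rw [NCSeries.coeff_mul]
  refine Finset.sum_eq_zero ?_
  rintro ⟨β', γ'⟩ h'
  rw [Finset.HasMulAntidiagonal.mem_mulAntidiagonal] at h'
  have : γ' ≠ γ := by
    rintro rfl
    exact h ⟨β', h'⟩
  simp [toSeries, basisVec_apply, this]

theorem hasFourier_iff (A : Fock n →L[ℂ] Fock n) (c : NCSeries n ℂ) :
    f.HasFourier m A c ↔ ∀ ξ, f.toSeries m (A ξ) = c * f.toSeries m ξ := by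
  have hb : ∀ α, (√(f.weight m α) : ℂ) ≠ 0 := fun α =>
    Complex.ofReal_ne_zero.2 (Real.sqrt_pos.2 (f.weight_pos m α)).ne'
  have hdiv : ∀ β γ : Word n, (√(f.weight m γ / f.weight m (β * γ)) : ℂ) =
      (√(f.weight m γ) : ℂ) / (√(f.weight m (β * γ)) : ℂ) := fun β γ => by
    rw [Real.sqrt_div (f.weight_nonneg m _), Complex.ofReal_div]
  constructor
  · rintro ⟨-, h⟩ ξ
    ext δ
    let L : Fock n →L[ℂ] ℂ := (√(f.weight m δ) : ℂ) • (lp.evalCLM ℂ (fun _ => ℂ) 2 δ ∘L A)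
    let R : Fock n →L[ℂ] ℂ := ∑ p ∈ Finset.HasMulAntidiagonal.mulAntidiagonal δ,
      c.coeff p.1 • (√(f.weight m p.2) : ℂ) • lp.evalCLM ℂ (fun _ => ℂ) 2 p.2
    have hL : ∀ ξ, L ξ = (f.toSeries m (A ξ)).coeff δ := fun ξ => rfl
    have hR : ∀ ξ, R ξ = (c * f.toSeries m ξ).coeff δ := fun ξ => by
      rw [NCSeries.coeff_mul, sum_apply]
      rfl
    rw [← hL, ← hR]
    congr 1
    refine clm_ext fun γ => ?_
    rw [hL, hR]
    have hs := (lp.evalCLM ℂ (fun _ : Word n => ℂ) 2 δ).hasSum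
      (h _ (Submodule.subset_span ⟨γ, rfl⟩))
    have hs' : HasSum (fun β => c.coeff β * ((√(f.weight m γ / f.weight m (β * γ)) : ℂ) *
        if δ = β * γ then 1 else 0)) (A (basisVec γ) δ) := by
      refine hs.congr_fun fun β => ?_
      rw [← basisVec_apply]
      simp only [map_smul, lift_W_basisVec]
      rfl
    have hv : (f.toSeries m (A (basisVec γ))).coeff δ =
        (√(f.weight m δ) : ℂ) * A (basisVec γ) δ := rfl
    by_cases hδ : δ ∈ Set.range fun β => β * γ
    · obtain ⟨β, rfl⟩ := hδ
      have h1 := hasSum_single (f := fun β' => c.coeff β' *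
        ((√(f.weight m γ / f.weight m (β' * γ)) : ℂ) * if β * γ = β' * γ then 1 else 0)) β
        (fun β' hβ' => by
          rw [if_neg (fun h => hβ' (mul_right_cancel h).symm), mul_zero, mul_zero])
      rw [hv, hs'.unique h1, coeff_mul_toSeries_basisVec, if_pos rfl, hdiv]
      field_simp [hb]
    · rw [hv, coeff_mul_toSeries_basisVec_of_notMem _ _ _ _ _ hδ]
      have h1 : ∀ β, (c.coeff β * ((√(f.weight m γ / f.weight m (β * γ)) : ℂ) *
        if δ = β * γ then 1 else 0)) = 0 := fun β => by
        rw [if_neg (fun h => hδ ⟨β, h.symm⟩), mul_zero, mul_zero]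
      simp only [h1] at hs'
      rw [hs'.unique hasSum_zero, mul_zero]
  · intro h
    have hc : ∀ β γ, (√(f.weight m (β * γ)) : ℂ) * A (basisVec γ) (β * γ) =
        c.coeff β * (√(f.weight m γ) : ℂ) := fun β γ => by
      rw [← coeff_mul_toSeries_basisVec, ← h]
      rfl
    refine ⟨?_, fun p hp => ?_⟩
    · have h1 := (lp.memℓp (A (basisVec 1))).summable (by norm_num)
      refine h1.congr fun β => ?_
      have h2 := hc β 1
      rw [mul_one, weight_one, Real.sqrt_one, Complex.ofReal_one, mul_one] at h2
      rw [← h2, norm_mul, mul_pow, Complex.norm_real, Real.norm_of_nonneg (Real.sqrt_nonneg _),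
        Real.sq_sqrt (f.weight_nonneg m _), mul_div_cancel_left₀ _ (f.weight_pos m β).ne']
      simp
    · induction hp using Submodule.span_induction with
      | mem x hx =>
        obtain ⟨γ, rfl⟩ := hx
        have h1 := lp.hasSum_single (by norm_num) (A (basisVec γ))
        rw [← (mul_left_injective γ).hasSum_iff] at h1
        · refine h1.congr_fun fun β => ?_
          rw [lift_W_basisVec, smul_smul, hdiv, ← mul_div_assoc, ← hc,
            mul_div_cancel_left₀ _ (hb _)]
          exact (single_eq_smul_basisVec _ _).symm
        · intro δ hδ
          have h2 : (√(f.weight m δ) : ℂ) * A (basisVec γ) δ = 0 := by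
            rw [← coeff_mul_toSeries_basisVec_of_notMem f m c γ δ hδ, ← h]
            rfl
          rw [(mul_eq_zero.1 h2).resolve_left (hb δ), lp.single_zero]
      | zero => simp
      | add x y _ _ hx hy => simpa only [map_add, smul_add] using hx.add hy
      | smul a x _ hx =>
        have h1 := hx.const_smul a
        simpa only [map_smul, smul_comm a] using h1

/-- The noncommutative Hardy algebra `F_n^∞(D_f^m)` of all bounded operators on the Fock space with
a formal Fourier representation `∑ c_β W_β`. -/
def hardyOperators : Subalgebra ℂ (Fock n →L[ℂ] Fock n) where
  carrier := {A | ∃ c, f.HasFourier m A c}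
  mul_mem' := by
    rintro A B ⟨c, hA⟩ ⟨d, hB⟩
    rw [hasFourier_iff] at hA hB
    refine ⟨c * d, (f.hasFourier_iff m _ _).2 fun ξ => ?_⟩
    rw [mul_apply_eq_comp, hA, hB, mul_assoc]
  add_mem' := by
    rintro A B ⟨c, hA⟩ ⟨d, hB⟩
    rw [hasFourier_iff] at hA hB
    refine ⟨c + d, (f.hasFourier_iff m _ _).2 fun ξ => ?_⟩
    rw [add_apply, toSeries_add, hA, hB, add_mul]
  algebraMap_mem' := by
    intro r
    refine ⟨algebraMap ℂ _ r, (f.hasFourier_iff m _ _).2 fun ξ => ?_⟩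
    rw [ContinuousLinearMap.algebraMap_apply, toSeries_smul, Algebra.smul_def]

/-- The noncommutative domain algebra `A_n(D_f^m)`: the norm closure of the polynomials in
`W_1, …, W_n` and the identity. -/
def domainAlgebra : Subalgebra ℂ (Fock n →L[ℂ] Fock n) :=
  (Algebra.adjoin ℂ (Set.range (f.W m))).topologicalClosure

section Berezin

variable {K : Type u} [NormedAddCommGroup K] [InnerProductSpace ℂ K] [CompleteSpace K]

/-- The operator `g ⊗ T` on the Hilbert space tensor product of the Fock space with `K`. -/
def tensorOp (g : Fock n →L[ℂ] Fock n) (T : K →L[ℂ] K) :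
    UniformSpace.Completion (Fock n ⊗[ℂ] K) →L[ℂ] UniformSpace.Completion (Fock n ⊗[ℂ] K) :=
  (TensorProduct.mapL g T).completion

variable (n K) in
/-- The isometry `x ↦ 1 ⊗ x`, where `1 = e_{g_0}` is the vacuum vector. -/
def vacuum : K →L[ℂ] UniformSpace.Completion (Fock n ⊗[ℂ] K) :=
  UniformSpace.Completion.toComplL ∘L TensorProduct.mkL ℂ (Fock n) K (basisVec 1)

/-- The operator `∑_{|α| ≥ 1} a_α̃ Λ_α ⊗ X_α̃^*`, where `α̃` is the reverse of `α`; the series is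
summed by degree in the operator norm. -/
def reconstruction (X : Fin n → K →L[ℂ] K) :
    UniformSpace.Completion (Fock n ⊗[ℂ] K) →L[ℂ] UniformSpace.Completion (Fock n ⊗[ℂ] K) :=
  ∑' k : ℕ, ∑ α ∈ words n (k + 1), (f.series.coeff α.reverse : ℂ) •
    tensorOp (FreeMonoid.lift (f.Lam m) α)
      (ContinuousLinearMap.adjoint (FreeMonoid.lift X α.reverse))

/-- The noncommutative Berezin transform `B_X[g]` at a point `X` of the radial domain, determined
by `⟨B_X[g] x, y⟩ = ⟨(I - R^*)^{-m} (g ⊗ Δ²) (I - R)^{-m} (1 ⊗ x), 1 ⊗ y⟩`, where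
`R = ∑_{|α| ≥ 1} a_α̃ Λ_α ⊗ X_α̃^*` and `Δ² = (id - Φ_{f,X})^m (I)`. -/
def berezin (X : Fin n → K →L[ℂ] K) (g : Fock n →L[ℂ] Fock n) : K →L[ℂ] K :=
  let P := Ring.inverse ((1 - f.reconstruction m X) ^ m)
  ContinuousLinearMap.adjoint (vacuum n K) ∘L ContinuousLinearMap.adjoint P ∘L
    tensorOp g (f.defect X m) ∘L P ∘L vacuum n K

end Berezin

end RegularFunction

end FreeHol

end

open FreeHol

/-!
Everything rests on the universal model `W`. It is itself a point of `D_f^m` (`W_mem_domain`),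
because `(id - Φ_{f,W})^k (I)` is diagonal with nonnegative entries: multiplying the weights, the
coefficients of `(1 - f)^{-m}`, by `(1 - f)^k` leaves the coefficients of `(1 - f)^{-(m-k)}`.

Conversely, `W` dominates every point `X` of the radial domain. The vector `(I - R)^{-m} (1 ⊗ x)`
has the coordinates `√b_α X_α^* x`, since they obey the recursion of the coefficients of
`(1 - f)^{-m}` (`tensorCoord_inverse_pow`). The adjoint `e_α ⊗ z ↦ √b_α X_α z` intertwines
`φ = ∑ c_α W_α` with `∑ c_α X_α` (`kernelMap_intertwines`), and it is normalized by
`∑ b_α X_α (id - Φ_{f,X})^m (I) X_α^* = I` (`hasSum_invPow_defect`), which telescopes. This gives both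
`B_X[φ] = ∑ c_α X_α` (`berezin_eq`) and, when `(id - Φ_{f,X})^m (I)` is positive, the von Neumann
inequality for matrices (`norm_matrixOp_le`).

The positivity is available on every Hilbert space. Starlikeness is assumed on one infinite
dimensional space only, but positivity is tested one vector at a time, each vector lies in a
separable subspace reducing the tuple, and such a subspace embeds into the given space
(`smul_mem_domain`). The same embedding carries a copy of `W` into that space
(`exists_transport_W_mem_domain`), so that the values at `rW`, an operator tuple on `ℓ²` of the
words, are compressions of values at a point of the radial domain in the universe under
consideration.

For the Hardy algebra, a multiplier `φ` has homogeneous parts bounded by `‖φ‖`, so by the von Neumann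
inequality its series converges geometrically on the radial domain and is bounded by `‖φ‖` there.
In the other direction, a series whose values at `rW` are bounded has a multiplier as strong limit
(`exists_hasFourier_of_bounded`, `tendsto_of_hasFourier_dilate`), and this limit attains the norm
(`le_supMatrixNorm`). For the domain algebra, a continuous extension makes the values at `rW`
converge in norm; and the multipliers whose series extend continuously form a norm closed algebra
containing the `W_i`, the extensions being uniform limits (`exists_hasFourier_of_mem_domainAlgebra`).
-/

noncomputable section

namespace FreeHol

universe v w

/-! ### Summation over words -/

section Words

variable {n : ℕ}

/-- The finite set of words of length less than `N`. -/
def wordsBelow (n N : ℕ) : Finset (Word n) := (Finset.range N).biUnion (words n)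

theorem mem_wordsBelow {N : ℕ} {α : Word n} : α ∈ wordsBelow n N ↔ α.length < N := by
  simp [wordsBelow, mem_words]

theorem sum_wordsBelow {E : Type*} [AddCommMonoid E] (g : Word n → E) (N : ℕ) :
    ∑ α ∈ wordsBelow n N, g α = ∑ k ∈ Finset.range N, ∑ α ∈ words n k, g α := by
  refine Finset.sum_biUnion fun i _ j _ hij => ?_
  refine Finset.disjoint_left.2 fun α hi hj => hij ?_
  rw [← mem_words.1 hi, mem_words.1 hj]

theorem tendsto_wordsBelow (n : ℕ) : Tendsto (wordsBelow n) atTop atTop := by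
  refine tendsto_atTop_finset_of_monotone (fun N M h α hα => ?_) fun α => ⟨α.length + 1, ?_⟩
  · exact mem_wordsBelow.2 ((mem_wordsBelow.1 hα).trans_le h)
  · exact mem_wordsBelow.2 (Nat.lt_succ_self _)

theorem tendsto_sum_words {E : Type*} [AddCommMonoid E] [TopologicalSpace E] {g : Word n → E}
    {s : E} (h : HasSum g s) :
    Tendsto (fun N => ∑ k ∈ Finset.range N, ∑ α ∈ words n k, g α) atTop (𝓝 s) := by
  simp only [← sum_wordsBelow]
  have h' : Tendsto (fun u : Finset (Word n) => ∑ α ∈ u, g α) atTop (𝓝 s) := by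
    simpa [HasSum] using h
  exact h'.comp (tendsto_wordsBelow n)

/-- A summand that vanishes at the empty word may be summed over the degrees `1, …, N`. -/
theorem sum_Icc_words {E : Type*} [AddCommMonoid E] {g : Word n → E} (h : g 1 = 0) (N : ℕ) :
    ∑ k ∈ Finset.Icc 1 N, ∑ α ∈ words n k, g α =
      ∑ k ∈ Finset.range (N + 1), ∑ α ∈ words n k, g α := by
  have h0 : ∑ α ∈ words n 0, g α = 0 := by
    refine Finset.sum_eq_zero fun α hα => ?_
    rw [FreeMonoid.length_eq_zero.1 (mem_words.1 hα), h]
  rw [Finset.sum_range_succ', h0, add_zero, Finset.range_eq_Ico, Finset.sum_Ico_add'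
    (fun k => ∑ α ∈ words n k, g α)]
  rfl

theorem tendsto_sum_Icc_words {E : Type*} [AddCommMonoid E] [TopologicalSpace E]
    {g : Word n → E} (h : g 1 = 0) {s : E} (hs : HasSum g s) :
    Tendsto (fun N => ∑ k ∈ Finset.Icc 1 N, ∑ α ∈ words n k, g α) atTop (𝓝 s) := by
  simp only [sum_Icc_words h]
  exact (tendsto_add_atTop_iff_nat 1).2 (tendsto_sum_words hs)

/-- A nonnegative function on words is summable as soon as its partial sums over all words of
bounded length converge. -/
theorem hasSum_of_tendsto_sum_words {g : Word n → ℝ} (hg : ∀ α, 0 ≤ g α) {s : ℝ}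
    (h : Tendsto (fun N => ∑ k ∈ Finset.range N, ∑ α ∈ words n k, g α) atTop (𝓝 s)) :
    HasSum g s := by
  simp only [← sum_wordsBelow] at h
  obtain ⟨C, hC⟩ := h.bddAbove_range
  have hsum : Summable g := summable_of_sum_le hg (c := C) fun u => by
    obtain ⟨N, hN⟩ := ((tendsto_wordsBelow n).eventually_ge_atTop u).exists
    exact (Finset.sum_le_sum_of_subset_of_nonneg hN fun α _ _ => hg α).trans (hC ⟨N, rfl⟩)
  have h1 := tendsto_sum_words hsum.hasSum
  simp only [← sum_wordsBelow] at h1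
  rw [tendsto_nhds_unique h h1]
  exact hsum.hasSum

/-- A double series over words may be summed by the product of the two words. -/
theorem ennreal_tsum_antidiagonal (g : Word n → Word n → ℝ≥0∞) :
    ∑' α, ∑' β, g α β =
      ∑' δ, ∑ p ∈ Finset.HasMulAntidiagonal.mulAntidiagonal δ, g p.1 p.2 := by
  rw [← ENNReal.tsum_prod,
    ← (Finset.HasMulAntidiagonal.sigmaMulAntidiagonalEquivProd (A := Word n)).tsum_eq, ENNReal.tsum_sigma']
  refine tsum_congr fun δ => ?_
  exact Finset.tsum_subtype (Finset.HasMulAntidiagonal.mulAntidiagonal δ)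
    (fun p : Word n × Word n => g p.1 p.2)

theorem hasSum_antidiagonal {E : Type*} [NormedAddCommGroup E] {g : Word n × Word n → E} {s : E}
    (h : HasSum g s) :
    HasSum (fun δ => ∑ p ∈ Finset.HasMulAntidiagonal.mulAntidiagonal δ, g p) s := by
  rw [← (Finset.HasMulAntidiagonal.sigmaMulAntidiagonalEquivProd (A := Word n)).hasSum_iff] at h
  exact h.sigma fun δ => (Finset.HasMulAntidiagonal.mulAntidiagonal δ).hasSum g

theorem summable_of_antidiagonal {g : Word n × Word n → ℝ} (hg : ∀ p, 0 ≤ g p)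
    (h : Summable fun δ => ∑ p ∈ Finset.HasMulAntidiagonal.mulAntidiagonal δ, g p) :
    Summable g := by
  rw [← (Finset.HasMulAntidiagonal.sigmaMulAntidiagonalEquivProd (A := Word n)).summable_iff]
  refine (summable_sigma_of_nonneg fun x => hg _).2
    ⟨fun δ => Summable.of_finite, h.congr fun δ => ?_⟩
  exact (Finset.tsum_subtype (Finset.HasMulAntidiagonal.mulAntidiagonal δ) g).symm

theorem fst_injOn_antidiagonal (δ : Word n) :
    Set.InjOn Prod.fst (Finset.HasMulAntidiagonal.mulAntidiagonal δ : Set (Word n × Word n)) := by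
  rintro ⟨a, b⟩ h ⟨c, d⟩ h' hac
  simp only [Finset.mem_coe, Finset.HasMulAntidiagonal.mem_mulAntidiagonal] at h h' hac
  subst hac
  rw [← h'] at h
  rw [mul_left_cancel h]

/-- A sum over words that is supported on the initial segments of `δ` is a sum over the
factorizations of `δ`. -/
theorem hasSum_of_prefix {E : Type*} [AddCommMonoid E] [TopologicalSpace E] (δ : Word n)
    {g : Word n → E} (hg : ∀ α, (∀ γ, α * γ ≠ δ) → g α = 0) :
    HasSum g (∑ p ∈ Finset.HasMulAntidiagonal.mulAntidiagonal δ, g p.1) := by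
  rw [← Finset.sum_image (f := g) (fst_injOn_antidiagonal δ)]
  refine hasSum_sum_of_ne_finset_zero fun α hα => hg α fun γ hγ => hα ?_
  exact Finset.mem_image.2 ⟨(α, γ), Finset.HasMulAntidiagonal.mem_mulAntidiagonal.2 hγ, rfl⟩

theorem length_fst_le {δ : Word n} {p : Word n × Word n}
    (hp : p ∈ Finset.HasMulAntidiagonal.mulAntidiagonal δ) : p.1.length ≤ δ.length := by
  rw [← Finset.HasMulAntidiagonal.mem_mulAntidiagonal.1 hp, FreeMonoid.length_mul]
  exact Nat.le_add_right _ _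

theorem length_snd_le {δ : Word n} {p : Word n × Word n}
    (hp : p ∈ Finset.HasMulAntidiagonal.mulAntidiagonal δ) : p.2.length ≤ δ.length := by
  rw [← Finset.HasMulAntidiagonal.mem_mulAntidiagonal.1 hp, FreeMonoid.length_mul]
  exact Nat.le_add_left _ _

end Words

/-! ### The coefficients of the powers of `(1 - f)⁻¹` -/

namespace RegularFunction

variable {n : ℕ} (f : RegularFunction n)

/-- The series `(1 - f)^{-k} = ∑_j C(k+j-1, j) f^j`. For `k ≥ 1` its coefficients are the weights
`b_α^{(k)}`; unlike these it has the right value, the series `1`, at `k = 0`. -/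
def invPow (k : ℕ) : NCSeries n ℝ :=
  ⟨fun α => ∑ j ∈ Finset.range (α.length + 1), (k.multichoose j : ℝ) * (f.series ^ j).coeff α⟩

theorem coeff_pow_eq_zero {j : ℕ} {α : Word n} (h : α.length < j) :
    (f.series ^ j).coeff α = 0 := by
  induction j generalizing α with
  | zero => exact absurd h (Nat.not_lt_zero _)
  | succ j ih =>
    rw [pow_succ, NCSeries.coeff_mul]
    refine Finset.sum_eq_zero fun p hp => ?_
    by_cases hp1 : p.1.length < j
    · rw [ih hp1, zero_mul]
    · have h1 := congrArg FreeMonoid.length (Finset.HasMulAntidiagonal.mem_mulAntidiagonal.1 hp)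
      rw [FreeMonoid.length_mul] at h1
      have h2 : p.2 = 1 := FreeMonoid.length_eq_zero.1 (by omega)
      rw [h2, f.coeff_one, mul_zero]

theorem coeff_invPow (k : ℕ) {α : Word n} {N : ℕ} (h : α.length < N) :
    (f.invPow k).coeff α =
      ∑ j ∈ Finset.range N, (k.multichoose j : ℝ) * (f.series ^ j).coeff α := by
  refine Finset.sum_subset (Finset.range_mono h) fun j _ hj => ?_
  rw [f.coeff_pow_eq_zero (by simpa using hj), mul_zero]

theorem invPow_zero : f.invPow 0 = 1 := by
  ext α
  rw [f.coeff_invPow 0 (Nat.lt_succ_self _), Finset.sum_range_succ']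
  simp

theorem coeff_invPow_nonneg (k : ℕ) (α : Word n) : 0 ≤ (f.invPow k).coeff α :=
  Finset.sum_nonneg (s := Finset.range (α.length + 1)) fun j _ =>
    mul_nonneg (Nat.cast_nonneg (k.multichoose j)) (f.pow_nonneg j α)

theorem coeff_invPow_succ (k : ℕ) (α : Word n) : (f.invPow (k + 1)).coeff α =
    (f.invPow k).coeff α + ∑ j ∈ Finset.range (α.length + 1),
      ((k + 1).multichoose j : ℝ) * (f.series ^ (j + 1)).coeff α := by
  have h : α.length < α.length + 1 + 1 := by omega
  rw [f.coeff_invPow (k + 1) h, f.coeff_invPow k h, Finset.sum_range_succ' _ (α.length + 1),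
    Finset.sum_range_succ' _ (α.length + 1)]
  simp only [Nat.multichoose_succ_succ, Nat.multichoose_zero_right, Nat.cast_add, add_mul,
    Finset.sum_add_distrib]
  ring

/-- `(1 - f)^{-k} = (1 - f)^{-(k+1)} (1 - f)`. -/
theorem invPow_succ_eq_add_mul (k : ℕ) :
    f.invPow (k + 1) = f.invPow k + f.invPow (k + 1) * f.series := by
  ext α
  rw [coeff_invPow_succ, NCSeries.coeff_add, NCSeries.coeff_mul]
  congr 1
  simp only [pow_succ f.series, NCSeries.coeff_mul, Finset.mul_sum]
  rw [Finset.sum_comm]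
  refine Finset.sum_congr rfl fun p hp => ?_
  rw [f.coeff_invPow (k + 1) (Nat.lt_succ_of_le (length_fst_le hp)), Finset.sum_mul]
  exact Finset.sum_congr rfl fun j _ => by ring

/-- `(1 - f)^{-k} = (1 - f) (1 - f)^{-(k+1)}`. -/
theorem invPow_succ_eq_mul_add (k : ℕ) :
    f.invPow (k + 1) = f.invPow k + f.series * f.invPow (k + 1) := by
  ext α
  rw [coeff_invPow_succ, NCSeries.coeff_add, NCSeries.coeff_mul]
  congr 1
  simp only [pow_succ' f.series, NCSeries.coeff_mul, Finset.mul_sum]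
  rw [Finset.sum_comm]
  refine Finset.sum_congr rfl fun p hp => ?_
  rw [f.coeff_invPow (k + 1) (Nat.lt_succ_of_le (length_snd_le hp)), Finset.mul_sum]
  exact Finset.sum_congr rfl fun j _ => by ring

theorem coeff_invPow_mono {k l : ℕ} (h : k ≤ l) (α : Word n) :
    (f.invPow k).coeff α ≤ (f.invPow l).coeff α := by
  induction h with
  | refl => exact le_rfl
  | step _ ih =>
    refine ih.trans ?_
    rw [Nat.succ_eq_add_one, coeff_invPow_succ]
    exact le_add_of_nonneg_right (Finset.sum_nonneg fun j _ =>
      mul_nonneg (Nat.cast_nonneg _) (f.pow_nonneg _ α))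

theorem weight_eq_coeff_invPow {m : ℕ} (hm : 1 ≤ m) (α : Word n) :
    f.weight m α = (f.invPow m).coeff α := by
  refine Finset.sum_congr rfl fun j _ => ?_
  have h : m - 1 + j = j + m - 1 := by omega
  rw [Nat.multichoose_eq, add_comm m j, ← h, Nat.choose_symm_add]

theorem sum_coeff_mul_weight_le {m : ℕ} (hm : 1 ≤ m) (δ : Word n) :
    ∑ p ∈ Finset.HasMulAntidiagonal.mulAntidiagonal δ, f.series.coeff p.1 * f.weight m p.2 ≤
      f.weight m δ := by
  obtain ⟨k, rfl⟩ := Nat.exists_eq_add_of_le' hm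
  simp only [f.weight_eq_coeff_invPow hm]
  conv_rhs => rw [invPow_succ_eq_mul_add, NCSeries.coeff_add]
  exact le_add_of_nonneg_left (f.coeff_invPow_nonneg k δ)

theorem sum_weight_mul_coeff_le {m : ℕ} (hm : 1 ≤ m) (δ : Word n) :
    ∑ p ∈ Finset.HasMulAntidiagonal.mulAntidiagonal δ, f.weight m p.1 * f.series.coeff p.2 ≤
      f.weight m δ := by
  obtain ⟨k, rfl⟩ := Nat.exists_eq_add_of_le' hm
  simp only [f.weight_eq_coeff_invPow hm]
  conv_rhs => rw [invPow_succ_eq_add_mul, NCSeries.coeff_add]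
  exact le_add_of_nonneg_left (f.coeff_invPow_nonneg k δ)

end RegularFunction

/-! ### The map `Φ_{f,X}` -/

section Phi

open ContinuousLinearMap (adjoint)

variable {n : ℕ} {K : Type v} [NormedAddCommGroup K] [InnerProductSpace ℂ K]

theorem lift_smul (r : ℂ) (X : Fin n → K →L[ℂ] K) (α : Word n) :
    FreeMonoid.lift (r • X) α = r ^ α.length • FreeMonoid.lift X α := by
  induction α using FreeMonoid.inductionOn' with
  | one => simp
  | of_mul i β ih =>
    rw [map_mul, ih, FreeMonoid.length_mul, map_mul, pow_add]
    simp [smul_smul, mul_comm]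

variable [CompleteSpace K]

theorem adjoint_lift_mul (X : Fin n → K →L[ℂ] K) (α β : Word n) (x : K) :
    adjoint (FreeMonoid.lift X (α * β)) x =
      adjoint (FreeMonoid.lift X β) (adjoint (FreeMonoid.lift X α) x) := by
  refine ext_inner_right ℂ fun y => ?_
  simp only [ContinuousLinearMap.adjoint_inner_left, map_mul, mul_apply_eq_comp]

theorem adjoint_lift_one (X : Fin n → K →L[ℂ] K) (x : K) :
    adjoint (FreeMonoid.lift X 1) x = x := by
  refine ext_inner_right ℂ fun y => ?_
  simp only [ContinuousLinearMap.adjoint_inner_left, map_one, one_apply_eq_self]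

theorem norm_adjoint_lift_smul {r : ℝ} (hr : 0 ≤ r) (X : Fin n → K →L[ℂ] K) (α : Word n) (x : K) :
    ‖adjoint (FreeMonoid.lift ((r : ℂ) • X) α) x‖ =
      r ^ α.length * ‖adjoint (FreeMonoid.lift X α) x‖ := by
  rw [lift_smul, map_smulₛₗ, smul_apply, norm_smul]
  simp [abs_of_nonneg hr]

namespace RegularFunction

variable (f : RegularFunction n)

/-- `∑_α a_α ‖X_α^* x‖²`, the quadratic form of `Φ_{f,X}(I)`. -/
def rowSq (X : Fin n → K →L[ℂ] K) (x : K) : ℝ≥0∞ :=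
  ∑' α, ENNReal.ofReal (f.series.coeff α) * ‖adjoint (FreeMonoid.lift X α) x‖ₑ ^ 2

variable {f} {X : Fin n → K →L[ℂ] K}

theorem coeff_mul_sq_nonneg (α : Word n) (x : K) :
    0 ≤ f.series.coeff α * ‖adjoint (FreeMonoid.lift X α) x‖ ^ 2 :=
  mul_nonneg (f.nonneg α) (sq_nonneg _)

theorem rowSq_eq (x : K) : f.rowSq X x =
    ∑' α, ENNReal.ofReal (f.series.coeff α * ‖adjoint (FreeMonoid.lift X α) x‖ ^ 2) := by
  refine tsum_congr fun α => ?_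
  rw [ENNReal.ofReal_mul (f.nonneg α), ENNReal.ofReal_pow (norm_nonneg _), ofReal_norm]

theorem sum_le_of_rowSq_le {C : ℝ} (hC : 0 ≤ C) {x : K}
    (h : f.rowSq X x ≤ ENNReal.ofReal C) (s : Finset (Word n)) :
    ∑ α ∈ s, f.series.coeff α * ‖adjoint (FreeMonoid.lift X α) x‖ ^ 2 ≤ C := by
  rw [← ENNReal.ofReal_le_ofReal_iff hC,
    ENNReal.ofReal_sum_of_nonneg fun α _ => coeff_mul_sq_nonneg α x]
  exact (ENNReal.sum_le_tsum s).trans ((rowSq_eq x).symm.trans_le h)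

theorem IsPhi.hasSum_sq {Φ : Module.End ℂ (K →L[ℂ] K)} (h : f.IsPhi X Φ) (x : K) :
    HasSum (fun α => f.series.coeff α * ‖adjoint (FreeMonoid.lift X α) x‖ ^ 2)
      (RCLike.re (inner ℂ x (Φ 1 x))) := by
  refine hasSum_of_tendsto_sum_words (fun α => coeff_mul_sq_nonneg α x) ?_
  rw [← tendsto_add_atTop_iff_nat 1]
  have h0 : f.series.coeff 1 * ‖adjoint (FreeMonoid.lift X 1) x‖ ^ 2 = 0 := by
    rw [f.coeff_one, zero_mul]
  simp only [← sum_Icc_words (g := fun α => f.series.coeff α *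
    ‖adjoint (FreeMonoid.lift X α) x‖ ^ 2) h0]
  have h1 := (RCLike.continuous_re.tendsto _).comp (h 1 x x)
  refine h1.congr fun N => ?_
  simp only [Function.comp, map_sum]
  refine Finset.sum_congr rfl fun k _ => Finset.sum_congr rfl fun α _ => ?_
  rw [mul_one, mul_apply_eq_comp, ← ContinuousLinearMap.adjoint_inner_left,
    inner_self_eq_norm_sq_to_K]
  simp [← Complex.ofReal_pow]

theorem IsPhi.rowSq_eq {Φ : Module.End ℂ (K →L[ℂ] K)} (h : f.IsPhi X Φ) (x : K) :
    f.rowSq X x = ENNReal.ofReal (RCLike.re (inner ℂ x (Φ 1 x))) := by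
  rw [RegularFunction.rowSq_eq, ← ENNReal.ofReal_tsum_of_nonneg (fun α => coeff_mul_sq_nonneg α x)
    (h.hasSum_sq x).summable, (h.hasSum_sq x).tsum_eq]

theorem summable_of_row (Y : K →L[ℂ] K) {x y : K}
    (hx : Summable fun α => f.series.coeff α * ‖adjoint (FreeMonoid.lift X α) x‖ ^ 2)
    (hy : Summable fun α => f.series.coeff α * ‖adjoint (FreeMonoid.lift X α) y‖ ^ 2) :
    Summable fun α => (f.series.coeff α : ℂ) * inner ℂ (adjoint (FreeMonoid.lift X α) y)
      (Y (adjoint (FreeMonoid.lift X α) x)) := by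
  refine Summable.of_norm_bounded ((hx.add hy).mul_left ‖Y‖) fun α => ?_
  rw [norm_mul, Complex.norm_real, Real.norm_of_nonneg (f.nonneg α)]
  have h1 : ‖inner ℂ (adjoint (FreeMonoid.lift X α) y) (Y (adjoint (FreeMonoid.lift X α) x))‖ ≤
      ‖Y‖ * (‖adjoint (FreeMonoid.lift X α) x‖ ^ 2 + ‖adjoint (FreeMonoid.lift X α) y‖ ^ 2) := by
    refine (norm_inner_le_norm _ _).trans ((mul_le_mul_of_nonneg_left (Y.le_opNorm _)
      (norm_nonneg _)).trans ?_)
    set p := ‖adjoint (FreeMonoid.lift X α) x‖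
    set q := ‖adjoint (FreeMonoid.lift X α) y‖
    have : q * p ≤ p ^ 2 + q ^ 2 := by nlinarith [sq_nonneg (p - q), sq_nonneg p, sq_nonneg q]
    calc q * (‖Y‖ * p) = ‖Y‖ * (q * p) := by ring
      _ ≤ _ := mul_le_mul_of_nonneg_left this (norm_nonneg _)
  calc _ ≤ f.series.coeff α * (‖Y‖ * (‖adjoint (FreeMonoid.lift X α) x‖ ^ 2 +
        ‖adjoint (FreeMonoid.lift X α) y‖ ^ 2)) := mul_le_mul_of_nonneg_left h1 (f.nonneg α)
    _ = _ := by ring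

theorem IsPhi.of_hasSum {Φ : Module.End ℂ (K →L[ℂ] K)}
    (h : ∀ (Y : K →L[ℂ] K) (x y : K), HasSum (fun α => (f.series.coeff α : ℂ) *
      inner ℂ (adjoint (FreeMonoid.lift X α) y) (Y (adjoint (FreeMonoid.lift X α) x)))
      (inner ℂ y (Φ Y x))) : f.IsPhi X Φ := by
  intro Y x y
  refine (tendsto_sum_Icc_words (by simp [f.coeff_one]) (h Y x y)).congr fun N => ?_
  refine Finset.sum_congr rfl fun k _ => Finset.sum_congr rfl fun α _ => ?_
  rw [ContinuousLinearMap.adjoint_inner_left]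
  rfl

/-- The defining series of `Φ_{f,X}`, summed by degree, converges unconditionally: applied to the
identity its terms are nonnegative, and the Cauchy-Schwarz inequality dominates all other values. -/
theorem IsPhi.hasSum {Φ : Module.End ℂ (K →L[ℂ] K)} (h : f.IsPhi X Φ) (Y : K →L[ℂ] K) (x y : K) :
    HasSum (fun α => (f.series.coeff α : ℂ) *
      inner ℂ (adjoint (FreeMonoid.lift X α) y) (Y (adjoint (FreeMonoid.lift X α) x)))
      (inner ℂ y (Φ Y x)) := by
  have hs := summable_of_row Y (h.hasSum_sq x).summable (h.hasSum_sq y).summable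
  have h1 := tendsto_sum_Icc_words (by simp [f.coeff_one]) hs.hasSum
  have h2 : inner ℂ y (Φ Y x) = _ := tendsto_nhds_unique (h Y x y) (h1.congr fun N =>
    Finset.sum_congr rfl fun k _ => Finset.sum_congr rfl fun α _ => by
      rw [ContinuousLinearMap.adjoint_inner_left]
      rfl)
  rw [h2]
  exact hs.hasSum

theorem IsPhi.eq_phi {Φ : Module.End ℂ (K →L[ℂ] K)} (h : f.IsPhi X Φ) : f.phi X = Φ := by
  have hex : ∃ Φ, f.IsPhi X Φ := ⟨Φ, h⟩
  rw [phi, dif_pos hex]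
  ext Y x
  exact ext_inner_left ℂ fun y => (hex.choose_spec.hasSum Y x y).unique (h.hasSum Y x y)

theorem isPhi_phi (h : ∃ Φ, f.IsPhi X Φ) : f.IsPhi X (f.phi X) := by
  obtain ⟨Φ, hΦ⟩ := h
  rwa [hΦ.eq_phi]

/-- `Φ_{f,X}` is well defined as soon as the quadratic form of `Φ_{f,X}(I)` is bounded. -/
theorem exists_isPhi {C : ℝ} (hC : 0 ≤ C)
    (h : ∀ x, f.rowSq X x ≤ ENNReal.ofReal (C * ‖x‖ ^ 2)) : ∃ Φ, f.IsPhi X Φ := by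
  have hfin : ∀ x s, ∑ α ∈ s, f.series.coeff α * ‖adjoint (FreeMonoid.lift X α) x‖ ^ 2 ≤
      C * ‖x‖ ^ 2 := fun x s => sum_le_of_rowSq_le (by positivity) (h x) s
  have hsq : ∀ x, Summable fun α => f.series.coeff α * ‖adjoint (FreeMonoid.lift X α) x‖ ^ 2 :=
    fun x => summable_of_sum_le (fun α => coeff_mul_sq_nonneg α x) (hfin x)
  have hs : ∀ (Y : K →L[ℂ] K) (x y : K), Summable fun α => (f.series.coeff α : ℂ) *
      inner ℂ (adjoint (FreeMonoid.lift X α) y) (Y (adjoint (FreeMonoid.lift X α) x)) :=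
    fun Y x y => summable_of_row Y (hsq x) (hsq y)
  have hbound : ∀ (Y : K →L[ℂ] K) (x y : K), ‖∑' α, (f.series.coeff α : ℂ) *
      inner ℂ (adjoint (FreeMonoid.lift X α) y) (Y (adjoint (FreeMonoid.lift X α) x))‖ ≤
      (‖Y‖ * C) * ‖y‖ * ‖x‖ := by
    intro Y x y
    have hpart : ∀ s : Finset (Word n), ‖∑ α ∈ s, (f.series.coeff α : ℂ) *
        inner ℂ (adjoint (FreeMonoid.lift X α) y) (Y (adjoint (FreeMonoid.lift X α) x))‖ ≤
        (‖Y‖ * C) * ‖y‖ * ‖x‖ := by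
      intro s
      have h1 := Finset.sum_mul_sq_le_sq_mul_sq s
        (fun α => √(f.series.coeff α) * ‖adjoint (FreeMonoid.lift X α) y‖)
        (fun α => √(f.series.coeff α) * ‖adjoint (FreeMonoid.lift X α) x‖)
      simp only [mul_pow, Real.sq_sqrt (f.nonneg _)] at h1
      have h2 : (∑ α ∈ s, √(f.series.coeff α) * ‖adjoint (FreeMonoid.lift X α) y‖ *
          (√(f.series.coeff α) * ‖adjoint (FreeMonoid.lift X α) x‖)) ^ 2 ≤
          (C * ‖y‖ * ‖x‖) ^ 2 := by
        refine h1.trans ((mul_le_mul (hfin y s) (hfin x s)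
          (Finset.sum_nonneg fun α _ => coeff_mul_sq_nonneg α x) (by positivity)).trans_eq ?_)
        ring
      have h3 := (abs_le_of_sq_le_sq' h2 (by positivity)).2
      calc _ ≤ ∑ α ∈ s, ‖Y‖ * (√(f.series.coeff α) * ‖adjoint (FreeMonoid.lift X α) y‖ *
          (√(f.series.coeff α) * ‖adjoint (FreeMonoid.lift X α) x‖)) := by
            refine norm_sum_le_of_le _ fun α _ => ?_
            rw [norm_mul, Complex.norm_real, Real.norm_of_nonneg (f.nonneg α)]
            refine (mul_le_mul_of_nonneg_left ((norm_inner_le_norm _ _).trans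
              (mul_le_mul_of_nonneg_left (Y.le_opNorm _) (norm_nonneg _))) (f.nonneg α)).trans_eq ?_
            conv_lhs => rw [← Real.mul_self_sqrt (f.nonneg α)]
            ring
        _ ≤ _ := by
            rw [← Finset.mul_sum]
            exact (mul_le_mul_of_nonneg_left h3 (norm_nonneg Y)).trans_eq (by ring)
    exact le_of_tendsto (hs Y x y).hasSum.norm (Eventually.of_forall hpart)
  -- `T Y` is the operator of the bounded sesquilinear form given by the series at `Y`.
  let B : (K →L[ℂ] K) → K →ₗ⋆[ℂ] K →ₗ[ℂ] ℂ := fun Y =>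
    LinearMap.mk₂'ₛₗ (starRingEnd ℂ) (RingHom.id ℂ) (fun y x => ∑' α, (f.series.coeff α : ℂ) *
      inner ℂ (adjoint (FreeMonoid.lift X α) y) (Y (adjoint (FreeMonoid.lift X α) x)))
      (fun y₁ y₂ x => by
        rw [← (hs Y x y₁).tsum_add (hs Y x y₂)]
        exact tsum_congr fun α => by rw [map_add, inner_add_left, mul_add])
      (fun c y x => by
        rw [smul_eq_mul, ← tsum_mul_left]
        exact tsum_congr fun α => by rw [map_smul, inner_smul_left]; ring)
      (fun y x₁ x₂ => by
        rw [← (hs Y x₁ y).tsum_add (hs Y x₂ y)]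
        exact tsum_congr fun α => by rw [map_add, map_add, inner_add_right, mul_add])
      (fun c y x => by
        rw [smul_eq_mul, ← tsum_mul_left]
        exact tsum_congr fun α => by
          rw [map_smul, map_smul, inner_smul_right, RingHom.id_apply]; ring)
  let T : (K →L[ℂ] K) → K →L[ℂ] K := fun Y => adjoint
    (InnerProductSpace.continuousLinearMapOfBilin ((B Y).mkContinuous₂ (‖Y‖ * C) fun y x =>
      hbound Y x y))
  have hT : ∀ Y x y, HasSum (fun α => (f.series.coeff α : ℂ) *
      inner ℂ (adjoint (FreeMonoid.lift X α) y) (Y (adjoint (FreeMonoid.lift X α) x)))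
      (inner ℂ y (T Y x)) := fun Y x y => by
    rw [ContinuousLinearMap.adjoint_inner_right,
      InnerProductSpace.continuousLinearMapOfBilin_apply]
    exact (hs Y x y).hasSum
  refine ⟨{ toFun := T, map_add' := fun Y Z => ?_, map_smul' := fun c Y => ?_ },
    IsPhi.of_hasSum hT⟩
  · ext x
    refine ext_inner_left ℂ fun y => (hT _ x y).unique ?_
    rw [add_apply, inner_add_right]
    refine ((hT Y x y).add (hT Z x y)).congr_fun fun α => ?_
    rw [add_apply, inner_add_right, mul_add]
  · ext x
    refine ext_inner_left ℂ fun y => (hT _ x y).unique ?_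
    rw [RingHom.id_apply, smul_apply, inner_smul_right]
    refine ((hT Y x y).mul_left c).congr_fun fun α => ?_
    rw [smul_apply, inner_smul_right]
    ring

theorem defect_succ (k : ℕ) :
    f.defect X (k + 1) = f.defect X k - f.phi X (f.defect X k) := by
  simp [defect, pow_succ']

theorem rowSq_smul_le {r : ℝ} (hr : 0 ≤ r) (hr1 : r ≤ 1) (x : K) :
    f.rowSq ((r : ℂ) • X) x ≤ ENNReal.ofReal (r ^ 2) * f.rowSq X x := by
  rw [rowSq_eq, rowSq_eq, ← ENNReal.tsum_mul_left]
  refine ENNReal.tsum_le_tsum fun α => ?_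
  rw [← ENNReal.ofReal_mul (sq_nonneg r)]
  refine ENNReal.ofReal_le_ofReal ?_
  by_cases hα : α = 1
  · rw [hα, f.coeff_one]
    simp
  · have h1 : 1 ≤ α.length := Nat.one_le_iff_ne_zero.2 fun h => hα (FreeMonoid.length_eq_zero.1 h)
    rw [norm_adjoint_lift_smul hr, mul_pow, ← pow_mul, mul_left_comm]
    refine mul_le_mul_of_nonneg_right (pow_le_pow_of_le_one hr hr1 (by omega))
      (coeff_mul_sq_nonneg α x)

variable {m : ℕ}

/-- Positivity of `I - Φ_{f,X}(I)`, as an inequality of quadratic forms. -/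
theorem rowSq_le_of_mem_domain (hm : 1 ≤ m) (hX : X ∈ f.domain m K) (x : K) :
    f.rowSq X x ≤ ENNReal.ofReal (‖x‖ ^ 2) := by
  have h1 := isPhi_phi hX.1
  rw [h1.rowSq_eq]
  refine ENNReal.ofReal_le_ofReal ?_
  have h2 := (hX.2 1 le_rfl hm).re_inner_nonneg_right x
  have h3 : f.defect X 1 x = x - f.phi X 1 x := by simp [defect]
  rw [h3, inner_sub_right, map_sub, inner_self_eq_norm_sq] at h2
  linarith

/-- At a point `X = rY` with `Y` in the domain, any part of the sum `Φ_{f,X}(I)` whose terms have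
degree at least `k` is at most `r^{2k} I`. -/
theorem sum_le_of_length_ge (hm : 1 ≤ m) {Y : Fin n → K →L[ℂ] K} (hY : Y ∈ f.domain m K) {r : ℝ}
    (hr : 0 ≤ r) (hr1 : r ≤ 1) {k : ℕ} (a : Word n → ℝ)
    (ha : ∀ α, a α = 0 ∨ (a α = f.series.coeff α ∧ k ≤ α.length)) (x : K) :
    ∑' α, ENNReal.ofReal (a α) * ‖adjoint (FreeMonoid.lift ((r : ℂ) • Y) α) x‖ₑ ^ 2 ≤
      ENNReal.ofReal (r ^ k) ^ 2 * ‖x‖ₑ ^ 2 := by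
  have h1 := rowSq_le_of_mem_domain hm hY x
  rw [ENNReal.ofReal_pow (norm_nonneg _), ofReal_norm] at h1
  refine le_trans ?_ (mul_le_mul_right h1 _)
  rw [rowSq, ← ENNReal.tsum_mul_left]
  refine ENNReal.tsum_le_tsum fun α => ?_
  obtain h0 | ⟨h0, hk⟩ := ha α
  · simp [h0]
  · rw [h0, ← ofReal_norm, norm_adjoint_lift_smul hr, ENNReal.ofReal_mul (by positivity),
      ofReal_norm, mul_pow, mul_left_comm]
    gcongr ?_ ^ 2 * _
    exact ENNReal.ofReal_le_ofReal (pow_le_pow_of_le_one hr hr1 hk)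

theorem exists_isPhi_smul (hm : 1 ≤ m) (hX : X ∈ f.domain m K) {r : ℝ} (hr : 0 ≤ r)
    (hr1 : r ≤ 1) : ∃ Φ, f.IsPhi ((r : ℂ) • X) Φ := by
  refine exists_isPhi (C := 1) zero_le_one fun x => ?_
  rw [one_mul]
  refine ((rowSq_smul_le hr hr1 x).trans (mul_le_of_le_one_left (zero_le) ?_)).trans
    (rowSq_le_of_mem_domain hm hX x)
  rw [← ENNReal.ofReal_one]
  exact ENNReal.ofReal_le_ofReal (pow_le_one₀ hr hr1)

end RegularFunction

end Phi

/-! ### Compression to reducing subspaces -/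

section Transport

open ContinuousLinearMap (adjoint)

variable {n : ℕ} {K : Type v} [NormedAddCommGroup K] [InnerProductSpace ℂ K] [CompleteSpace K]
  {H : Type w} [NormedAddCommGroup H] [InnerProductSpace ℂ H] [CompleteSpace H]

/-- `T` is a partial isometry whose initial projection `T^* T` commutes with all `Y_i`, that is,
the initial space of `T` reduces the tuple `Y`. -/
structure IsReducing (T : K →L[ℂ] H) (Y : Fin n → K →L[ℂ] K) : Prop where
  apply_apply : ∀ x, T (adjoint T (T x)) = T x
  comm : ∀ i x, adjoint T (T (Y i x)) = Y i (adjoint T (T x))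

/-- The tuple `T Y_i T^*`. -/
def transport (T : K →L[ℂ] H) (Y : Fin n → K →L[ℂ] K) (i : Fin n) : H →L[ℂ] H :=
  T ∘L Y i ∘L adjoint T

theorem transport_smul (c : ℂ) (T : K →L[ℂ] H) (Y : Fin n → K →L[ℂ] K) :
    transport T (c • Y) = c • transport T Y := by
  ext i x
  simp [transport]

namespace IsReducing

variable {T : K →L[ℂ] H} {Y : Fin n → K →L[ℂ] K} (hT : IsReducing T Y)

include hT

theorem adjoint_apply (y : H) : adjoint T (T (adjoint T y)) = adjoint T y := by
  refine ext_inner_right ℂ fun x => ?_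
  rw [ContinuousLinearMap.adjoint_inner_left, ← ContinuousLinearMap.adjoint_inner_right T,
    ContinuousLinearMap.adjoint_inner_left, hT.apply_apply,
    ContinuousLinearMap.adjoint_inner_left]

theorem smul (c : ℂ) : IsReducing T (c • Y) where
  apply_apply := hT.apply_apply
  comm i x := by simp [hT.comm]

theorem comm_lift (α : Word n) (x : K) :
    adjoint T (T (FreeMonoid.lift Y α x)) = FreeMonoid.lift Y α (adjoint T (T x)) := by
  induction α using FreeMonoid.inductionOn' with
  | one => simp
  | of_mul i β ih =>
    simp only [map_mul, mul_apply_eq_comp, FreeMonoid.lift_eval_of]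
    rw [hT.comm, ih]

theorem comm_adjoint_lift (α : Word n) (x : K) :
    adjoint T (T (adjoint (FreeMonoid.lift Y α) x)) =
      adjoint (FreeMonoid.lift Y α) (adjoint T (T x)) := by
  refine ext_inner_right ℂ fun z => ?_
  simp only [ContinuousLinearMap.adjoint_inner_left]
  rw [← ContinuousLinearMap.adjoint_inner_right T, ContinuousLinearMap.adjoint_inner_left,
    ← ContinuousLinearMap.adjoint_inner_right T, hT.comm_lift]

/-- The empty word is excluded: there the left side is `y` and the right side `T T^* y`. -/
theorem lift_transport {α : Word n} (hα : α ≠ 1) (y : H) :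
    FreeMonoid.lift (transport T Y) α y = T (FreeMonoid.lift Y α (adjoint T y)) := by
  induction α using FreeMonoid.inductionOn' generalizing y with
  | one => exact absurd rfl hα
  | of_mul i β ih =>
    simp only [map_mul, mul_apply_eq_comp, FreeMonoid.lift_eval_of]
    by_cases hβ : β = 1
    · subst hβ
      simp [transport]
    · rw [ih hβ]
      simp only [transport, ContinuousLinearMap.comp_apply]
      rw [hT.comm_lift, hT.adjoint_apply]

theorem adjoint_lift_transport {α : Word n} (hα : α ≠ 1) (y : H) :
    adjoint (FreeMonoid.lift (transport T Y) α) y =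
      T (adjoint (FreeMonoid.lift Y α) (adjoint T y)) := by
  refine ext_inner_right ℂ fun z => ?_
  rw [ContinuousLinearMap.adjoint_inner_left, hT.lift_transport hα,
    ← ContinuousLinearMap.adjoint_inner_left, ← ContinuousLinearMap.adjoint_inner_left,
    ContinuousLinearMap.adjoint_inner_right]

variable {f : RegularFunction n}

theorem isPhi {Φ : Module.End ℂ (K →L[ℂ] K)} (hΦ : f.IsPhi Y Φ) :
    f.IsPhi (transport T Y)
      { toFun := fun A => T ∘L Φ (adjoint T ∘L A ∘L T) ∘L adjoint T
        map_add' := fun A B => by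
          rw [ContinuousLinearMap.add_comp, ContinuousLinearMap.comp_add, map_add,
            ContinuousLinearMap.add_comp, ContinuousLinearMap.comp_add]
        map_smul' := fun c A => by
          rw [ContinuousLinearMap.smul_comp, ContinuousLinearMap.comp_smul, map_smul,
            ContinuousLinearMap.smul_comp, ContinuousLinearMap.comp_smul, RingHom.id_apply] } := by
  refine RegularFunction.IsPhi.of_hasSum fun A x y => ?_
  have h := hΦ.hasSum (adjoint T ∘L A ∘L T) (adjoint T x) (adjoint T y)
  rw [ContinuousLinearMap.adjoint_inner_left] at h
  refine h.congr_fun fun α => ?_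
  by_cases hα : α = 1
  · rw [hα, f.coeff_one]
    simp
  · rw [hT.adjoint_lift_transport hα, hT.adjoint_lift_transport hα]
    simp only [ContinuousLinearMap.comp_apply]
    rw [ContinuousLinearMap.adjoint_inner_right]

/-- The summand `1 - T T^*` does not contribute: `T Y_i T^*` vanishes off the range of `T`, and `f`
has no constant term. -/
theorem phi_transport {Φ : Module.End ℂ (K →L[ℂ] K)} (hΦ : f.IsPhi Y Φ) (D : K →L[ℂ] K) :
    f.phi (transport T Y) (T ∘L D ∘L adjoint T + (1 - T ∘L adjoint T)) =
      T ∘L f.phi Y D ∘L adjoint T := by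
  rw [(hT.isPhi hΦ).eq_phi, hΦ.eq_phi]
  ext x
  refine ext_inner_left ℂ fun y => ?_
  have h := hΦ.hasSum (adjoint T ∘L (T ∘L D ∘L adjoint T + (1 - T ∘L adjoint T)) ∘L T)
    (adjoint T x) (adjoint T y)
  have h' := hΦ.hasSum D (adjoint T x) (adjoint T y)
  rw [ContinuousLinearMap.adjoint_inner_left] at h h'
  refine h.unique (h'.congr_fun fun α => ?_)
  congr 1
  simp only [ContinuousLinearMap.comp_apply, add_apply, sub_apply, one_apply_eq_self]
  rw [hT.apply_apply, sub_self, add_zero, ContinuousLinearMap.adjoint_inner_right,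
    ← ContinuousLinearMap.adjoint_inner_left, hT.comm_adjoint_lift, hT.comm_adjoint_lift,
    hT.adjoint_apply, hT.adjoint_apply]

/-- `(id - Φ)^k (I)` at `T Y T^*` is the copy of the one at `Y` on the range of `T`, and the identity
on the orthogonal complement. -/
theorem defect_transport (hΦ : ∃ Φ, f.IsPhi Y Φ) (k : ℕ) :
    f.defect (transport T Y) k = T ∘L f.defect Y k ∘L adjoint T + (1 - T ∘L adjoint T) := by
  obtain ⟨Φ, hΦ⟩ := hΦ
  induction k with
  | zero =>
    simp only [RegularFunction.defect, pow_zero, Module.End.one_apply]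
    ext x
    simp
  | succ k ih =>
    rw [RegularFunction.defect_succ, ih, hT.phi_transport hΦ, RegularFunction.defect_succ]
    ext x
    simp only [ContinuousLinearMap.comp_apply, add_apply, sub_apply, one_apply_eq_self, map_sub]
    abel

theorem isPositive_one_sub : (1 - T ∘L adjoint T).IsPositive := by
  have h : (1 - T ∘L adjoint T) = (1 - T ∘L adjoint T) ∘L adjoint (1 - T ∘L adjoint T) := by
    have h1 : adjoint (1 - T ∘L adjoint T) = 1 - T ∘L adjoint T := by
      rw [map_sub, ContinuousLinearMap.adjoint_comp, ContinuousLinearMap.adjoint_adjoint]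
      congr 1
      exact ContinuousLinearMap.adjoint_id
    rw [h1]
    ext x
    simp only [ContinuousLinearMap.comp_apply, sub_apply, one_apply_eq_self, map_sub,
      hT.apply_apply]
    abel
  rw [h]
  exact ContinuousLinearMap.isPositive_self_comp_adjoint _

theorem transport_mem_domain {m : ℕ} (hY : Y ∈ f.domain m K) :
    transport T Y ∈ f.domain m H := by
  refine ⟨?_, fun k h1 hk => ?_⟩
  · obtain ⟨Φ, hΦ⟩ := hY.1
    exact ⟨_, hT.isPhi hΦ⟩
  · rw [hT.defect_transport hY.1]
    exact ((hY.2 k h1 hk).conj_adjoint T).add hT.isPositive_one_sub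

end IsReducing

/-- An isometric embedding of an `ℓ²` space with countable index set into an infinite dimensional
Hilbert space. -/
theorem exists_linearIsometry_of_countable {ι : Type*} [Countable ι]
    (hH : ¬ FiniteDimensional ℂ H) : Nonempty (lp (fun _ : ι => ℂ) 2 →ₗᵢ[ℂ] H) := by
  obtain ⟨w, b, hb⟩ := exists_hilbertBasis ℂ H
  have hw : Infinite w := by
    by_contra hfin
    rw [not_infinite_iff_finite] at hfin
    have := Fintype.ofFinite w
    exact hH (b.toOrthonormalBasis.toBasis.finiteDimensional_of_finite)
  obtain ⟨g, hg⟩ := exists_injective_nat ι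
  have hO := (b.orthonormal.comp _ ((Infinite.natEmbedding w).injective.comp hg)).orthogonalFamily
  exact ⟨hO.linearIsometry⟩

theorem countable_of_orthonormal {S : Type*} [NormedAddCommGroup S] [InnerProductSpace ℂ S]
    [TopologicalSpace.SeparableSpace S] {w : Set S} (h : Orthonormal ℂ ((↑) : w → S)) :
    Countable w := by
  have hd : DiscreteTopology w := DiscreteTopology.of_forall_le_dist zero_lt_one fun x y hxy => by
    have h1 : ‖(x : S) - y‖ ^ 2 = 2 := by
      rw [@norm_sub_sq ℂ, h.1 x, h.1 y, h.2 hxy]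
      norm_num
    change 1 ≤ dist x y
    rw [Subtype.dist_eq, dist_eq_norm]
    nlinarith [norm_nonneg ((x : S) - y)]
  have : SecondCountableTopology S := UniformSpace.secondCountable_of_separable S
  exact TopologicalSpace.separableSpace_iff_countable.1 inferInstance

theorem exists_linearIsometry_of_separable {S : Type*} [NormedAddCommGroup S]
    [InnerProductSpace ℂ S] [CompleteSpace S] [TopologicalSpace.SeparableSpace S]
    (hH : ¬ FiniteDimensional ℂ H) : Nonempty (S →ₗᵢ[ℂ] H) := by
  obtain ⟨w, b, hb⟩ := exists_hilbertBasis ℂ S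
  have hw : Countable w := countable_of_orthonormal (hb ▸ b.orthonormal)
  obtain ⟨J⟩ := exists_linearIsometry_of_countable (ι := w) hH
  exact ⟨J.comp b.repr.toLinearIsometry⟩

/-- Every vector lies in a separable subspace reducing a given tuple. -/
theorem exists_separable_reducing (Y : Fin n → K →L[ℂ] K) (x : K) :
    ∃ S : Submodule ℂ K, IsClosed (S : Set K) ∧ TopologicalSpace.IsSeparable (S : Set K) ∧
      x ∈ S ∧ (∀ i, ∀ z ∈ S, Y i z ∈ S) ∧ ∀ i, ∀ z ∈ S, adjoint (Y i) z ∈ S := by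
  let L : Fin n ⊕ Fin n → K →L[ℂ] K := Sum.elim Y fun i => adjoint (Y i)
  -- The orbit of `x` under the words in the `Y_i` and the `Y_i^*` is countable.
  let s : Set K := Set.range fun w : FreeMonoid (Fin n ⊕ Fin n) => FreeMonoid.lift L w x
  have hinv : ∀ l, ∀ z ∈ (Submodule.span ℂ s).topologicalClosure,
      L l z ∈ (Submodule.span ℂ s).topologicalClosure := by
    intro l z hz
    refine map_mem_closure (L l).continuous hz fun y hy => ?_
    induction hy using Submodule.span_induction with
    | mem y hy =>
      obtain ⟨w, rfl⟩ := hy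
      exact Submodule.subset_span ⟨FreeMonoid.of l * w, by simp [mul_apply_eq_comp]⟩
    | zero => simp
    | add y z _ _ hy hz => rw [map_add]; exact add_mem hy hz
    | smul c y _ hy => rw [map_smul]; exact Submodule.smul_mem _ _ hy
  have hc : Countable (FreeMonoid (Fin n ⊕ Fin n)) :=
    inferInstanceAs (Countable (List (Fin n ⊕ Fin n)))
  refine ⟨(Submodule.span ℂ s).topologicalClosure, Submodule.isClosed_topologicalClosure _, ?_,
    Submodule.le_topologicalClosure _ (Submodule.subset_span ⟨1, by simp⟩),
    fun i => hinv (Sum.inl i), fun i => hinv (Sum.inr i)⟩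
  exact ((Set.countable_range _).isSeparable.span (R := ℂ)).closure

/-- Every vector lies in the initial space of a partial isometry into a given infinite dimensional
Hilbert space that reduces a given tuple. -/
theorem exists_isReducing (hH : ¬ FiniteDimensional ℂ H) (Y : Fin n → K →L[ℂ] K) (x : K) :
    ∃ T : K →L[ℂ] H, IsReducing T Y ∧ adjoint T (T x) = x := by
  obtain ⟨S, hSc, hSs, hx, hS1, hS2⟩ := exists_separable_reducing Y x
  have : CompleteSpace S := hSc.completeSpace_coe
  have : TopologicalSpace.SeparableSpace S := hSs.separableSpace
  obtain ⟨J⟩ := exists_linearIsometry_of_separable (S := S) hH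
  let T : K →L[ℂ] H := J.toContinuousLinearMap ∘L S.orthogonalProjectionOnto
  have hTT : ∀ z, adjoint T (T z) = S.starProjection z := fun z => by
    refine ext_inner_right ℂ fun y => ?_
    rw [ContinuousLinearMap.adjoint_inner_left]
    simp only [T, ContinuousLinearMap.comp_apply, LinearIsometry.coe_toContinuousLinearMap,
      LinearIsometry.inner_map_map]
    rw [Submodule.starProjection_apply, ← Submodule.inner_orthogonalProjectionOnto_eq_of_mem_left]
  have hmem : ∀ z ∈ S, S.starProjection z = z := fun z hz =>
    Submodule.starProjection_eq_self_iff.2 hz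
  refine ⟨T, ⟨fun z => ?_, fun i z => ?_⟩, ?_⟩
  · rw [hTT]
    simp only [T, ContinuousLinearMap.comp_apply]
    congr 1
    rw [Submodule.starProjection_apply]
    exact Submodule.orthogonalProjectionOnto_mem_subspace_eq_self _
  · rw [hTT, hTT]
    have h1 : Y i z = Y i (S.starProjection z) + Y i (z - S.starProjection z) := by
      rw [← map_add, add_sub_cancel]
    have h2 : Y i (z - S.starProjection z) ∈ Sᗮ := by
      rw [Submodule.mem_orthogonal]
      intro y hy
      rw [← ContinuousLinearMap.adjoint_inner_left]
      exact (Submodule.mem_orthogonal _ _).1 (Submodule.sub_starProjection_mem_orthogonal z) _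
        (hS2 i y hy)
    rw [h1, map_add, hmem _ (hS1 i _ (Submodule.starProjection_apply_mem _ _)),
      (Submodule.starProjection_apply_eq_zero_iff _).2 h2, add_zero]
  · rw [hTT, hmem x hx]

/-- If `D_f^m` is starlike on some infinite dimensional Hilbert space, it is starlike on every
Hilbert space: positivity at a vector is tested on a separable reducing subspace. -/
theorem smul_mem_domain {f : RegularFunction n} {m : ℕ} (hm : 1 ≤ m)
    (hH : ¬ FiniteDimensional ℂ H)
    (hstar : ∀ X ∈ f.domain m H, ∀ r : ℝ, 0 ≤ r → r < 1 → (r : ℂ) • X ∈ f.domain m H)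
    {Y : Fin n → K →L[ℂ] K} (hY : Y ∈ f.domain m K) {r : ℝ} (hr : 0 ≤ r) (hr1 : r < 1) :
    (r : ℂ) • Y ∈ f.domain m K := by
  have hΦ := RegularFunction.exists_isPhi_smul hm hY hr hr1.le
  refine ⟨hΦ, fun k h1 hk => ?_⟩
  rw [ContinuousLinearMap.isPositive_iff_complex]
  intro x
  obtain ⟨T, hT, hTx⟩ := exists_isReducing hH Y x
  have h2 := (hstar _ (hT.transport_mem_domain hY) r hr hr1).2 k h1 hk
  rw [← transport_smul, (hT.smul r).defect_transport hΦ,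
    ContinuousLinearMap.isPositive_iff_complex] at h2
  have h3 := h2 (T x)
  simpa [hTx, ← ContinuousLinearMap.adjoint_inner_right] using h3

end Transport

/-! ### The universal model lies in the domain -/

section Model

open ContinuousLinearMap (adjoint)

theorem enorm_sq_eq_tsum {ι : Type*} {E : Type*} [NormedAddCommGroup E]
    (ξ : lp (fun _ : ι => E) 2) : ‖ξ‖ₑ ^ 2 = ∑' i, ‖ξ i‖ₑ ^ 2 := by
  have h := lp.hasSum_norm (p := 2) (by norm_num) ξ
  simp only [ENNReal.toReal_ofNat, Real.rpow_ofNat] at h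
  simp only [← ofReal_norm, ← ENNReal.ofReal_pow (norm_nonneg _)]
  rw [← h.tsum_eq, ENNReal.ofReal_tsum_of_nonneg (fun _ => sq_nonneg _) h.summable]

namespace RegularFunction

variable {n : ℕ} (f : RegularFunction n) (m : ℕ)

theorem adjoint_lift_W_apply (β γ : Word n) (ξ : Fock n) :
    adjoint (FreeMonoid.lift (f.W m) β) ξ γ =
      (√(f.weight m γ / f.weight m (β * γ)) : ℂ) * ξ (β * γ) := by
  rw [← inner_basisVec, ContinuousLinearMap.adjoint_inner_right, lift_W_basisVec, inner_smul_left,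
    inner_basisVec, Complex.conj_ofReal]

theorem adjoint_lift_W_basisVec_mul (β γ : Word n) :
    adjoint (FreeMonoid.lift (f.W m) β) (basisVec (β * γ)) =
      (√(f.weight m γ / f.weight m (β * γ)) : ℂ) • basisVec γ := by
  ext δ
  rw [adjoint_lift_W_apply, lp.coeFn_smul, Pi.smul_apply, basisVec_apply, basisVec_apply,
    smul_eq_mul]
  by_cases h : δ = γ
  · simp [h]
  · rw [if_neg h, if_neg fun h' => h (mul_left_cancel h')]
    simp

theorem adjoint_lift_W_basisVec_eq_zero {β δ : Word n} (h : ∀ γ, β * γ ≠ δ) :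
    adjoint (FreeMonoid.lift (f.W m) β) (basisVec δ) = 0 := by
  ext γ
  rw [adjoint_lift_W_apply, basisVec_apply, if_neg (h γ)]
  simp

variable {m}

/-- `∑_α a_α W_α W_α^* ≤ I`: the sum is diagonal with entries `(f b)_δ / b_δ ≤ 1`. -/
theorem rowSq_W_le (hm : 1 ≤ m) (ξ : Fock n) : f.rowSq (f.W m) ξ ≤ ‖ξ‖ₑ ^ 2 := by
  have h1 : ∀ α γ : Word n, ENNReal.ofReal (f.series.coeff α) *
      ‖adjoint (FreeMonoid.lift (f.W m) α) ξ γ‖ₑ ^ 2 =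
      ENNReal.ofReal (f.series.coeff α * f.weight m γ / f.weight m (α * γ)) *
        ‖ξ (α * γ)‖ₑ ^ 2 := fun α γ => by
    rw [adjoint_lift_W_apply, enorm_mul, mul_pow, ← mul_assoc, mul_div_assoc,
      ENNReal.ofReal_mul (f.nonneg α)]
    congr 2
    rw [← ofReal_norm, Complex.norm_real, Real.norm_of_nonneg (Real.sqrt_nonneg _),
      ← ENNReal.ofReal_pow (Real.sqrt_nonneg _),
      Real.sq_sqrt (div_nonneg (f.weight_nonneg m _) (f.weight_nonneg m _))]
  have h2 : f.rowSq (f.W m) ξ = ∑' α, ∑' γ, ENNReal.ofReal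
      (f.series.coeff α * f.weight m γ / f.weight m (α * γ)) * ‖ξ (α * γ)‖ₑ ^ 2 := by
    refine tsum_congr fun α => ?_
    rw [enorm_sq_eq_tsum, ← ENNReal.tsum_mul_left]
    exact tsum_congr fun γ => h1 α γ
  rw [h2, ennreal_tsum_antidiagonal, enorm_sq_eq_tsum]
  refine ENNReal.tsum_le_tsum fun δ => ?_
  calc _ = ∑ p ∈ Finset.HasMulAntidiagonal.mulAntidiagonal δ, ENNReal.ofReal
        (f.series.coeff p.1 * f.weight m p.2 / f.weight m δ) * ‖ξ δ‖ₑ ^ 2 :=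
        Finset.sum_congr rfl fun p hp => by
          rw [Finset.HasMulAntidiagonal.mem_mulAntidiagonal.1 hp]
    _ ≤ 1 * ‖ξ δ‖ₑ ^ 2 := by
        rw [← Finset.sum_mul, ← ENNReal.ofReal_sum_of_nonneg fun p _ => div_nonneg
          (mul_nonneg (f.nonneg _) (f.weight_nonneg m _)) (f.weight_nonneg m _),
          ← Finset.sum_div]
        refine mul_le_mul_left ?_ _
        rw [← ENNReal.ofReal_one]
        refine ENNReal.ofReal_le_ofReal ((div_le_one (f.weight_pos m δ)).2 ?_)
        exact f.sum_coeff_mul_weight_le hm δ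
    _ = _ := one_mul _

theorem exists_isPhi_W (hm : 1 ≤ m) : ∃ Φ, f.IsPhi (f.W m) Φ :=
  exists_isPhi zero_le_one fun ξ => by
    rw [one_mul, ENNReal.ofReal_pow (norm_nonneg _), ofReal_norm]
    exact f.rowSq_W_le hm ξ

/-- On the model, `Φ_{f,W}` maps the diagonal operator with entries `c_γ / b_γ` to the one with
entries `(f c)_γ / b_γ`. -/
theorem phi_W_basisVec (hm : 1 ≤ m) {A : Fock n →L[ℂ] Fock n} {c : NCSeries n ℝ}
    (hA : ∀ γ, A (basisVec γ) = ((c.coeff γ / f.weight m γ : ℝ) : ℂ) • basisVec γ) (δ : Word n) :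
    f.phi (f.W m) A (basisVec δ) =
      (((f.series * c).coeff δ / f.weight m δ : ℝ) : ℂ) • basisVec δ := by
  refine ext_inner_left ℂ fun y => ?_
  have h := (isPhi_phi (f.exists_isPhi_W hm)).hasSum A (basisVec δ) y
  refine h.unique ?_
  have h1 := hasSum_of_prefix δ (g := fun α => (f.series.coeff α : ℂ) *
      inner ℂ (adjoint (FreeMonoid.lift (f.W m) α) y)
        (A (adjoint (FreeMonoid.lift (f.W m) α) (basisVec δ)))) fun α hα => by
    rw [f.adjoint_lift_W_basisVec_eq_zero m hα]
    simp
  convert h1 using 1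
  rw [inner_smul_right, NCSeries.coeff_mul, Finset.sum_div, Complex.ofReal_sum, Finset.sum_mul]
  refine Finset.sum_congr rfl fun p hp => ?_
  rw [← Finset.HasMulAntidiagonal.mem_mulAntidiagonal.1 hp, adjoint_lift_W_basisVec_mul, map_smul,
    hA, smul_smul, inner_smul_right, ContinuousLinearMap.adjoint_inner_left, lift_W_basisVec,
    inner_smul_right]
  have hb := (f.weight_pos m p.2).ne'
  have hsq : (√(f.weight m p.2 / f.weight m (p.1 * p.2)) : ℂ) *
      √(f.weight m p.2 / f.weight m (p.1 * p.2)) =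
      ((f.weight m p.2 / f.weight m (p.1 * p.2) : ℝ) : ℂ) := by
    rw [← Complex.ofReal_mul,
      Real.mul_self_sqrt (div_nonneg (f.weight_nonneg m _) (f.weight_nonneg m _))]
  have hr : f.series.coeff p.1 * c.coeff p.2 / f.weight m (p.1 * p.2) = f.series.coeff p.1 *
      (f.weight m p.2 / f.weight m (p.1 * p.2) * (c.coeff p.2 / f.weight m p.2)) := by
    field_simp
  rw [hr, Complex.ofReal_mul, Complex.ofReal_mul, ← hsq]
  ring

/-- On the model, `(id - Φ_{f,W})^k (I)` is diagonal with entries `b_δ^{(m-k)} / b_δ^{(m)}`: each step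
multiplies the numerators, as a series, by `1 - f`. -/
theorem defect_W_basisVec (hm : 1 ≤ m) {k : ℕ} (hk : k ≤ m) (δ : Word n) :
    f.defect (f.W m) k (basisVec δ) =
      (((f.invPow (m - k)).coeff δ / f.weight m δ : ℝ) : ℂ) • basisVec δ := by
  induction k generalizing δ with
  | zero =>
    rw [Nat.sub_zero, ← f.weight_eq_coeff_invPow hm, div_self (f.weight_pos m δ).ne']
    simp [defect]
  | succ k ih =>
    have h1 : m - k = (m - (k + 1)) + 1 := by omega
    rw [defect_succ, sub_apply, f.phi_W_basisVec hm (ih (by omega)), ih (by omega), ← sub_smul,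
      ← Complex.ofReal_sub, ← sub_div, h1]
    congr 3
    conv_lhs => rw [invPow_succ_eq_mul_add, NCSeries.coeff_add]
    rw [← invPow_succ_eq_mul_add, add_sub_cancel_right]

theorem apply_of_diagonal {A : Fock n →L[ℂ] Fock n} {d : Word n → ℂ}
    (hA : ∀ γ, A (basisVec γ) = d γ • basisVec γ) (ξ : Fock n) (γ : Word n) :
    A ξ γ = d γ * ξ γ := by
  have : lp.evalCLM ℂ (fun _ : Word n => ℂ) 2 γ ∘L A =
      d γ • lp.evalCLM ℂ (fun _ => ℂ) 2 γ := clm_ext fun β => by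
    have h1 : (lp.evalCLM ℂ (fun _ : Word n => ℂ) 2 γ ∘L A) (basisVec β) =
      A (basisVec β) γ := rfl
    have h2 : (d γ • lp.evalCLM ℂ (fun _ : Word n => ℂ) 2 γ) (basisVec β) =
      d γ * basisVec β γ := rfl
    rw [h1, h2, hA, lp.coeFn_smul, Pi.smul_apply, smul_eq_mul, basisVec_apply]
    by_cases h : γ = β
    · rw [h]
    · simp [h]
  exact congrArg (fun L => L ξ) this

theorem isPositive_of_diagonal {A : Fock n →L[ℂ] Fock n} {d : Word n → ℝ} (hd : ∀ γ, 0 ≤ d γ)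
    (hA : ∀ γ, A (basisVec γ) = (d γ : ℂ) • basisVec γ) : A.IsPositive := by
  rw [ContinuousLinearMap.isPositive_iff_complex]
  intro ξ
  have h1 := lp.hasSum_inner (𝕜 := ℂ) (A ξ) ξ
  have h2 : ∀ γ, inner ℂ (A ξ γ) (ξ γ) = ((d γ * ‖ξ γ‖ ^ 2 : ℝ) : ℂ) := fun γ => by
    rw [apply_of_diagonal hA, ← smul_eq_mul, inner_smul_left, inner_self_eq_norm_sq_to_K, Complex.conj_ofReal]
    push_cast
    rfl
  simp only [h2] at h1
  have h3 : HasSum (fun γ => d γ * ‖ξ γ‖ ^ 2) (RCLike.re (inner ℂ (A ξ) ξ)) := by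
    have := Complex.reCLM.hasSum h1
    simpa [← Complex.ofReal_pow] using this
  have h4 := Complex.ofRealCLM.hasSum h3
  exact ⟨h4.unique h1, h3.nonneg fun γ => mul_nonneg (hd γ) (sq_nonneg _)⟩

theorem W_mem_domain (hm : 1 ≤ m) : f.W m ∈ f.domain m (Fock n) :=
  ⟨f.exists_isPhi_W hm, fun _ _ hk => isPositive_of_diagonal
    (fun γ => div_nonneg (f.coeff_invPow_nonneg _ γ) (f.weight_nonneg m γ))
    (f.defect_W_basisVec hm hk)⟩

end RegularFunction

end Model

/-! ### Coordinates on the tensor product of the Fock space with a Hilbert space -/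

section Tensor

open ContinuousLinearMap (adjoint)

variable {n : ℕ} {K : Type v} [NormedAddCommGroup K] [InnerProductSpace ℂ K]

variable (n K) in
/-- The Hilbert space tensor product of the Fock space with `K`. -/
abbrev FockTensor := UniformSpace.Completion (Fock n ⊗[ℂ] K)

/-- The map `z ↦ ξ ⊗ z`. -/
def tensorLeft (ξ : Fock n) : K →L[ℂ] FockTensor n K :=
  UniformSpace.Completion.toComplL ∘L TensorProduct.mkL ℂ (Fock n) K ξ

/-- The map `ξ ↦ ξ ⊗ z`. -/
def tensorRight (z : K) : Fock n →L[ℂ] FockTensor n K :=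
  UniformSpace.Completion.toComplL ∘L (TensorProduct.mkL ℂ (Fock n) K).flip z

theorem tensorRight_apply (z : K) (ξ : Fock n) : tensorRight z ξ = tensorLeft ξ z := rfl

theorem inner_tensorLeft (ξ η : Fock n) (y z : K) :
    inner ℂ (tensorLeft ξ y) (tensorLeft η z) = inner ℂ ξ η * inner ℂ y z := by
  have h : ∀ (ξ : Fock n) (y : K), tensorLeft ξ y = ((ξ ⊗ₜ[ℂ] y : Fock n ⊗[ℂ] K) :
    FockTensor n K) := fun _ _ => rfl
  rw [h, h, UniformSpace.Completion.inner_coe, TensorProduct.inner_tmul]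

/-- A bounded operator on the tensor product is determined by its values on the vectors `e_γ ⊗ z`. -/
theorem tensor_ext {E : Type*} [NormedAddCommGroup E] [NormedSpace ℂ E]
    {S T : FockTensor n K →L[ℂ] E}
    (h : ∀ γ z, S (tensorLeft (basisVec γ) z) = T (tensorLeft (basisVec γ) z)) : S = T := by
  have h1 : ∀ ξ z, S (tensorLeft ξ z) = T (tensorLeft ξ z) := fun ξ z => by
    have : S ∘L tensorRight z = T ∘L tensorRight z := clm_ext fun γ => h γ z
    exact congrArg (fun L => L ξ) this
  refine DFunLike.coe_injective (UniformSpace.Completion.ext S.continuous T.continuous fun a => ?_)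
  have h2 : ∀ L : FockTensor n K →L[ℂ] E, ∀ a b : Fock n ⊗[ℂ] K,
      L ((a + b : Fock n ⊗[ℂ] K) : FockTensor n K) = L a + L b := fun L a b => by
    rw [UniformSpace.Completion.coe_add, map_add]
  induction a using TensorProduct.induction_on with
  | zero => rw [UniformSpace.Completion.coe_zero, map_zero, map_zero]
  | tmul ξ z => exact h1 ξ z
  | add a b ha hb => rw [h2, h2, ha, hb]

theorem tensorOp_tensorLeft [CompleteSpace K] (g : Fock n →L[ℂ] Fock n) (T : K →L[ℂ] K)
    (ξ : Fock n) (z : K) :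
    RegularFunction.tensorOp g T (tensorLeft ξ z) = tensorLeft (g ξ) (T z) :=
  ContinuousLinearMap.completion_apply_coe _ _

variable [CompleteSpace K]

variable (K) in
/-- The coordinate `⟨e_δ| ⊗ id` of a vector of the tensor product at the word `δ`. -/
def tensorCoord (δ : Word n) : FockTensor n K →L[ℂ] K := adjoint (tensorLeft (basisVec δ))

theorem tensorCoord_tensorLeft (δ : Word n) (ξ : Fock n) (z : K) :
    tensorCoord K δ (tensorLeft ξ z) = ξ δ • z := by
  refine ext_inner_left ℂ fun y => ?_
  rw [tensorCoord, ContinuousLinearMap.adjoint_inner_right, inner_tensorLeft, inner_basisVec,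
    inner_smul_right]

/-- The isometry `z ↦ e_γ ⊗ z`. -/
def tensorIsometry (γ : Word n) : K →ₗᵢ[ℂ] FockTensor n K where
  toLinearMap := (tensorLeft (basisVec γ) : K →L[ℂ] FockTensor n K).toLinearMap
  norm_map' z := by
    have h : ‖(tensorLeft (basisVec γ) z : FockTensor n K)‖ ^ 2 = ‖z‖ ^ 2 := by
      rw [← @inner_self_eq_norm_sq ℂ, ← @inner_self_eq_norm_sq ℂ, inner_tensorLeft,
        inner_basisVec, basisVec_apply, if_pos rfl, one_mul]
    exact (sq_eq_sq₀ (norm_nonneg _) (norm_nonneg _)).1 h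

theorem isHilbertSum_tensorIsometry :
    IsHilbertSum ℂ (fun _ : Word n => K) (tensorIsometry (n := n) (K := K)) := by
  refine IsHilbertSum.mk (fun γ δ h y z => ?_) ?_
  · change inner ℂ (tensorLeft (basisVec γ) y) (tensorLeft (basisVec δ) z) = 0
    rw [inner_tensorLeft, inner_basisVec, basisVec_apply, if_neg h, zero_mul]
  · rw [top_le_iff, Submodule.topologicalClosure_eq_top_iff, Submodule.eq_bot_iff]
    intro w hw
    have h0 : innerSL ℂ w = 0 := tensor_ext fun γ z => by
      rw [innerSL_apply_apply, zero_apply]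
      refine Submodule.inner_left_of_mem_orthogonal ?_ hw
      exact Submodule.mem_iSup_of_mem γ ⟨z, rfl⟩
    have h1 := congrArg (fun L => L w) h0
    simpa using h1

/-- Parseval's identity for the coordinates of the tensor product. -/
theorem hasSum_inner_tensorCoord (w w' : FockTensor n K) :
    HasSum (fun δ : Word n => inner ℂ (tensorCoord K δ w) (tensorCoord K δ w')) (inner ℂ w w') := by
  have hV := isHilbertSum_tensorIsometry (n := n) (K := K)
  have hc : ∀ (w : FockTensor n K) δ, hV.linearIsometryEquiv w δ = tensorCoord K δ w :=
    fun w δ => by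
      refine ext_inner_left ℂ fun z => ?_
      refine (lp.inner_single_left (𝕜 := ℂ) (G := fun _ : Word n => K) δ z _).symm.trans ?_
      rw [tensorCoord, ContinuousLinearMap.adjoint_inner_right,
        ← hV.linearIsometryEquiv.symm.inner_map_map,
        hV.linearIsometryEquiv_symm_apply_single, LinearIsometryEquiv.symm_apply_apply]
      rfl
  have h := lp.hasSum_inner (𝕜 := ℂ) (hV.linearIsometryEquiv w) (hV.linearIsometryEquiv w')
  rw [hV.linearIsometryEquiv.inner_map_map] at h
  simpa only [hc] using h

theorem enorm_sq_eq_tsum_tensorCoord (w : FockTensor n K) :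
    ‖w‖ₑ ^ 2 = ∑' δ : Word n, ‖tensorCoord K δ w‖ₑ ^ 2 := by
  have h := Complex.reCLM.hasSum (hasSum_inner_tensorCoord w w)
  have h1 : ∀ {E : Type v} [NormedAddCommGroup E] [InnerProductSpace ℂ E] (z : E),
      Complex.reCLM (inner ℂ z z) = ‖z‖ ^ 2 := fun z => inner_self_eq_norm_sq (𝕜 := ℂ) z
  simp only [h1] at h
  simp only [← ofReal_norm, ← ENNReal.ofReal_pow (norm_nonneg _)]
  rw [← h.tsum_eq, ENNReal.ofReal_tsum_of_nonneg (fun _ => sq_nonneg _) h.summable]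

theorem tensorCoord_tensorOp_one (T : K →L[ℂ] K) (δ : Word n) (w : FockTensor n K) :
    tensorCoord K δ (RegularFunction.tensorOp 1 T w) = T (tensorCoord K δ w) := by
  have h : tensorCoord K δ ∘L RegularFunction.tensorOp 1 T = T ∘L tensorCoord K δ :=
    tensor_ext fun γ z => by
      simp only [ContinuousLinearMap.comp_apply]
      rw [tensorOp_tensorLeft, tensorCoord_tensorLeft, tensorCoord_tensorLeft, map_smul,
        one_apply_eq_self]
  exact congrArg (fun L => L w) h

end Tensor

/-! ### The reconstruction operator -/

namespace RegularFunction

open ContinuousLinearMap (adjoint)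

variable {n : ℕ} (f : RegularFunction n) (m : ℕ) {K : Type v} [NormedAddCommGroup K]
  [InnerProductSpace ℂ K] [CompleteSpace K]

/-- `Λ_β̃ e_γ = √(b_γ / b_{γβ}) e_{γβ}`: right creation operators append the letters of a word in
reversed order. -/
theorem lift_Lam_reverse_basisVec (β γ : Word n) :
    FreeMonoid.lift (f.Lam m) β.reverse (basisVec γ) =
      (√(f.weight m γ / f.weight m (γ * β)) : ℂ) • basisVec (γ * β) := by
  induction β using FreeMonoid.inductionOn' generalizing γ with
  | one =>
    have : (1 : Word n).reverse = 1 := rfl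
    simp [this, (f.weight_pos m γ).ne']
  | of_mul i β ih =>
    have h1 := (f.weight_pos m (γ * FreeMonoid.of i)).ne'
    rw [FreeMonoid.reverse_mul, FreeMonoid.reverse_of, map_mul, mul_apply_eq_comp,
      FreeMonoid.lift_eval_of, Lam_basisVec, map_smul, ih, smul_smul, ← Complex.ofReal_mul,
      ← Real.sqrt_mul (div_nonneg (f.weight_nonneg m _) (f.weight_nonneg m _)),
      div_mul_div_cancel₀ h1, mul_assoc]

theorem tensorCoord_tensorOp_Lam (β : Word n) (T : K →L[ℂ] K) (δ : Word n)
    (w : FockTensor n K) :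
    tensorCoord K δ (tensorOp (FreeMonoid.lift (f.Lam m) β.reverse) T w) =
      ∑ p ∈ Finset.HasMulAntidiagonal.mulAntidiagonal δ, if p.2 = β then
        (√(f.weight m p.1 / f.weight m δ) : ℂ) • T (tensorCoord K p.1 w) else 0 := by
  have h : tensorCoord K δ ∘L tensorOp (FreeMonoid.lift (f.Lam m) β.reverse) T =
      ∑ p ∈ Finset.HasMulAntidiagonal.mulAntidiagonal δ, if p.2 = β then
        (√(f.weight m p.1 / f.weight m δ) : ℂ) • (T ∘L tensorCoord K p.1) else 0 := by
    refine tensor_ext fun γ z => ?_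
    rw [ContinuousLinearMap.comp_apply, tensorOp_tensorLeft, tensorCoord_tensorLeft,
      lift_Lam_reverse_basisVec, sum_apply, lp.coeFn_smul, Pi.smul_apply, basisVec_apply]
    have h0 : ∀ p : Word n × Word n, p.1 ≠ γ → (if p.2 = β then
        (√(f.weight m p.1 / f.weight m δ) : ℂ) • (T ∘L tensorCoord K p.1) else 0)
          (tensorLeft (basisVec γ) z) = 0 := fun p hp => by
      split_ifs
      · rw [smul_apply, ContinuousLinearMap.comp_apply, tensorCoord_tensorLeft, basisVec_apply,
          if_neg hp]
        simp
      · rfl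
    by_cases hδ : δ = γ * β
    · subst hδ
      rw [Finset.sum_eq_single (γ, β)]
      · simp [tensorCoord_tensorLeft, basisVec_apply]
      · rintro ⟨a, b⟩ hp hne
        rw [Finset.HasMulAntidiagonal.mem_mulAntidiagonal] at hp
        refine h0 _ fun ha => hne ?_
        simp only at ha hp
        subst ha
        rw [mul_left_cancel hp]
      · simp
    · rw [if_neg hδ, Finset.sum_eq_zero]
      · simp
      · rintro ⟨a, b⟩ hp
        rw [Finset.HasMulAntidiagonal.mem_mulAntidiagonal] at hp
        by_cases ha : a = γ
        · rw [if_neg, zero_apply]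
          rintro rfl
          exact hδ (by rw [← hp, ha])
        · exact h0 _ ha
  rw [← ContinuousLinearMap.comp_apply, h, sum_apply]
  refine Finset.sum_congr rfl fun p _ => ?_
  split_ifs <;> rfl

/-- The coordinates of `∑_{β} c_β Λ_β̃ ⊗ X_β^*`, the sum running over a finite set of words. -/
theorem tensorCoord_sum (X : Fin n → K →L[ℂ] K) (s : Finset (Word n)) (c : Word n → ℝ)
    (δ : Word n) (w : FockTensor n K) :
    tensorCoord K δ ((∑ β ∈ s, (c β : ℂ) • tensorOp (FreeMonoid.lift (f.Lam m) β.reverse)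
      (adjoint (FreeMonoid.lift X β))) w) =
      ∑ p ∈ Finset.HasMulAntidiagonal.mulAntidiagonal δ,
        (((if p.2 ∈ s then c p.2 else 0) * √(f.weight m p.1 / f.weight m δ) : ℝ) : ℂ) •
          adjoint (FreeMonoid.lift X p.2) (tensorCoord K p.1 w) := by
  rw [sum_apply, map_sum]
  simp only [smul_apply, map_smul, tensorCoord_tensorOp_Lam, Finset.smul_sum]
  rw [Finset.sum_comm]
  refine Finset.sum_congr rfl fun p _ => ?_
  simp only [smul_ite, smul_zero, Finset.sum_ite_eq]
  split_ifs
  · rw [smul_smul, Complex.ofReal_mul]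
  · simp

variable {m}

/-- The row of the `√a_β Λ_β̃ ⊗ I` is a contraction, hence `∑_β a_β Λ_β̃ ⊗ X_β^*` has at most the
norm of the column of the `√a_β X_β^*`. -/
theorem norm_le_of_tensorCoord (hm : 1 ≤ m) (X : Fin n → K →L[ℂ] K) {a : Word n → ℝ}
    (ha0 : ∀ β, 0 ≤ a β) (ha : ∀ β, a β ≤ f.series.coeff β) {ρ : ℝ} (hρ : 0 ≤ ρ)
    (hX : ∀ z, ∑' β, ENNReal.ofReal (a β) * ‖adjoint (FreeMonoid.lift X β) z‖ₑ ^ 2 ≤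
      ENNReal.ofReal ρ ^ 2 * ‖z‖ₑ ^ 2)
    {A : FockTensor n K →L[ℂ] FockTensor n K}
    (hA : ∀ δ w, tensorCoord K δ (A w) = ∑ p ∈ Finset.HasMulAntidiagonal.mulAntidiagonal δ,
      ((a p.2 * √(f.weight m p.1 / f.weight m δ) : ℝ) : ℂ) •
        adjoint (FreeMonoid.lift X p.2) (tensorCoord K p.1 w)) : ‖A‖ ≤ ρ := by
  refine ContinuousLinearMap.opNorm_le_bound _ hρ fun w => ?_
  have hδ : ∀ δ, ‖tensorCoord K δ (A w)‖ₑ ^ 2 ≤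
      ∑ p ∈ Finset.HasMulAntidiagonal.mulAntidiagonal δ, ENNReal.ofReal (a p.2) *
        ‖adjoint (FreeMonoid.lift X p.2) (tensorCoord K p.1 w)‖ₑ ^ 2 := fun δ => by
    have hsq : ∀ p : Word n × Word n, √(f.weight m p.1 / f.weight m δ) ^ 2 =
        f.weight m p.1 / f.weight m δ := fun p =>
      Real.sq_sqrt (div_nonneg (f.weight_nonneg m _) (f.weight_nonneg m _))
    have h1 : ‖tensorCoord K δ (A w)‖ ≤ ∑ p ∈ Finset.HasMulAntidiagonal.mulAntidiagonal δ,
        (√(a p.2) * √(f.weight m p.1 / f.weight m δ)) *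
          (√(a p.2) * ‖adjoint (FreeMonoid.lift X p.2) (tensorCoord K p.1 w)‖) := by
      rw [hA]
      refine norm_sum_le_of_le _ fun p _ => ?_
      rw [norm_smul, Complex.norm_real,
        Real.norm_of_nonneg (mul_nonneg (ha0 _) (Real.sqrt_nonneg _))]
      conv_lhs => rw [← Real.mul_self_sqrt (ha0 p.2)]
      exact le_of_eq (by ring)
    have h2 := Finset.sum_mul_sq_le_sq_mul_sq (Finset.HasMulAntidiagonal.mulAntidiagonal δ)
      (fun p => √(a p.2) * √(f.weight m p.1 / f.weight m δ))
      (fun p => √(a p.2) * ‖adjoint (FreeMonoid.lift X p.2) (tensorCoord K p.1 w)‖)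
    simp only [mul_pow, Real.sq_sqrt (ha0 _), hsq] at h2
    have h3 : ∑ p ∈ Finset.HasMulAntidiagonal.mulAntidiagonal δ,
        a p.2 * (f.weight m p.1 / f.weight m δ) ≤ 1 := by
      refine le_trans ?_ ((div_le_one (f.weight_pos m δ)).2 (f.sum_weight_mul_coeff_le hm δ))
      rw [Finset.sum_div]
      refine Finset.sum_le_sum fun p _ => ?_
      rw [mul_comm (f.weight m p.1), mul_div_assoc]
      exact mul_le_mul_of_nonneg_right (ha _)
        (div_nonneg (f.weight_nonneg m _) (f.weight_nonneg m _))
    have h4 : ‖tensorCoord K δ (A w)‖ ^ 2 ≤ ∑ p ∈ Finset.HasMulAntidiagonal.mulAntidiagonal δ,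
        a p.2 * ‖adjoint (FreeMonoid.lift X p.2) (tensorCoord K p.1 w)‖ ^ 2 :=
      ((pow_le_pow_left₀ (norm_nonneg _) h1 2).trans h2).trans
        (mul_le_of_le_one_left (Finset.sum_nonneg fun p _ =>
          mul_nonneg (ha0 _) (sq_nonneg _)) h3)
    have h5 := ENNReal.ofReal_le_ofReal h4
    rw [ENNReal.ofReal_sum_of_nonneg fun p _ => mul_nonneg (ha0 _) (sq_nonneg _)] at h5
    simpa only [ENNReal.ofReal_mul (ha0 _), ENNReal.ofReal_pow (norm_nonneg _), ofReal_norm]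
      using h5
  have hsum : ‖A w‖ₑ ^ 2 ≤ (ENNReal.ofReal ρ * ‖w‖ₑ) ^ 2 := by
    rw [enorm_sq_eq_tsum_tensorCoord]
    refine (ENNReal.tsum_le_tsum hδ).trans ?_
    rw [← ennreal_tsum_antidiagonal fun γ β => ENNReal.ofReal (a β) *
      ‖adjoint (FreeMonoid.lift X β) (tensorCoord K γ w)‖ₑ ^ 2, mul_pow,
      enorm_sq_eq_tsum_tensorCoord w, ← ENNReal.tsum_mul_left]
    exact ENNReal.tsum_le_tsum fun γ => hX _
  have h6 : ‖A w‖ₑ ≤ ENNReal.ofReal ρ * ‖w‖ₑ := by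
    exact (ENNReal.pow_le_pow_left_iff two_ne_zero).1 hsum
  rwa [← ofReal_norm, ← ofReal_norm, ← ENNReal.ofReal_mul hρ,
    ENNReal.ofReal_le_ofReal_iff (mul_nonneg hρ (norm_nonneg _))] at h6

end RegularFunction

namespace RegularFunction

open ContinuousLinearMap (adjoint)

variable {n : ℕ} (f : RegularFunction n) {m : ℕ} {K : Type v} [NormedAddCommGroup K]
  [InnerProductSpace ℂ K] [CompleteSpace K]

theorem sum_words_reverse {E : Type*} [AddCommMonoid E] (g : Word n → E) (k : ℕ) :
    ∑ α ∈ words n k, g α = ∑ β ∈ words n k, g β.reverse :=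
  Finset.sum_nbij' FreeMonoid.reverse FreeMonoid.reverse
    (fun α hα => by rw [mem_words, FreeMonoid.length_reverse]; exact mem_words.1 hα)
    (fun α hα => by rw [mem_words, FreeMonoid.length_reverse]; exact mem_words.1 hα)
    (fun α _ => FreeMonoid.reverse_reverse) (fun α _ => FreeMonoid.reverse_reverse)
    (fun α _ => by rw [FreeMonoid.reverse_reverse])

variable {f} {X : Fin n → K →L[ℂ] K}

/-- At a point of the radial domain the homogeneous parts of `R = ∑ a_β̃ Λ_β ⊗ X_β̃^*` decay
geometrically. -/
theorem norm_reconstruction_part_le (hm : 1 ≤ m) {Y : Fin n → K →L[ℂ] K}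
    (hY : Y ∈ f.domain m K) {r : ℝ} (hr0 : 0 ≤ r) (hr1 : r ≤ 1) (k : ℕ) :
    ‖∑ β ∈ words n k, (f.series.coeff β : ℂ) •
      tensorOp (FreeMonoid.lift (f.Lam m) β.reverse)
        (adjoint (FreeMonoid.lift ((r : ℂ) • Y) β))‖ ≤ r ^ k := by
  have hA := f.tensorCoord_sum m ((r : ℂ) • Y) (words n k) f.series.coeff
  refine f.norm_le_of_tensorCoord hm ((r : ℂ) • Y)
    (a := fun β => if β ∈ words n k then f.series.coeff β else 0) (fun β => ?_)
    (fun β => ?_) (_root_.pow_nonneg hr0 _) (fun z => ?_) hA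
  · split_ifs
    exacts [f.nonneg β, le_rfl]
  · split_ifs
    exacts [le_rfl, f.nonneg β]
  · refine sum_le_of_length_ge hm hY hr0 hr1 _ (fun β => ?_) z
    by_cases hβ : β ∈ words n k
    · exact Or.inr ⟨if_pos hβ, (mem_words.1 hβ).ge⟩
    · exact Or.inl (if_neg hβ)

theorem reconstruction_eq_tsum : f.reconstruction m X = ∑' k : ℕ, ∑ β ∈ words n (k + 1),
    (f.series.coeff β : ℂ) • tensorOp (FreeMonoid.lift (f.Lam m) β.reverse)
      (adjoint (FreeMonoid.lift X β)) := by
  refine tsum_congr fun k => ?_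
  rw [sum_words_reverse]
  simp only [FreeMonoid.reverse_reverse]

theorem hasSum_reconstruction (hm : 1 ≤ m) (hX : X ∈ f.radDomain m K) :
    HasSum (fun k : ℕ => ∑ β ∈ words n (k + 1), (f.series.coeff β : ℂ) •
      tensorOp (FreeMonoid.lift (f.Lam m) β.reverse) (adjoint (FreeMonoid.lift X β)))
      (f.reconstruction m X) := by
  obtain ⟨r, hr0, hr1, Y, hY, rfl⟩ := hX
  have hs := Summable.of_norm_bounded (E := FockTensor n K →L[ℂ] FockTensor n K)
    ((summable_nat_add_iff 1).2 (summable_geometric_of_lt_one hr0 hr1)) fun k =>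
      norm_reconstruction_part_le hm hY hr0 hr1.le (k + 1)
  rw [reconstruction_eq_tsum]
  exact hs.hasSum

theorem tensorCoord_reconstruction (hm : 1 ≤ m) (hX : X ∈ f.radDomain m K) (δ : Word n)
    (w : FockTensor n K) :
    tensorCoord K δ (f.reconstruction m X w) =
      ∑ p ∈ Finset.HasMulAntidiagonal.mulAntidiagonal δ,
        ((f.series.coeff p.2 * √(f.weight m p.1 / f.weight m δ) : ℝ) : ℂ) •
          adjoint (FreeMonoid.lift X p.2) (tensorCoord K p.1 w) := by
  have h := (tensorCoord K δ ∘L ContinuousLinearMap.apply ℂ (FockTensor n K) w).hasSum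
    (hasSum_reconstruction hm hX)
  simp only [ContinuousLinearMap.comp_apply, ContinuousLinearMap.apply_apply] at h
  simp only [f.tensorCoord_sum] at h
  refine h.unique (hasSum_sum fun p _ => ?_)
  by_cases hp : p.2 = 1
  · simp only [hp, f.coeff_one, ite_self, zero_mul, Complex.ofReal_zero, zero_smul]
    exact hasSum_zero
  · have h1 : 1 ≤ p.2.length := Nat.one_le_iff_ne_zero.2 fun h => hp (FreeMonoid.length_eq_zero.1 h)
    convert hasSum_single (p.2.length - 1) fun k hk => ?_ using 1
    · rw [if_pos (mem_words.2 (by omega))]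
    · rw [if_neg fun h => hk (by rw [mem_words.1 h]; rfl)]
      simp

theorem norm_reconstruction_lt_one (hm : 1 ≤ m) (hX : X ∈ f.radDomain m K) :
    ‖f.reconstruction m X‖ < 1 := by
  have h := tensorCoord_reconstruction hm hX
  obtain ⟨r, hr0, hr1, Y, hY, rfl⟩ := hX
  refine lt_of_le_of_lt ?_ hr1
  refine f.norm_le_of_tensorCoord hm ((r : ℂ) • Y) f.nonneg (fun _ => le_rfl) hr0 (fun z => ?_) h
  have h1 := sum_le_of_length_ge hm hY hr0 hr1.le (k := 1) f.series.coeff (fun β => ?_) z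
  · rwa [pow_one] at h1
  · by_cases hβ : β = 1
    · exact Or.inl (hβ ▸ f.coeff_one)
    · exact Or.inr ⟨rfl, Nat.one_le_iff_ne_zero.2 fun h => hβ (FreeMonoid.length_eq_zero.1 h)⟩

/-- The coordinates of `(I - R)^{-k} (1 ⊗ x)` satisfy the recursion that the coefficients of
`(1 - f)^{-k}` satisfy; the vacuum vector fixes the initial value. -/
theorem tensorCoord_inverse_pow (hm : 1 ≤ m) (hX : X ∈ f.radDomain m K) (x : K) (k : ℕ)
    (δ : Word n) :
    tensorCoord K δ ((Ring.inverse (1 - f.reconstruction m X) ^ k) (vacuum n K x)) =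
      (((f.invPow k).coeff δ / √(f.weight m δ) : ℝ) : ℂ) • adjoint (FreeMonoid.lift X δ) x := by
  have hu := isUnit_one_sub_of_norm_lt_one
    (R := FockTensor n K →L[ℂ] FockTensor n K) (norm_reconstruction_lt_one hm hX)
  induction k generalizing δ with
  | zero =>
    have h1 : (vacuum n K) x = tensorLeft (basisVec 1) x := rfl
    rw [pow_zero, one_apply_eq_self, h1, tensorCoord_tensorLeft, basisVec_apply, invPow_zero,
      NCSeries.coeff_one]
    by_cases hδ : δ = 1
    · subst hδ
      rw [adjoint_lift_one]
      simp [weight_one]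
    · simp [hδ]
  | succ k ih =>
    set w := (Ring.inverse (1 - f.reconstruction m X) ^ (k + 1)) (vacuum n K x) with hw
    have h1 : w = (Ring.inverse (1 - f.reconstruction m X) ^ k) (vacuum n K x) +
        f.reconstruction m X w := by
      have h2 : (1 - f.reconstruction m X) w =
          (Ring.inverse (1 - f.reconstruction m X) ^ k) (vacuum n K x) := by
        rw [hw, ← mul_apply_eq_comp, pow_succ', ← mul_assoc, Ring.mul_inverse_cancel _ hu, one_mul]
      rw [← h2, sub_apply, one_apply_eq_self, sub_add_cancel]
    clear_value w
    -- The part of the recursion that involves `w` only has shorter words, as `f` has no constant term.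
    induction hN : δ.length using Nat.strong_induction_on generalizing δ with
    | _ N ihN =>
    rw [h1, map_add, ih, tensorCoord_reconstruction hm hX, invPow_succ_eq_add_mul,
      NCSeries.coeff_add, NCSeries.coeff_mul, add_div, Complex.ofReal_add, add_smul,
      Finset.sum_div, Complex.ofReal_sum, Finset.sum_smul]
    congr 1
    refine Finset.sum_congr rfl fun p hp => ?_
    rw [Finset.HasMulAntidiagonal.mem_mulAntidiagonal] at hp
    by_cases hp2 : p.2 = 1
    · simp [hp2, f.coeff_one]
    · have hlen := congrArg FreeMonoid.length hp
      have h3 : p.2.length ≠ 0 := fun h => hp2 (FreeMonoid.length_eq_zero.1 h)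
      rw [FreeMonoid.length_mul] at hlen
      rw [ihN p.1.length (by omega) p.1 rfl, map_smul, smul_smul, ← hp, adjoint_lift_mul,
        ← Complex.ofReal_mul]
      congr 2
      have hb := (Real.sqrt_pos.2 (f.weight_pos m p.1)).ne'
      rw [Real.sqrt_div (f.weight_nonneg m _)]
      field_simp

variable (f m) in
/-- The adjoint of `x ↦ (I - R)^{-m} (1 ⊗ x)`; at a point `X` of the radial domain it maps
`e_δ ⊗ z` to `√b_δ X_δ z`. -/
def kernelMap (X : Fin n → K →L[ℂ] K) : FockTensor n K →L[ℂ] K :=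
  adjoint (Ring.inverse ((1 - f.reconstruction m X) ^ m) ∘L vacuum n K)

theorem tensorCoord_adjoint_kernelMap (hm : 1 ≤ m) (hX : X ∈ f.radDomain m K) (x : K)
    (δ : Word n) : tensorCoord K δ (adjoint (f.kernelMap m X) x) =
      (√(f.weight m δ) : ℂ) • adjoint (FreeMonoid.lift X δ) x := by
  rw [kernelMap, ContinuousLinearMap.adjoint_adjoint, ContinuousLinearMap.comp_apply,
    ← Ring.inverse_pow, tensorCoord_inverse_pow hm hX, ← f.weight_eq_coeff_invPow hm,
    Real.div_sqrt]

theorem kernelMap_tensorLeft (hm : 1 ≤ m) (hX : X ∈ f.radDomain m K) (δ : Word n) (z : K) :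
    f.kernelMap m X (tensorLeft (basisVec δ) z) =
      (√(f.weight m δ) : ℂ) • FreeMonoid.lift X δ z := by
  refine ext_inner_right ℂ fun y => ?_
  rw [← ContinuousLinearMap.adjoint_inner_right, ← ContinuousLinearMap.adjoint_inner_right,
    ← tensorCoord, tensorCoord_adjoint_kernelMap hm hX, inner_smul_right, inner_smul_left,
    ContinuousLinearMap.adjoint_inner_right, Complex.conj_ofReal]

theorem summable_weight_mul_sq (hm : 1 ≤ m) (hX : X ∈ f.radDomain m K) (x : K) :
    Summable fun δ => f.weight m δ * ‖adjoint (FreeMonoid.lift X δ) x‖ ^ 2 := by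
  have h := Complex.reCLM.hasSum (hasSum_inner_tensorCoord (adjoint (f.kernelMap m X) x)
    (adjoint (f.kernelMap m X) x))
  refine h.summable.congr fun δ => ?_
  rw [tensorCoord_adjoint_kernelMap hm hX, inner_smul_left, inner_smul_right,
    inner_self_eq_norm_sq_to_K, Complex.conj_ofReal, ← mul_assoc, ← Complex.ofReal_mul,
    Real.mul_self_sqrt (f.weight_nonneg m _)]
  simp [← Complex.ofReal_pow]

theorem exists_isPhi_of_mem_radDomain (hm : 1 ≤ m) (hX : X ∈ f.radDomain m K) :
    ∃ Φ, f.IsPhi X Φ := by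
  obtain ⟨r, hr0, hr1, Y, hY, rfl⟩ := hX
  exact exists_isPhi_smul hm hY hr0 hr1.le

/-- `∑_α b_α^{(k)} X_α (id - Φ_{f,X})^k(I) X_α^* = I`, by telescoping in `k`. -/
theorem hasSum_invPow_defect (hm : 1 ≤ m) (hX : X ∈ f.radDomain m K) (x : K) {k : ℕ}
    (hk : k ≤ m) :
    HasSum (fun δ => ((f.invPow k).coeff δ : ℂ) * inner ℂ (adjoint (FreeMonoid.lift X δ) x)
      (f.defect X k (adjoint (FreeMonoid.lift X δ) x))) (inner ℂ x x) := by
  induction k with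
  | zero =>
    convert hasSum_single (1 : Word n) fun δ hδ => ?_ using 1
    · rw [adjoint_lift_one, invPow_zero, NCSeries.coeff_one]
      simp [defect]
    · rw [invPow_zero, NCSeries.coeff_one, if_neg hδ]
      simp
  | succ k ih =>
    have ih := ih (by omega)
    set D := f.defect X k with hD
    have hΦ := isPhi_phi (exists_isPhi_of_mem_radDomain hm hX)
    have hle : ∀ δ, (f.invPow (k + 1)).coeff δ ≤ f.weight m δ := fun δ => by
      rw [f.weight_eq_coeff_invPow hm]
      exact f.coeff_invPow_mono hk δ
    have hle' : ∀ δ, (f.invPow (k + 1) * f.series).coeff δ ≤ f.weight m δ := fun δ => by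
      refine le_trans ?_ (hle δ)
      conv_rhs => rw [invPow_succ_eq_add_mul, NCSeries.coeff_add]
      exact le_add_of_nonneg_left (f.coeff_invPow_nonneg k δ)
    let t : (K →L[ℂ] K) → Word n → ℂ := fun T δ =>
      inner ℂ (adjoint (FreeMonoid.lift X δ) x) (T (adjoint (FreeMonoid.lift X δ) x))
    -- The double series `∑_{α,β} b_α^{(k+1)} a_β X_{αβ} D X_{αβ}^*` is summed over `β` first and by the
    -- product `αβ`; its terms are dominated by those of `∑_δ b_δ^{(m)} X_δ X_δ^*`.
    have hpair : Summable fun p : Word n × Word n => ((f.invPow (k + 1)).coeff p.1 : ℂ) *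
        ((f.series.coeff p.2 : ℂ) * t D (p.1 * p.2)) := by
      refine Summable.of_norm_bounded (g := fun p => ‖D‖ * ((f.invPow (k + 1)).coeff p.1 *
        f.series.coeff p.2 * ‖adjoint (FreeMonoid.lift X (p.1 * p.2)) x‖ ^ 2)) ?_ fun p => ?_
      · refine Summable.mul_left _ (summable_of_antidiagonal (fun p => mul_nonneg (mul_nonneg
          (f.coeff_invPow_nonneg _ _) (f.nonneg _)) (sq_nonneg _)) ?_)
        refine Summable.of_nonneg_of_le (fun δ => Finset.sum_nonneg fun p _ => mul_nonneg
          (mul_nonneg (f.coeff_invPow_nonneg _ _) (f.nonneg _)) (sq_nonneg _)) (fun δ => ?_)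
          (summable_weight_mul_sq hm hX x)
        refine le_trans (le_of_eq ?_) (mul_le_mul_of_nonneg_right (hle' δ) (sq_nonneg _))
        rw [NCSeries.coeff_mul, Finset.sum_mul]
        exact Finset.sum_congr rfl fun p hp => by
          rw [Finset.HasMulAntidiagonal.mem_mulAntidiagonal.1 hp]
      · rw [norm_mul, norm_mul, Complex.norm_real, Complex.norm_real,
          Real.norm_of_nonneg (f.nonneg _), Real.norm_of_nonneg (f.coeff_invPow_nonneg _ _)]
        have h1 : ‖t D (p.1 * p.2)‖ ≤ ‖D‖ * ‖adjoint (FreeMonoid.lift X (p.1 * p.2)) x‖ ^ 2 := by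
          refine (norm_inner_le_norm _ _).trans ((mul_le_mul_of_nonneg_left (D.le_opNorm _)
            (norm_nonneg _)).trans_eq (by ring))
        calc _ ≤ (f.invPow (k + 1)).coeff p.1 * (f.series.coeff p.2 *
              (‖D‖ * ‖adjoint (FreeMonoid.lift X (p.1 * p.2)) x‖ ^ 2)) :=
              mul_le_mul_of_nonneg_left (mul_le_mul_of_nonneg_left h1 (f.nonneg _))
                (f.coeff_invPow_nonneg _ _)
          _ = _ := by ring
    obtain ⟨s, hs⟩ := hpair
    have h0 : ∀ α, HasSum (fun β => (f.series.coeff β : ℂ) * t D (α * β)) (t (f.phi X D) α) :=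
      fun α => by
        have h := hΦ.hasSum D (adjoint (FreeMonoid.lift X α) x) (adjoint (FreeMonoid.lift X α) x)
        simp only [← adjoint_lift_mul] at h
        exact h
    have h1 : HasSum (fun α => ((f.invPow (k + 1)).coeff α : ℂ) * t (f.phi X D) α) s := by
      have h01 : ∀ α, HasSum (fun β => ((f.invPow (k + 1)).coeff α : ℂ) *
          ((f.series.coeff β : ℂ) * t D (α * β)))
          (((f.invPow (k + 1)).coeff α : ℂ) * t (f.phi X D) α) := fun α => (h0 α).mul_left _
      exact hs.prod_fiberwise h01
    have h2 : HasSum (fun δ => ((f.invPow (k + 1) * f.series).coeff δ : ℂ) * t D δ) s := by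
      refine (hasSum_antidiagonal hs).congr_fun fun δ => ?_
      rw [NCSeries.coeff_mul, Complex.ofReal_sum, Finset.sum_mul]
      refine Finset.sum_congr rfl fun p hp => ?_
      rw [Finset.HasMulAntidiagonal.mem_mulAntidiagonal.1 hp, Complex.ofReal_mul, mul_assoc]
    have h3 := (ih.add h2).sub h1
    rw [add_sub_cancel_right] at h3
    refine h3.congr_fun fun δ => ?_
    have h4 : t (f.defect X (k + 1)) δ = t D δ - t (f.phi X D) δ := by
      simp only [t]
      rw [defect_succ, sub_apply, inner_sub_right]
    change _ * t (f.defect X (k + 1)) δ = _ * t D δ + _ - _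
    have h5 : (f.invPow (k + 1)).coeff δ =
        (f.invPow k).coeff δ + (f.invPow (k + 1) * f.series).coeff δ := by
      conv_lhs => rw [invPow_succ_eq_add_mul, NCSeries.coeff_add]
    rw [h4, mul_sub, h5, Complex.ofReal_add]
    ring

/-- The Berezin transform of the identity is the identity. -/
theorem kernelMap_defect (hm : 1 ≤ m) (hX : X ∈ f.radDomain m K) (x : K) :
    f.kernelMap m X (tensorOp 1 (f.defect X m) (adjoint (f.kernelMap m X) x)) = x := by
  have h : f.kernelMap m X ∘L tensorOp 1 (f.defect X m) ∘L adjoint (f.kernelMap m X) = 1 := by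
    rw [← ContinuousLinearMap.coe_inj]
    refine (ext_inner_map _ _).1 fun x => ?_
    have hconj := congrArg (starRingEnd ℂ) ((hasSum_inner_tensorCoord (adjoint (f.kernelMap m X) x)
      (tensorOp 1 (f.defect X m) (adjoint (f.kernelMap m X) x))).unique
      ((hasSum_invPow_defect hm hX x le_rfl).congr_fun fun δ => ?_))
    · rw [inner_conj_symm, inner_conj_symm, ContinuousLinearMap.adjoint_inner_right] at hconj
      exact hconj
    · rw [tensorCoord_tensorOp_one, tensorCoord_adjoint_kernelMap hm hX, map_smul,
        inner_smul_left, inner_smul_right, Complex.conj_ofReal, ← mul_assoc,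
        ← Complex.ofReal_mul, Real.mul_self_sqrt (f.weight_nonneg m _),
        f.weight_eq_coeff_invPow hm]
  exact congrArg (fun L => L x) h

/-- For fixed `z`, the map `ξ ↦ ∑_α √b_α ξ_α X_α z` from the Fock space to `K` intertwines
`φ = ∑ c_α W_α` with `∑ c_α X_α`. -/
theorem kernelMap_intertwines (hm : 1 ≤ m) (hX : X ∈ f.radDomain m K)
    {φ : Fock n →L[ℂ] Fock n} {c : NCSeries n ℂ} (hφ : f.HasFourier m φ c) {T : K →L[ℂ] K}
    (hT : HasSum (c.homog X) T) (z : K) (ξ : Fock n) :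
    f.kernelMap m X (tensorLeft (φ ξ) z) = T (f.kernelMap m X (tensorLeft ξ z)) := by
  have h : f.kernelMap m X ∘L tensorRight z ∘L φ = T ∘L f.kernelMap m X ∘L tensorRight z := by
    refine clm_ext fun γ => ?_
    have h1 := (f.kernelMap m X ∘L tensorRight z).hasSum
      (hφ.2 _ (Submodule.subset_span ⟨γ, rfl⟩))
    have h2 := (ContinuousLinearMap.apply ℂ K
      ((√(f.weight m γ) : ℂ) • FreeMonoid.lift X γ z)).hasSum hT
    have h3 := h2.tendsto_sum_nat
    simp only [ContinuousLinearMap.comp_apply, tensorRight_apply, kernelMap_tensorLeft hm hX]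
    refine tendsto_nhds_unique (tendsto_sum_words h1) (h3.congr fun N => ?_)
    refine Finset.sum_congr rfl fun k _ => ?_
    rw [NCSeries.homog, map_sum]
    refine Finset.sum_congr rfl fun β _ => ?_
    simp only [ContinuousLinearMap.apply_apply, ContinuousLinearMap.comp_apply, smul_apply,
      map_smul, lift_W_basisVec, tensorRight_apply, kernelMap_tensorLeft hm hX, map_mul,
      mul_apply_eq_comp]
    congr 1
    rw [smul_smul, ← Complex.ofReal_mul, Real.sqrt_div (f.weight_nonneg m _),
      div_mul_cancel₀ _ (Real.sqrt_pos.2 (f.weight_pos m _)).ne']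
  exact congrArg (fun L => L ξ) h

/-- The Berezin transform at `X` of `φ = ∑ c_α W_α` is `∑ c_α X_α`: the factor `φ` can be moved
through `kernelMap`, and what remains is the Berezin transform of the identity. -/
theorem berezin_eq (hm : 1 ≤ m) (hX : X ∈ f.radDomain m K)
    {φ : Fock n →L[ℂ] Fock n} {c : NCSeries n ℂ} (hφ : f.HasFourier m φ c) {T : K →L[ℂ] K}
    (hT : HasSum (c.homog X) T) : f.berezin m X φ = T := by
  have h1 : f.berezin m X φ =
      f.kernelMap m X ∘L tensorOp φ (f.defect X m) ∘L adjoint (f.kernelMap m X) := by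
    rw [kernelMap, ContinuousLinearMap.adjoint_adjoint, ContinuousLinearMap.adjoint_comp]
    rfl
  have h2 : f.kernelMap m X ∘L tensorOp φ (f.defect X m) =
      T ∘L f.kernelMap m X ∘L tensorOp 1 (f.defect X m) := tensor_ext fun γ z => by
    simp only [ContinuousLinearMap.comp_apply, tensorOp_tensorLeft]
    exact kernelMap_intertwines hm hX hφ hT _ _
  ext x
  rw [h1]
  have h3 := congrArg (fun L => L (adjoint (f.kernelMap m X) x)) h2
  simp only [ContinuousLinearMap.comp_apply] at h3 ⊢
  rw [h3, kernelMap_defect hm hX]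

end RegularFunction

/-! ### The von Neumann inequality -/

section MatrixOp

open ContinuousLinearMap (adjoint)

variable {K : Type v} [NormedAddCommGroup K] [InnerProductSpace ℂ K] {p : ℕ}

omit [InnerProductSpace ℂ K] in
theorem enorm_sq_piLp (x : PiLp 2 (fun _ : Fin p => K)) : ‖x‖ₑ ^ 2 = ∑ i, ‖x i‖ₑ ^ 2 := by
  simp only [← ofReal_norm, ← ENNReal.ofReal_pow (norm_nonneg _)]
  rw [PiLp.norm_sq_eq_of_L2, ENNReal.ofReal_sum_of_nonneg fun _ _ => sq_nonneg _]

theorem adjoint_matrixOp [CompleteSpace K] (A : Matrix (Fin p) (Fin p) (K →L[ℂ] K)) :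
    adjoint (matrixOp A) = matrixOp (Matrix.of fun i j => adjoint (A j i)) := by
  symm
  rw [ContinuousLinearMap.eq_adjoint_iff]
  intro x y
  simp only [PiLp.inner_apply, matrixOp_apply, Matrix.of_apply, sum_inner, inner_sum,
    ContinuousLinearMap.adjoint_inner_left]
  exact Finset.sum_comm

theorem norm_matrixOp_one (A : K →L[ℂ] K) :
    ‖matrixOp (Matrix.of fun _ _ : Fin 1 => A)‖ = ‖A‖ := by
  have hsq : ∀ x : PiLp 2 (fun _ : Fin 1 => K), ‖x‖ = ‖x 0‖ := fun x => by
    have h := PiLp.norm_sq_eq_of_L2 _ x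
    rw [Fin.sum_univ_one] at h
    exact (sq_eq_sq₀ (norm_nonneg _) (norm_nonneg _)).1 h
  have happ : ∀ x, matrixOp (Matrix.of fun _ _ : Fin 1 => A) x 0 = A (x 0) := fun x => by
    rw [matrixOp_apply, Fin.sum_univ_one, Matrix.of_apply]
  refine le_antisymm (ContinuousLinearMap.opNorm_le_bound _ (norm_nonneg _) fun x => ?_)
    (ContinuousLinearMap.opNorm_le_bound _ (ContinuousLinearMap.opNorm_nonneg _) fun x => ?_)
  · rw [hsq, hsq, happ]
    exact A.le_opNorm _
  · have h := (matrixOp (Matrix.of fun _ _ : Fin 1 => A)).le_opNorm (WithLp.toLp 2 fun _ => x)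
    rwa [hsq, hsq, happ] at h

end MatrixOp

namespace RegularFunction

open ContinuousLinearMap (adjoint)

variable {n : ℕ} {f : RegularFunction n} {m : ℕ} {K : Type v} [NormedAddCommGroup K]
  [InnerProductSpace ℂ K] [CompleteSpace K] {X : Fin n → K →L[ℂ] K}

theorem hasSum_weight_defect (hm : 1 ≤ m) (hX : X ∈ f.radDomain m K) (x : K) :
    HasSum (fun δ => f.weight m δ * RCLike.re (inner ℂ (adjoint (FreeMonoid.lift X δ) x)
      (f.defect X m (adjoint (FreeMonoid.lift X δ) x)))) (‖x‖ ^ 2) := by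
  have h := Complex.reCLM.hasSum (hasSum_invPow_defect hm hX x le_rfl)
  have h1 : Complex.reCLM (inner ℂ x x) = ‖x‖ ^ 2 := inner_self_eq_norm_sq (𝕜 := ℂ) x
  rw [h1] at h
  refine h.congr_fun fun δ => ?_
  rw [f.weight_eq_coeff_invPow hm, Complex.reCLM_apply, Complex.re_ofReal_mul]
  rfl

/-- A jointly coisometric family of operators from the Fock space to `K` that intertwines the model
with the tuple `X`: the family of the maps `ξ ↦ ∑_α √b_α ξ_α X_α Δ u` with `Δ` the square root of
`(id - Φ_{f,X})^m (I)` and `u` running over a Hilbert basis of `K`. -/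
theorem exists_intertwining_family (hm : 1 ≤ m) (hX : X ∈ f.radDomain m K)
    (hpos : (f.defect X m).IsPositive) :
    ∃ (ι : Type v) (L : ι → Fock n →L[ℂ] K),
      (∀ (φ : Fock n →L[ℂ] Fock n) (c : NCSeries n ℂ) (T : K →L[ℂ] K), f.HasFourier m φ c →
        HasSum (c.homog X) T → ∀ s ξ, L s (φ ξ) = T (L s ξ)) ∧
      ∀ x, ∑' s, ‖adjoint (L s) x‖ₑ ^ 2 = ‖x‖ₑ ^ 2 := by
  obtain ⟨w, b, -⟩ := exists_hilbertBasis ℂ K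
  have h0 : 0 ≤ f.defect X m := (ContinuousLinearMap.nonneg_iff_isPositive _).2 hpos
  set S := CFC.sqrt (f.defect X m) with hS
  have hSa : adjoint S = S := (CFC.sqrt_nonneg (f.defect X m)).isSelfAdjoint
  have hSS : ∀ z, ‖S z‖ ^ 2 = RCLike.re (inner ℂ z (f.defect X m z)) := fun z => by
    rw [← @inner_self_eq_norm_sq ℂ, ← ContinuousLinearMap.adjoint_inner_right, hSa,
      ← mul_apply_eq_comp, hS, CFC.sqrt_mul_sqrt_self _ h0]
  refine ⟨w, fun s => f.kernelMap m X ∘L tensorRight (S (b s)), fun φ c T hφ hT s ξ => ?_,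
    fun x => ?_⟩
  · exact kernelMap_intertwines hm hX hφ hT _ _
  · have hco : ∀ s γ, adjoint (f.kernelMap m X ∘L tensorRight (S (b s))) x γ =
        (√(f.weight m γ) : ℂ) * b.repr (S (adjoint (FreeMonoid.lift X γ) x)) s := fun s γ => by
      rw [← inner_basisVec, ContinuousLinearMap.adjoint_inner_right, ContinuousLinearMap.comp_apply,
        tensorRight_apply, kernelMap_tensorLeft hm hX, inner_smul_left, Complex.conj_ofReal,
        b.repr_apply_apply]
      congr 1
      rw [← ContinuousLinearMap.adjoint_inner_right, ← ContinuousLinearMap.adjoint_inner_right, hSa]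
    have h1 : ∀ γ, ∑' s, ‖adjoint (f.kernelMap m X ∘L tensorRight (S (b s))) x γ‖ₑ ^ 2 =
        ENNReal.ofReal (f.weight m γ * RCLike.re (inner ℂ (adjoint (FreeMonoid.lift X γ) x)
          (f.defect X m (adjoint (FreeMonoid.lift X γ) x)))) := fun γ => by
      simp only [hco, enorm_mul, mul_pow]
      rw [ENNReal.tsum_mul_left, ← enorm_sq_eq_tsum, b.repr.enorm_map, ← hSS,
        ENNReal.ofReal_mul (f.weight_nonneg m _), ENNReal.ofReal_pow (norm_nonneg _), ofReal_norm,
        ← ofReal_norm, Complex.norm_real, Real.norm_of_nonneg (Real.sqrt_nonneg _),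
        ← ENNReal.ofReal_pow (Real.sqrt_nonneg _), Real.sq_sqrt (f.weight_nonneg m _)]
    have h2 := hasSum_weight_defect hm hX x
    simp only [enorm_sq_eq_tsum]
    rw [ENNReal.tsum_comm]
    simp only [h1]
    rw [← ENNReal.ofReal_tsum_of_nonneg (fun γ => mul_nonneg (f.weight_nonneg m γ)
      (hpos.re_inner_nonneg_right _)) h2.summable, h2.tsum_eq,
      ENNReal.ofReal_pow (norm_nonneg _), ofReal_norm]

/-- The von Neumann inequality for matrices of multipliers. By the intertwining family, the adjoint
of the matrix `T` is the restriction of a multiple of the adjoint of the matrix `φ` to an invariant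
subspace. -/
theorem norm_matrixOp_le (hm : 1 ≤ m) (hX : X ∈ f.radDomain m K)
    (hpos : (f.defect X m).IsPositive) {p : ℕ} {φ : Matrix (Fin p) (Fin p) (Fock n →L[ℂ] Fock n)}
    {c : Matrix (Fin p) (Fin p) (NCSeries n ℂ)} {T : Matrix (Fin p) (Fin p) (K →L[ℂ] K)}
    (hφ : ∀ i j, f.HasFourier m (φ i j) (c i j)) (hT : ∀ i j, HasSum ((c i j).homog X) (T i j)) :
    ‖matrixOp T‖ₑ ≤ ‖matrixOp φ‖ₑ := by
  obtain ⟨ι, L, hL, hLx⟩ := exists_intertwining_family hm hX hpos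
  have hadj : ∀ s i j z, adjoint (L s) (adjoint (T i j) z) = adjoint (φ i j) (adjoint (L s) z) :=
    fun s i j z => by
      refine ext_inner_right ℂ fun ξ => ?_
      simp only [ContinuousLinearMap.adjoint_inner_left]
      rw [hL _ _ _ (hφ i j) (hT i j)]
  rw [← LinearIsometryEquiv.enorm_map ContinuousLinearMap.adjoint (matrixOp T),
    ← LinearIsometryEquiv.enorm_map ContinuousLinearMap.adjoint (matrixOp φ)]
  have hle : ∀ x, ‖adjoint (matrixOp T) x‖ₑ ≤ ‖adjoint (matrixOp φ)‖ₑ * ‖x‖ₑ := fun x => by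
    refine (ENNReal.pow_le_pow_left_iff two_ne_zero).1 ?_
    let V : ι → PiLp 2 (fun _ : Fin p => Fock n) := fun s =>
      WithLp.toLp 2 fun j => adjoint (L s) (x j)
    have hV : ∀ s, ‖V s‖ₑ ^ 2 = ∑ j, ‖adjoint (L s) (x j)‖ₑ ^ 2 := fun s => enorm_sq_piLp _
    have hTV : ∀ s i, adjoint (L s) (adjoint (matrixOp T) x i) =
        adjoint (matrixOp φ) (V s) i := fun s i => by
      rw [adjoint_matrixOp, adjoint_matrixOp, matrixOp_apply, matrixOp_apply, map_sum]
      simp only [Matrix.of_apply]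
      exact Finset.sum_congr rfl fun j _ => hadj s j i _
    calc ‖adjoint (matrixOp T) x‖ₑ ^ 2
        = ∑ i, ∑' s, ‖adjoint (matrixOp φ) (V s) i‖ₑ ^ 2 := by
          rw [enorm_sq_piLp]
          refine Finset.sum_congr rfl fun i _ => ?_
          rw [← hLx]
          simp only [hTV]
      _ = ∑' s, ‖adjoint (matrixOp φ) (V s)‖ₑ ^ 2 := by
          rw [← Summable.tsum_finsetSum fun _ _ => ENNReal.summable]
          simp only [enorm_sq_piLp]
      _ ≤ ∑' s, ‖adjoint (matrixOp φ)‖ₑ ^ 2 * ‖V s‖ₑ ^ 2 := by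
          refine ENNReal.tsum_le_tsum fun s => ?_
          rw [← mul_pow]
          exact pow_le_pow_left' (ContinuousLinearMap.le_opENorm _ _) 2
      _ = (‖adjoint (matrixOp φ)‖ₑ * ‖x‖ₑ) ^ 2 := by
          rw [ENNReal.tsum_mul_left, mul_pow]
          congr 1
          simp only [hV]
          rw [Summable.tsum_finsetSum fun _ _ => ENNReal.summable, enorm_sq_piLp]
          exact Finset.sum_congr rfl fun j _ => hLx _
  exact ContinuousLinearMap.opENorm_le_bound _ hle

/-- The von Neumann inequality. -/
theorem norm_le_of_hasFourier (hm : 1 ≤ m) (hX : X ∈ f.radDomain m K)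
    (hpos : (f.defect X m).IsPositive) {φ : Fock n →L[ℂ] Fock n} {c : NCSeries n ℂ}
    {T : K →L[ℂ] K} (hφ : f.HasFourier m φ c) (hT : HasSum (c.homog X) T) : ‖T‖ ≤ ‖φ‖ := by
  have h := norm_matrixOp_le hm hX hpos (p := 1) (φ := Matrix.of fun _ _ => φ)
    (c := Matrix.of fun _ _ => c) (T := Matrix.of fun _ _ => T) (fun _ _ => hφ) (fun _ _ => hT)
  rwa [enorm_le_iff_norm_le, norm_matrixOp_one, norm_matrixOp_one] at h

end RegularFunction

/-! ### Series and their homogeneous parts -/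

namespace NCSeries

variable {n : ℕ} {A : Type*} [Ring A] [Algebra ℂ A]

/-- The homogeneous part of degree `k` of a series, as a series. -/
def homogPart (c : NCSeries n ℂ) (k : ℕ) : NCSeries n ℂ :=
  ⟨fun α => if α.length = k then c.coeff α else 0⟩

/-- The series `∑ r^{|α|} c_α Z_α`. -/
def dilate (c : NCSeries n ℂ) (r : ℂ) : NCSeries n ℂ := ⟨fun α => r ^ α.length * c.coeff α⟩

theorem homog_homogPart (c : NCSeries n ℂ) (X : Fin n → A) (k j : ℕ) :
    (c.homogPart k).homog X j = if j = k then c.homog X k else 0 := by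
  split_ifs with h
  · subst h
    refine Finset.sum_congr rfl fun α hα => ?_
    simp only [homogPart]
    rw [if_pos (mem_words.1 hα)]
  · refine Finset.sum_eq_zero fun α hα => ?_
    simp only [homogPart]
    rw [if_neg (fun h' => h (by rw [← mem_words.1 hα, h'])), zero_smul]

theorem hasSum_homogPart [TopologicalSpace A] (c : NCSeries n ℂ) (X : Fin n → A) (k : ℕ) :
    HasSum ((c.homogPart k).homog X) (c.homog X k) := by
  convert hasSum_ite_eq k (c.homog X k) using 1
  ext j
  rw [homog_homogPart]

theorem homog_dilate (c : NCSeries n ℂ) (r : ℂ) (X : Fin n → A) (k : ℕ) :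
    (c.dilate r).homog X k = c.homog (r • X) k := by
  rw [homog_smul, homog, homog, Finset.smul_sum]
  refine Finset.sum_congr rfl fun α hα => ?_
  rw [smul_smul, ← mem_words.1 hα]
  rfl

end NCSeries

/-! ### Multipliers in coordinates -/

namespace RegularFunction

open ContinuousLinearMap (adjoint)

variable {n : ℕ} {f : RegularFunction n} {m : ℕ}

variable (f m) in
/-- The coordinate at `δ` of `(∑ c_β W_β) ξ`. -/
def fourierCoord (c : NCSeries n ℂ) (ξ : Fock n) (δ : Word n) : ℂ :=
  ∑ p ∈ Finset.HasMulAntidiagonal.mulAntidiagonal δ,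
    c.coeff p.1 * ((√(f.weight m p.2 / f.weight m δ) : ℂ) * ξ p.2)

/-- Comparing coordinates, a Fourier representation is an identity of finite sums. -/
theorem hasFourier_iff_coord {φ : Fock n →L[ℂ] Fock n} {c : NCSeries n ℂ} :
    f.HasFourier m φ c ↔ ∀ ξ δ, φ ξ δ = f.fourierCoord m c ξ δ := by
  have hb : ∀ α, (√(f.weight m α) : ℂ) ≠ 0 := fun α =>
    Complex.ofReal_ne_zero.2 (Real.sqrt_pos.2 (f.weight_pos m α)).ne'
  have key : ∀ ξ δ, (c * f.toSeries m ξ).coeff δ =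
      (√(f.weight m δ) : ℂ) * f.fourierCoord m c ξ δ := fun ξ δ => by
    rw [NCSeries.coeff_mul, fourierCoord, Finset.mul_sum]
    refine Finset.sum_congr rfl fun p _ => ?_
    rw [Real.sqrt_div (f.weight_nonneg m _), Complex.ofReal_div]
    simp only [toSeries]
    field_simp [hb]
  rw [hasFourier_iff]
  refine forall_congr' fun ξ => ?_
  constructor
  · intro h δ
    have h1 := congrArg (fun F => F.coeff δ) h
    simp only [key] at h1
    exact mul_left_cancel₀ (hb δ) h1
  · intro h
    ext δ
    rw [key, ← h]
    rfl

theorem HasFourier.op_unique {φ ψ : Fock n →L[ℂ] Fock n} {c : NCSeries n ℂ}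
    (h : f.HasFourier m φ c) (h' : f.HasFourier m ψ c) : φ = ψ := by
  ext ξ δ
  rw [hasFourier_iff_coord.1 h, hasFourier_iff_coord.1 h']

theorem fourierCoord_vacuum (c : NCSeries n ℂ) (δ : Word n) :
    f.fourierCoord m c (basisVec 1) δ = c.coeff δ * (√(1 / f.weight m δ) : ℂ) := by
  rw [fourierCoord, Finset.sum_eq_single (δ, 1)]
  · simp [basisVec_apply, weight_one]
  · rintro ⟨a, b⟩ hp hne
    rw [Finset.HasMulAntidiagonal.mem_mulAntidiagonal] at hp
    have hb : b ≠ 1 := by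
      rintro rfl
      exact hne (by simpa using hp)
    simp [basisVec_apply, hb]
  · simp

theorem HasFourier.series_unique {φ : Fock n →L[ℂ] Fock n} {c d : NCSeries n ℂ}
    (h : f.HasFourier m φ c) (h' : f.HasFourier m φ d) : c = d := by
  ext δ
  have h1 := (hasFourier_iff_coord.1 h (basisVec 1) δ).symm.trans
    (hasFourier_iff_coord.1 h' (basisVec 1) δ)
  rw [fourierCoord_vacuum, fourierCoord_vacuum] at h1
  refine mul_right_cancel₀ ?_ h1
  exact Complex.ofReal_ne_zero.2 (Real.sqrt_pos.2 (one_div_pos.2 (f.weight_pos m δ))).ne'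

theorem HasFourier.mul {φ ψ : Fock n →L[ℂ] Fock n} {c d : NCSeries n ℂ}
    (h : f.HasFourier m φ c) (h' : f.HasFourier m ψ d) : f.HasFourier m (φ * ψ) (c * d) := by
  rw [hasFourier_iff] at h h' ⊢
  intro ξ
  rw [mul_apply_eq_comp, h, h', mul_assoc]

theorem HasFourier.add {φ ψ : Fock n →L[ℂ] Fock n} {c d : NCSeries n ℂ}
    (h : f.HasFourier m φ c) (h' : f.HasFourier m ψ d) : f.HasFourier m (φ + ψ) (c + d) := by
  rw [hasFourier_iff] at h h' ⊢
  intro ξ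
  rw [add_apply, toSeries_add, h, h', add_mul]

theorem hasFourier_algebraMap (z : ℂ) :
    f.HasFourier m (algebraMap ℂ (Fock n →L[ℂ] Fock n) z) (algebraMap ℂ (NCSeries n ℂ) z) := by
  rw [hasFourier_iff]
  intro ξ
  rw [ContinuousLinearMap.algebraMap_apply, toSeries_smul, Algebra.smul_def]

theorem HasFourier.sub {φ ψ : Fock n →L[ℂ] Fock n} {c d : NCSeries n ℂ}
    (h : f.HasFourier m φ c) (h' : f.HasFourier m ψ d) : f.HasFourier m (φ - ψ) (c - d) := by
  have h1 := h.add ((hasFourier_algebraMap (-1)).mul h')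
  rw [map_neg, map_one, map_neg, map_one, neg_one_mul, neg_one_mul, ← sub_eq_add_neg,
    ← sub_eq_add_neg] at h1
  exact h1

theorem hasFourier_homog (c : NCSeries n ℂ) (k : ℕ) :
    f.HasFourier m (c.homog (f.W m) k) (c.homogPart k) := by
  have h0 : ∀ β ∉ words n k, (c.homogPart k).coeff β = 0 := fun β hβ =>
    if_neg fun h => hβ (mem_words.2 h)
  refine ⟨summable_of_ne_finset_zero (s := words n k) fun β hβ => by simp [h0 β hβ],
    fun p _ => ?_⟩
  have h1 : c.homog (f.W m) k p =
      ∑ β ∈ words n k, (c.homogPart k).coeff β • FreeMonoid.lift (f.W m) β p := by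
    rw [NCSeries.homog, sum_apply]
    refine Finset.sum_congr rfl fun β hβ => ?_
    have h2 : (c.homogPart k).coeff β = c.coeff β := if_pos (mem_words.1 hβ)
    rw [h2, smul_apply]
  rw [h1]
  exact hasSum_sum_of_ne_finset_zero fun β hβ => by rw [h0 β hβ, zero_smul]

theorem hasFourier_of_hasSum {c : NCSeries n ℂ} {T : Fock n →L[ℂ] Fock n}
    (h : HasSum (c.homog (f.W m)) T) : f.HasFourier m T c := by
  rw [hasFourier_iff_coord]
  intro ξ δ
  have h1 := (lp.evalCLM ℂ (fun _ : Word n => ℂ) 2 δ ∘L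
    ContinuousLinearMap.apply ℂ (Fock n) ξ).hasSum h
  have h2 : ∀ A : Fock n →L[ℂ] Fock n, (lp.evalCLM ℂ (fun _ : Word n => ℂ) 2 δ ∘L
    ContinuousLinearMap.apply ℂ (Fock n) ξ) A = A ξ δ := fun _ => rfl
  simp only [h2, hasFourier_iff_coord.1 (hasFourier_homog c _)] at h1
  refine h1.unique (hasSum_sum fun p _ => ?_)
  refine HasSum.mul_right _ ?_
  exact (hasSum_ite_eq p.1.length (c.coeff p.1)).congr_fun fun k => if_congr eq_comm rfl rfl

/-- A norm limit of multipliers whose Fourier coefficients converge is the multiplier with the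
limit coefficients. -/
theorem hasFourier_of_tendsto {ι : Type*} {l : Filter ι} [l.NeBot]
    {φ : ι → Fock n →L[ℂ] Fock n} {c : ι → NCSeries n ℂ} {ψ : Fock n →L[ℂ] Fock n}
    {d : NCSeries n ℂ} (h : ∀ᶠ i in l, f.HasFourier m (φ i) (c i))
    (hφ : Tendsto φ l (𝓝 ψ)) (hc : ∀ α, Tendsto (fun i => (c i).coeff α) l (𝓝 (d.coeff α))) :
    f.HasFourier m ψ d := by
  rw [hasFourier_iff_coord]
  intro ξ δ
  have h1 := ((lp.evalCLM ℂ (fun _ : Word n => ℂ) 2 δ ∘L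
    ContinuousLinearMap.apply ℂ (Fock n) ξ).continuous.tendsto ψ).comp hφ
  have h2 : Tendsto (fun i => f.fourierCoord m (c i) ξ δ) l (𝓝 (f.fourierCoord m d ξ δ)) :=
    tendsto_finsetSum _ fun p _ => (hc p.1).mul_const _
  refine tendsto_nhds_unique h1 (h2.congr' ?_)
  filter_upwards [h] with i hi
  exact (hasFourier_iff_coord.1 hi ξ δ).symm

/-- The Fourier coefficients are read off from the value at the vacuum vector. -/
theorem tendsto_coeff {ι : Type*} {l : Filter ι}
    {φ : ι → Fock n →L[ℂ] Fock n} {c : ι → NCSeries n ℂ} {ψ : Fock n →L[ℂ] Fock n}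
    (h : ∀ᶠ i in l, f.HasFourier m (φ i) (c i)) (hφ : Tendsto φ l (𝓝 ψ)) (α : Word n) :
    Tendsto (fun i => (c i).coeff α) l (𝓝 ((√(f.weight m α) : ℂ) * ψ (basisVec 1) α)) := by
  have h1 := ((lp.evalCLM ℂ (fun _ : Word n => ℂ) 2 α ∘L
    ContinuousLinearMap.apply ℂ (Fock n) (basisVec 1)).continuous.tendsto ψ).comp hφ
  refine (h1.const_mul (√(f.weight m α) : ℂ)).congr' ?_
  filter_upwards [h] with i hi
  have h2 := hasFourier_iff_coord.1 hi (basisVec 1) α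
  rw [fourierCoord_vacuum] at h2
  change (√(f.weight m α) : ℂ) * φ i (basisVec 1) α = _
  have hb : (√(f.weight m α) : ℂ) ≠ 0 :=
    Complex.ofReal_ne_zero.2 (Real.sqrt_pos.2 (f.weight_pos m α)).ne'
  rw [h2, Real.sqrt_div zero_le_one, Real.sqrt_one, Complex.ofReal_div, Complex.ofReal_one]
  field_simp

theorem isClosed_hardyOperators : IsClosed (f.hardyOperators m : Set (Fock n →L[ℂ] Fock n)) := by
  refine isClosed_of_closure_subset fun ψ hψ => ?_
  obtain ⟨φ, hφ, hlim⟩ := mem_closure_iff_seq_limit.1 hψ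
  choose c hc using hφ
  exact ⟨⟨fun α => (√(f.weight m α) : ℂ) * ψ (basisVec 1) α⟩, hasFourier_of_tendsto
    (Eventually.of_forall hc) hlim (tendsto_coeff (Eventually.of_forall hc) hlim)⟩

/-! ### Homogeneous parts and dilations of multipliers -/

theorem exists_diagonal (w : Word n → ℝ) (hw : ∀ α, |w α| ≤ 1) :
    ∃ D : Fock n →L[ℂ] Fock n, ∀ ξ δ, D ξ δ = (w δ : ℂ) * ξ δ := by
  obtain ⟨D, hD⟩ := exists_weightedShift id Function.injective_id w 1 hw
  exact ⟨D, fun ξ δ => apply_of_diagonal (d := fun α => (w α : ℂ)) hD ξ δ⟩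

/-- The homogeneous parts of a multiplier are bounded by the norm of the multiplier: the part of
degree `k` is a sum of corners of `φ` with mutually orthogonal domains and ranges. -/
theorem norm_homog_le {φ : Fock n →L[ℂ] Fock n} {c : NCSeries n ℂ} (h : f.HasFourier m φ c)
    (k : ℕ) : ‖c.homog (f.W m) k‖ ≤ ‖φ‖ := by
  choose Q hQ using fun d : ℕ => exists_diagonal (n := n)
    (fun α => if α.length = d then 1 else 0) (fun α => by split_ifs <;> simp)
  have hQ' : ∀ d ξ δ, Q d ξ δ = if FreeMonoid.length δ = d then ξ δ else 0 := fun d ξ δ => by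
    rw [hQ]
    split_ifs <;> simp
  have hQsum : ∀ ξ : Fock n, ∑' d, ‖Q d ξ‖ₑ ^ 2 = ‖ξ‖ₑ ^ 2 := fun ξ => by
    simp only [enorm_sq_eq_tsum]
    rw [ENNReal.tsum_comm]
    refine tsum_congr fun δ => ?_
    rw [tsum_eq_single δ.length fun d hd => by rw [hQ', if_neg hd.symm]; simp, hQ', if_pos rfl]
  -- The part of degree `k` maps vectors of degree `d` to vectors of degree `d + k`.
  have hco : ∀ (ξ : Fock n) (δ : Word n),
      ‖c.homog (f.W m) k ξ δ‖ₑ ^ 2 ≤ ∑' d, ‖φ (Q d ξ) δ‖ₑ ^ 2 := fun ξ δ => by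
    rw [hasFourier_iff_coord.1 (hasFourier_homog c k)]
    by_cases hk : k ≤ δ.length
    · refine le_trans (le_of_eq ?_) (ENNReal.le_tsum (δ.length - k))
      rw [hasFourier_iff_coord.1 h]
      congr 2
      refine Finset.sum_congr rfl fun p hp => ?_
      have hlen := congrArg FreeMonoid.length (Finset.HasMulAntidiagonal.mem_mulAntidiagonal.1 hp)
      rw [FreeMonoid.length_mul] at hlen
      rw [hQ', NCSeries.homogPart]
      simp only
      by_cases hp1 : p.1.length = k
      · rw [if_pos hp1, if_pos (by omega)]
      · rw [if_neg hp1, if_neg (by omega)]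
        simp
    · rw [fourierCoord, Finset.sum_eq_zero fun p hp => ?_]
      · simp
      · have hlen := length_fst_le hp
        rw [NCSeries.homogPart]
        simp only
        rw [if_neg (by omega), zero_mul]
  have hle : ∀ ξ, ‖c.homog (f.W m) k ξ‖ₑ ≤ ‖φ‖ₑ * ‖ξ‖ₑ := fun ξ => by
    refine (ENNReal.pow_le_pow_left_iff two_ne_zero).1 ?_
    calc ‖c.homog (f.W m) k ξ‖ₑ ^ 2 ≤ ∑' δ, ∑' d, ‖φ (Q d ξ) δ‖ₑ ^ 2 := by
          rw [enorm_sq_eq_tsum]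
          exact ENNReal.tsum_le_tsum (hco ξ)
      _ = ∑' d, ‖φ (Q d ξ)‖ₑ ^ 2 := by
          rw [ENNReal.tsum_comm]
          simp only [enorm_sq_eq_tsum]
      _ ≤ ∑' d, ‖φ‖ₑ ^ 2 * ‖Q d ξ‖ₑ ^ 2 := by
          refine ENNReal.tsum_le_tsum fun d => ?_
          rw [← mul_pow]
          exact pow_le_pow_left' (ContinuousLinearMap.le_opENorm _ _) 2
      _ = (‖φ‖ₑ * ‖ξ‖ₑ) ^ 2 := by rw [ENNReal.tsum_mul_left, hQsum, mul_pow]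
  exact enorm_le_iff_norm_le.1 (ContinuousLinearMap.opENorm_le_bound _ hle)

theorem eventually_mem_Ico : ∀ᶠ r in 𝓝[<] (1 : ℝ), 0 ≤ r ∧ r < 1 :=
  (eventually_nhdsWithin_of_eventually_nhds (eventually_ge_nhds zero_lt_one)).and
    self_mem_nhdsWithin

/-- The diagonal contractions `e_α ↦ r^{|α|} e_α` converge strongly to the identity as `r → 1`. -/
theorem exists_dilation : ∃ D : ℝ → Fock n →L[ℂ] Fock n,
    (∀ r, 0 ≤ r → r < 1 → ∀ ξ δ, D r ξ δ = (r : ℂ) ^ FreeMonoid.length δ * ξ δ) ∧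
      ∀ ξ, Tendsto (fun r => D r ξ) (𝓝[<] 1) (𝓝 ξ) := by
  have hex : ∀ r : ℝ, ∃ D : Fock n →L[ℂ] Fock n, 0 ≤ r → r < 1 →
      ∀ ξ δ, D ξ δ = (r : ℂ) ^ FreeMonoid.length δ * ξ δ := fun r => by
    by_cases hr : 0 ≤ r ∧ r < 1
    · obtain ⟨D, hD⟩ := exists_diagonal (n := n) (fun α => r ^ α.length) fun α => by
        rw [abs_of_nonneg (_root_.pow_nonneg hr.1 _)]
        exact pow_le_one₀ hr.1 hr.2.le
      exact ⟨D, fun _ _ ξ δ => by rw [hD]; push_cast; rfl⟩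
    · exact ⟨0, fun h0 h1 => absurd ⟨h0, h1⟩ hr⟩
  choose D hD using hex
  refine ⟨D, hD, fun ξ => ?_⟩
  rw [tendsto_iff_norm_sub_tendsto_zero]
  have hsq : ∀ η : Fock n, ‖η‖ ^ 2 = ∑' δ, ‖η δ‖ ^ 2 := fun η => by
    have h := lp.hasSum_norm (p := 2) (by norm_num) η
    simp only [ENNReal.toReal_ofNat, Real.rpow_ofNat] at h
    exact h.tsum_eq.symm
  have hsum : Summable fun δ => ‖ξ δ‖ ^ 2 := by
    have h := lp.hasSum_norm (p := 2) (by norm_num) ξ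
    simp only [ENNReal.toReal_ofNat, Real.rpow_ofNat] at h
    exact h.summable
  have hlim : Tendsto (fun r => ‖D r ξ - ξ‖ ^ 2) (𝓝[<] 1) (𝓝 0) := by
    simp only [hsq]
    have h0 : ∑' _ : Word n, (0 : ℝ) = 0 := tsum_zero
    rw [← h0]
    refine tendsto_tsum_of_dominated_convergence hsum (fun δ => ?_) ?_
    · have h1 : Tendsto (fun r : ℝ => ‖(r : ℂ) ^ FreeMonoid.length δ * ξ δ - ξ δ‖ ^ 2) (𝓝 1)
          (𝓝 0) := by
        have hc : Continuous fun r : ℝ => ‖(r : ℂ) ^ FreeMonoid.length δ * ξ δ - ξ δ‖ ^ 2 := by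
          fun_prop
        simpa using hc.tendsto 1
      refine (h1.mono_left nhdsWithin_le_nhds).congr' ?_
      filter_upwards [eventually_mem_Ico] with r hr
      rw [lp.coeFn_sub, Pi.sub_apply, hD r hr.1 hr.2]
    · filter_upwards [eventually_mem_Ico] with r hr δ
      rw [lp.coeFn_sub, Pi.sub_apply, hD r hr.1 hr.2]
      have h1 : (r : ℂ) ^ FreeMonoid.length δ * ξ δ - ξ δ =
          ((r ^ FreeMonoid.length δ - 1 : ℝ) : ℂ) * ξ δ := by
        push_cast
        ring
      rw [h1, norm_mul, Complex.norm_real, mul_pow, Real.norm_of_nonneg (by positivity)]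
      refine mul_le_of_le_one_left (sq_nonneg _) ?_
      have h2 := pow_le_one₀ (n := FreeMonoid.length δ) hr.1 hr.2.le
      have h3 := _root_.pow_nonneg hr.1 (FreeMonoid.length δ)
      rw [Real.norm_eq_abs, sq_abs]
      nlinarith
  have h4 := hlim.sqrt
  simpa only [Real.sqrt_sq (norm_nonneg _), Real.sqrt_zero] using h4

/-- If the dilations `φ_r = ∑ r^{|α|} c_α W_α` of a multiplier are uniformly bounded, they converge
to it strongly: with the diagonal contractions `D_r` one has `φ_r D_r = D_r φ`. -/
theorem tendsto_of_hasFourier_dilate {φ : Fock n →L[ℂ] Fock n} {c : NCSeries n ℂ}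
    (hφ : f.HasFourier m φ c) {T : ℝ → Fock n →L[ℂ] Fock n}
    (hT : ∀ r, 0 ≤ r → r < 1 → f.HasFourier m (T r) (c.dilate r)) {C : ℝ}
    (hC : ∀ r, 0 ≤ r → r < 1 → ‖T r‖ ≤ C) (ξ : Fock n) :
    Tendsto (fun r => T r ξ) (𝓝[<] 1) (𝓝 (φ ξ)) := by
  obtain ⟨D, hD, hlim⟩ := exists_dilation (n := n)
  have hcomm : ∀ r, 0 ≤ r → r < 1 → T r (D r ξ) = D r (φ ξ) := fun r h0 h1 => by
    ext δ
    rw [hD r h0 h1, hasFourier_iff_coord.1 (hT r h0 h1), hasFourier_iff_coord.1 hφ, fourierCoord,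
      fourierCoord, Finset.mul_sum]
    refine Finset.sum_congr rfl fun p hp => ?_
    rw [hD r h0 h1, ← Finset.HasMulAntidiagonal.mem_mulAntidiagonal.1 hp, FreeMonoid.length_mul,
      pow_add, NCSeries.dilate]
    ring
  have h1 : Tendsto (fun r => T r (ξ - D r ξ)) (𝓝[<] 1) (𝓝 0) := by
    have h2 : Tendsto (fun r => C * ‖ξ - D r ξ‖) (𝓝[<] 1) (𝓝 0) := by
      have h3 := ((tendsto_const_nhds (x := ξ)).sub (hlim ξ)).norm.const_mul C
      simpa using h3
    refine squeeze_zero_norm' ?_ h2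
    filter_upwards [eventually_mem_Ico] with r hr
    exact (T r).le_of_opNorm_le (hC r hr.1 hr.2) _
  have h2 := h1.add (hlim (φ ξ))
  rw [zero_add] at h2
  refine h2.congr' ?_
  filter_upwards [eventually_mem_Ico] with r hr
  rw [← hcomm r hr.1 hr.2, ← map_add, sub_add_cancel]

/-- A series whose dilations are uniformly bounded multipliers is the Fourier series of a
multiplier: the coordinates of the candidate are limits of those of the dilations, so the uniform
bound carries over to finite sums of their squares. -/
theorem exists_hasFourier_of_bounded {c : NCSeries n ℂ} {T : ℝ → Fock n →L[ℂ] Fock n}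
    (hT : ∀ r, 0 ≤ r → r < 1 → f.HasFourier m (T r) (c.dilate r)) {C : ℝ}
    (hC : ∀ r, 0 ≤ r → r < 1 → ‖T r‖ ≤ C) : ∃ φ, f.HasFourier m φ c := by
  have hC0 : 0 ≤ C := (norm_nonneg _).trans (hC 0 le_rfl zero_lt_one)
  have hlim : ∀ ξ δ, Tendsto (fun r => T r ξ δ) (𝓝[<] 1) (𝓝 (f.fourierCoord m c ξ δ)) := by
    intro ξ δ
    have h1 : Tendsto (fun r : ℝ => f.fourierCoord m (c.dilate r) ξ δ) (𝓝 1)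
        (𝓝 (f.fourierCoord m c ξ δ)) := by
      have hc : Continuous fun r : ℝ => f.fourierCoord m (c.dilate r) ξ δ := by
        simp only [fourierCoord, NCSeries.dilate]
        fun_prop
      have h2 := hc.tendsto 1
      have h3 : c.dilate ((1 : ℝ) : ℂ) = c := by
        ext α
        simp [NCSeries.dilate]
      rwa [h3] at h2
    refine (h1.mono_left nhdsWithin_le_nhds).congr' ?_
    filter_upwards [eventually_mem_Ico] with r hr
    rw [hasFourier_iff_coord.1 (hT r hr.1 hr.2)]
  have hbd : ∀ (ξ : Fock n) (s : Finset (Word n)),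
      ∑ δ ∈ s, ‖f.fourierCoord m c ξ δ‖ ^ (2 : ℝ≥0∞).toReal ≤ (C * ‖ξ‖) ^ (2 : ℝ≥0∞).toReal := by
    intro ξ s
    simp only [ENNReal.toReal_ofNat, Real.rpow_ofNat]
    refine le_of_tendsto (tendsto_finsetSum s fun δ _ => ((hlim ξ δ).norm.pow 2)) ?_
    filter_upwards [eventually_mem_Ico] with r hr
    have h1 := lp.sum_rpow_le_norm_rpow (p := 2) (by norm_num) (T r ξ) s
    simp only [ENNReal.toReal_ofNat, Real.rpow_ofNat] at h1
    exact h1.trans (pow_le_pow_left₀ (norm_nonneg _)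
      ((T r).le_of_opNorm_le (hC r hr.1 hr.2) ξ) 2)
  let L : Fock n →ₗ[ℂ] Fock n :=
    { toFun := fun ξ => ⟨f.fourierCoord m c ξ, memℓp_gen' (hbd ξ)⟩
      map_add' := fun ξ η => by
        ext δ
        change f.fourierCoord m c (ξ + η) δ = f.fourierCoord m c ξ δ + f.fourierCoord m c η δ
        simp only [fourierCoord, ← Finset.sum_add_distrib, lp.coeFn_add, Pi.add_apply, mul_add]
      map_smul' := fun z ξ => by
        ext δ
        change f.fourierCoord m c (z • ξ) δ = z * f.fourierCoord m c ξ δ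
        simp only [fourierCoord, Finset.mul_sum, lp.coeFn_smul, Pi.smul_apply, smul_eq_mul]
        exact Finset.sum_congr rfl fun p _ => by ring }
  refine ⟨L.mkContinuous C fun ξ => ?_, hasFourier_iff_coord.2 fun ξ δ => rfl⟩
  exact lp.norm_le_of_forall_sum_le (by norm_num) (mul_nonneg hC0 (norm_nonneg _)) (hbd ξ)

end RegularFunction

/-! ### Evaluating multipliers on the radial domain -/

namespace NCSeries

variable {n : ℕ} {A : Type*} [Ring A] [Algebra ℂ A]

theorem homog_sub (F G : NCSeries n ℂ) (X : Fin n → A) (k : ℕ) :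
    (F - G).homog X k = F.homog X k - G.homog X k := by
  rw [eq_sub_iff_add_eq, ← homog_add, sub_add_cancel]

end NCSeries

namespace RegularFunction

variable {n : ℕ} {f : RegularFunction n} {m : ℕ}

variable (f m) in
/-- The domain `D_f^m` is starlike on every Hilbert space of the given universe. -/
def IsStarlike : Prop :=
  ∀ (K : Type u) [NormedAddCommGroup K] [InnerProductSpace ℂ K] [CompleteSpace K],
    ∀ Y ∈ f.domain m K, ∀ r : ℝ, 0 ≤ r → r < 1 → (r : ℂ) • Y ∈ f.domain m K

section

variable {K : Type u} [NormedAddCommGroup K] [InnerProductSpace ℂ K] [CompleteSpace K]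
  {X Y : Fin n → K →L[ℂ] K} {φ ψ : Fock n →L[ℂ] Fock n} {c d : NCSeries n ℂ}

theorem smul_mem_radDomain (hY : Y ∈ f.domain m K) {r : ℝ} (h0 : 0 ≤ r) (h1 : r < 1) :
    (r : ℂ) • Y ∈ f.radDomain m K :=
  ⟨r, h0, h1, Y, hY, rfl⟩

theorem IsStarlike.mem_domain (hs : IsStarlike.{u} f m) (hX : X ∈ f.radDomain m K) :
    X ∈ f.domain m K := by
  obtain ⟨r, h0, h1, Y, hY, rfl⟩ := hX
  exact hs K Y hY r h0 h1

theorem IsStarlike.defect_isPositive (hs : IsStarlike.{u} f m) (hm : 1 ≤ m)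
    (hX : X ∈ f.radDomain m K) : (f.defect X m).IsPositive :=
  (hs.mem_domain hX).2 m hm le_rfl

/-- The von Neumann inequality applied to each homogeneous part bounds the parts uniformly on the
radial domain, so the series converges geometrically. -/
theorem HasFourier.summable_homog (hs : IsStarlike.{u} f m) (hm : 1 ≤ m)
    (h : f.HasFourier m φ c) (hX : X ∈ f.radDomain m K) : Summable (c.homog X) := by
  obtain ⟨r, h0, h1, Y, hY, rfl⟩ := hX
  obtain ⟨s, hrs, hs1⟩ := exists_between h1
  have hs0 : 0 < s := h0.trans_lt hrs
  have hsY := smul_mem_radDomain hY hs0.le hs1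
  refine Summable.of_norm_bounded ((summable_geometric_of_lt_one (div_nonneg h0 hs0.le)
    ((div_lt_one hs0).2 hrs)).mul_right ‖φ‖) fun k => ?_
  have hk : c.homog ((r : ℂ) • Y) k = ((r / s : ℝ) : ℂ) ^ k • c.homog ((s : ℂ) • Y) k := by
    rw [← NCSeries.homog_smul, smul_smul, ← Complex.ofReal_mul, div_mul_cancel₀ _ hs0.ne']
  rw [hk, norm_smul, norm_pow, Complex.norm_real, Real.norm_of_nonneg (div_nonneg h0 hs0.le)]
  refine mul_le_mul_of_nonneg_left ?_ (by positivity)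
  exact (norm_le_of_hasFourier hm hsY (hs.defect_isPositive hm hsY) (hasFourier_homog c k)
    (NCSeries.hasSum_homogPart c _ k)).trans (norm_homog_le h k)

theorem HasFourier.isFreeHol (hs : IsStarlike.{u} f m) (hm : 1 ≤ m)
    (h : f.HasFourier m φ c) : IsFreeHol.{u} f m c := fun _ _ _ _ _ hX =>
  ⟨_, (h.summable_homog hs hm hX).hasSum.tendsto_sum_nat⟩

theorem HasFourier.norm_eval_le (hs : IsStarlike.{u} f m) (hm : 1 ≤ m)
    (h : f.HasFourier m φ c) (hX : X ∈ f.radDomain m K) : ‖c.eval X‖ ≤ ‖φ‖ :=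
  norm_le_of_hasFourier hm hX (hs.defect_isPositive hm hX) h ((h.isFreeHol hs hm).hasSum hX)

theorem HasFourier.norm_eval_sub_le (hs : IsStarlike.{u} f m) (hm : 1 ≤ m)
    (h : f.HasFourier m φ c) (h' : f.HasFourier m ψ d) (hX : X ∈ f.radDomain m K) :
    ‖c.eval X - d.eval X‖ ≤ ‖φ - ψ‖ := by
  refine norm_le_of_hasFourier hm hX (hs.defect_isPositive hm hX) (h.sub h') ?_
  exact (((h.isFreeHol hs hm).hasSum hX).sub ((h'.isFreeHol hs hm).hasSum hX)).congr_fun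
    fun k => NCSeries.homog_sub c d X k

theorem HasFourier.eval_eq_berezin (hs : IsStarlike.{u} f m) (hm : 1 ≤ m)
    (h : f.HasFourier m φ c) (hX : X ∈ f.radDomain m K) : c.eval X = f.berezin m X φ :=
  (berezin_eq hm hX h ((h.isFreeHol hs hm).hasSum hX)).symm

end

theorem HasFourier.mem_hardyAlgebra (hs : IsStarlike.{u} f m) (hm : 1 ≤ m)
    {φ : Fock n →L[ℂ] Fock n} {c : NCSeries n ℂ} (h : f.HasFourier m φ c) :
    c ∈ hardyAlgebra.{u} f m := by
  refine ⟨h.isFreeHol hs hm, lt_of_le_of_lt ?_ (enorm_lt_top (x := φ))⟩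
  refine iSup_le fun K => iSup_le fun _ => iSup_le fun _ => iSup_le fun _ => iSup_le fun X =>
    iSup_le fun hX => ?_
  exact enorm_le_iff_norm_le.2 (h.norm_eval_le hs hm hX)

theorem supMatrixNorm_le (hs : IsStarlike.{u} f m) (hm : 1 ≤ m) {p : ℕ}
    {φ : Matrix (Fin p) (Fin p) (Fock n →L[ℂ] Fock n)} {c : Matrix (Fin p) (Fin p) (NCSeries n ℂ)}
    (h : ∀ i j, f.HasFourier m (φ i j) (c i j)) : supMatrixNorm.{u} f m c ≤ ‖matrixOp φ‖ₑ := by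
  refine iSup_le fun K => iSup_le fun _ => iSup_le fun _ => iSup_le fun _ => iSup_le fun X =>
    iSup_le fun hX => ?_
  exact norm_matrixOp_le hm hX (hs.defect_isPositive hm hX) h
    fun i j => ((h i j).isFreeHol hs hm).hasSum hX

end RegularFunction

/-! ### Copies of the universal model -/

section Compression

open ContinuousLinearMap (adjoint)

variable {K : Type v} [NormedAddCommGroup K] [InnerProductSpace ℂ K] [CompleteSpace K]
  {H : Type w} [NormedAddCommGroup H] [InnerProductSpace ℂ H] [CompleteSpace H]

/-- The map `A ↦ T^* A T`. -/
def compression (T : K →L[ℂ] H) : (H →L[ℂ] H) →L[ℂ] (K →L[ℂ] K) :=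
  ContinuousLinearMap.compL ℂ K H K (adjoint T) ∘L (ContinuousLinearMap.compL ℂ K H H).flip T

theorem compression_apply (T : K →L[ℂ] H) (A : H →L[ℂ] H) (x : K) :
    compression T A x = adjoint T (A (T x)) := rfl

variable {T : K →L[ℂ] H}

theorem norm_apply_of_adjoint_apply (hT : ∀ x, adjoint T (T x) = x) (x : K) : ‖T x‖ = ‖x‖ := by
  rw [← sq_eq_sq₀ (norm_nonneg _) (norm_nonneg _), ← @inner_self_eq_norm_sq ℂ,
    ← @inner_self_eq_norm_sq ℂ, ← ContinuousLinearMap.adjoint_inner_left, hT]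

theorem norm_adjoint_apply_le (hT : ∀ x, adjoint T (T x) = x) (y : H) : ‖adjoint T y‖ ≤ ‖y‖ := by
  have h1 : ‖adjoint T‖ ≤ 1 := by
    rw [LinearIsometryEquiv.norm_map]
    exact ContinuousLinearMap.opNorm_le_bound _ zero_le_one fun x => by
      rw [norm_apply_of_adjoint_apply hT, one_mul]
  simpa using (adjoint T).le_of_opNorm_le h1 y

theorem norm_compression_le (hT : ∀ x, adjoint T (T x) = x) (A : H →L[ℂ] H) :
    ‖compression T A‖ ≤ ‖A‖ :=
  ContinuousLinearMap.opNorm_le_bound _ (norm_nonneg _) fun x => by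
    rw [compression_apply, ← norm_apply_of_adjoint_apply hT x]
    exact (norm_adjoint_apply_le hT _).trans (A.le_opNorm _)

theorem enorm_matrixOp_compression_le (hT : ∀ x, adjoint T (T x) = x) {p : ℕ}
    (A : Matrix (Fin p) (Fin p) (H →L[ℂ] H)) :
    ‖matrixOp (A.map (compression T))‖ₑ ≤ ‖matrixOp A‖ₑ := by
  refine ContinuousLinearMap.opENorm_le_bound _ fun x => ?_
  let y : PiLp 2 (fun _ : Fin p => H) := WithLp.toLp 2 fun j => T (x j)
  have hy : ‖y‖ₑ = ‖x‖ₑ := by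
    refine (ENNReal.pow_right_strictMono two_ne_zero).injective ?_
    simp only [enorm_sq_piLp]
    refine Finset.sum_congr rfl fun j _ => ?_
    rw [enorm_eq_iff_norm_eq.2 (norm_apply_of_adjoint_apply hT (x j))]
  have hle : ‖matrixOp (A.map (compression T)) x‖ₑ ≤ ‖matrixOp A y‖ₑ := by
    refine (ENNReal.pow_le_pow_left_iff two_ne_zero).1 ?_
    simp only [enorm_sq_piLp, matrixOp_apply, Matrix.map_apply, compression_apply, ← map_sum]
    exact Finset.sum_le_sum fun i _ =>
      pow_le_pow_left' (enorm_le_iff_norm_le.2 (norm_adjoint_apply_le hT _)) 2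
  rw [← hy]
  exact hle.trans (ContinuousLinearMap.le_opENorm _ _)

variable {n : ℕ} {Y : Fin n → K →L[ℂ] K}

theorem isReducing_of_adjoint_apply (hT : ∀ x, adjoint T (T x) = x) : IsReducing T Y where
  apply_apply x := by rw [hT]
  comm i x := by rw [hT, hT]

theorem homog_eq_compression (hT : ∀ x, adjoint T (T x) = x) (c : NCSeries n ℂ) (k : ℕ) :
    c.homog Y k = compression T (c.homog (transport T Y) k) := by
  rw [NCSeries.homog, NCSeries.homog, map_sum]
  refine Finset.sum_congr rfl fun α _ => ?_
  rw [map_smul]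
  congr 1
  ext x
  rw [compression_apply]
  by_cases hα : α = 1
  · subst hα
    simp [hT]
  · rw [(isReducing_of_adjoint_apply hT).lift_transport hα, hT, hT]

/-- The universal model is unitarily equivalent to the restriction, to a reducing subspace, of a
point of `D_f^m(H)`. -/
theorem exists_transport_W_mem_domain (f : RegularFunction n) {m : ℕ} (hm : 1 ≤ m)
    (hH : ¬ FiniteDimensional ℂ H) :
    ∃ T : Fock n →L[ℂ] H, (∀ ξ, adjoint T (T ξ) = ξ) ∧ transport T (f.W m) ∈ f.domain m H := by
  have : Countable (Word n) := inferInstanceAs (Countable (List (Fin n)))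
  obtain ⟨J⟩ := exists_linearIsometry_of_countable (ι := Word n) hH
  have hT : ∀ ξ, adjoint J.toContinuousLinearMap (J.toContinuousLinearMap ξ) = ξ := fun ξ => by
    refine ext_inner_right ℂ fun η => ?_
    rw [ContinuousLinearMap.adjoint_inner_left]
    exact J.inner_map_map ξ η
  exact ⟨J.toContinuousLinearMap, hT,
    (isReducing_of_adjoint_apply hT).transport_mem_domain (f.W_mem_domain hm)⟩

end Compression

section Model

open ContinuousLinearMap (adjoint)

variable {n : ℕ} {f : RegularFunction n} {m : ℕ}
  {H : Type u} [NormedAddCommGroup H] [InnerProductSpace ℂ H] [CompleteSpace H]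

variable {T : Fock n →L[ℂ] H} {c : NCSeries n ℂ} {r : ℝ}

/-- The value at `r W` of a free holomorphic function is the compression of its value at the copy
`r T W T^*` of `r W`, a point of the radial domain. -/
theorem IsFreeHol.hasSum_model (hc : IsFreeHol.{u} f m c)
    (hT : ∀ ξ, adjoint T (T ξ) = ξ) (hZ : transport T (f.W m) ∈ f.domain m H)
    (h0 : 0 ≤ r) (h1 : r < 1) : HasSum (c.homog ((r : ℂ) • f.W m))
      (compression T (c.eval ((r : ℂ) • transport T (f.W m)))) := by
  have h := (compression T).hasSum (hc.hasSum (RegularFunction.smul_mem_radDomain hZ h0 h1))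
  refine h.congr_fun fun k => ?_
  rw [homog_eq_compression hT, transport_smul]

theorem IsFreeHol.eval_model (hc : IsFreeHol.{u} f m c)
    (hT : ∀ ξ, adjoint T (T ξ) = ξ) (hZ : transport T (f.W m) ∈ f.domain m H)
    (h0 : 0 ≤ r) (h1 : r < 1) : c.eval ((r : ℂ) • f.W m) =
      compression T (c.eval ((r : ℂ) • transport T (f.W m))) :=
  NCSeries.eval_eq (hc.hasSum_model hT hZ h0 h1)

theorem IsFreeHol.hasFourier_eval (hc : IsFreeHol.{u} f m c)
    (hT : ∀ ξ, adjoint T (T ξ) = ξ) (hZ : transport T (f.W m) ∈ f.domain m H)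
    (h0 : 0 ≤ r) (h1 : r < 1) : f.HasFourier m (c.eval ((r : ℂ) • f.W m)) (c.dilate r) := by
  refine RegularFunction.hasFourier_of_hasSum ?_
  rw [hc.eval_model hT hZ h0 h1]
  exact (hc.hasSum_model hT hZ h0 h1).congr_fun fun k => NCSeries.homog_dilate c r _ k

end Model

namespace RegularFunction

open ContinuousLinearMap (adjoint)

variable {n : ℕ} {f : RegularFunction n} {m : ℕ}
  {H : Type u} [NormedAddCommGroup H] [InnerProductSpace ℂ H] [CompleteSpace H]

section Model

variable {T : Fock n →L[ℂ] H} {c : NCSeries n ℂ} {r : ℝ}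

/-- A bounded free holomorphic function is bounded on the dilations `r W` of the model. -/
theorem bddAbove_of_mem_hardyAlgebra (hc : c ∈ hardyAlgebra.{u} f m)
    (hT : ∀ ξ, adjoint T (T ξ) = ξ) (hZ : transport T (f.W m) ∈ f.domain m H) :
    BddAbove ((fun r : ℝ => ‖c.eval ((r : ℂ) • f.W m)‖) '' Set.Ico 0 1) := by
  refine ⟨(supNorm.{u} f m c).toReal, ?_⟩
  rintro _ ⟨r, ⟨h0, h1⟩, rfl⟩
  simp only
  rw [hc.1.eval_model hT hZ h0 h1]
  refine (norm_compression_le hT _).trans ?_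
  rw [← toReal_enorm]
  exact ENNReal.toReal_mono hc.2.ne (enorm_eval_le_supNorm c (smul_mem_radDomain hZ h0 h1))

theorem exists_hasFourier_of_bddAbove (hc : IsFreeHol.{u} f m c)
    (hT : ∀ ξ, adjoint T (T ξ) = ξ) (hZ : transport T (f.W m) ∈ f.domain m H)
    (hb : BddAbove ((fun r : ℝ => ‖c.eval ((r : ℂ) • f.W m)‖) '' Set.Ico 0 1)) :
    ∃ φ, f.HasFourier m φ c := by
  obtain ⟨C, hC⟩ := hb
  exact exists_hasFourier_of_bounded (fun r h0 h1 => hc.hasFourier_eval hT hZ h0 h1)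
    fun r h0 h1 => hC ⟨r, ⟨h0, h1⟩, rfl⟩

theorem HasFourier.tendsto_eval {φ : Fock n →L[ℂ] Fock n} (h : f.HasFourier m φ c)
    (hs : IsStarlike.{u} f m) (hm : 1 ≤ m)
    (hT : ∀ ξ, adjoint T (T ξ) = ξ) (hZ : transport T (f.W m) ∈ f.domain m H) (ξ : Fock n) :
    Tendsto (fun r : ℝ => c.eval ((r : ℂ) • f.W m) ξ) (𝓝[<] 1) (𝓝 (φ ξ)) := by
  have hc := h.isFreeHol hs hm
  refine tendsto_of_hasFourier_dilate h (fun r h0 h1 => hc.hasFourier_eval hT hZ h0 h1)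
    (C := ‖φ‖) (fun r h0 h1 => ?_) ξ
  rw [hc.eval_model hT hZ h0 h1]
  exact (norm_compression_le hT _).trans (h.norm_eval_le hs hm (smul_mem_radDomain hZ h0 h1))

/-- The supremum over the radial domain is at least the norm of the matrix of multipliers, because the
latter is the strong limit of the values at the dilations `r W`. -/
theorem le_supMatrixNorm (hs : IsStarlike.{u} f m) (hm : 1 ≤ m)
    (hT : ∀ ξ, adjoint T (T ξ) = ξ) (hZ : transport T (f.W m) ∈ f.domain m H) {p : ℕ}
    {φ : Matrix (Fin p) (Fin p) (Fock n →L[ℂ] Fock n)} {c : Matrix (Fin p) (Fin p) (NCSeries n ℂ)}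
    (h : ∀ i j, f.HasFourier m (φ i j) (c i j)) : ‖matrixOp φ‖ₑ ≤ supMatrixNorm.{u} f m c := by
  refine ContinuousLinearMap.opENorm_le_bound _ fun x => ?_
  have hlim : Tendsto (fun r : ℝ => matrixOp (c.map fun G => G.eval ((r : ℂ) • f.W m)) x)
      (𝓝[<] 1) (𝓝 (matrixOp φ x)) := by
    have h1 : Tendsto (fun (r : ℝ) i => matrixOp (c.map fun G => G.eval ((r : ℂ) • f.W m)) x i)
        (𝓝[<] 1) (𝓝 fun i => matrixOp φ x i) := tendsto_pi_nhds.2 fun i => by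
      simp only [matrixOp_apply, Matrix.map_apply]
      exact tendsto_finsetSum _ fun j _ => (h i j).tendsto_eval hs hm hT hZ (x j)
    exact ((PiLp.continuous_toLp 2 (fun _ : Fin p => Fock n)).tendsto _).comp h1
  refine le_of_tendsto hlim.enorm ?_
  filter_upwards [eventually_mem_Ico] with r hr
  refine (ContinuousLinearMap.le_opENorm _ _).trans (mul_le_mul_left ?_ _)
  have h1 : (c.map fun G => G.eval ((r : ℂ) • f.W m)) =
      (c.map fun G => G.eval ((r : ℂ) • transport T (f.W m))).map (compression T) := by
    ext1 i j
    exact ((h i j).isFreeHol hs hm).eval_model hT hZ hr.1 hr.2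
  rw [h1]
  refine (enorm_matrixOp_compression_le hT _).trans ?_
  unfold supMatrixNorm
  exact le_iSup_of_le H (le_iSup_of_le _ (le_iSup_of_le _ (le_iSup_of_le _ (le_iSup_of_le _
    (le_iSup_of_le (smul_mem_radDomain hZ hr.1 hr.2) le_rfl)))))

end Model

end RegularFunction

/-! ### The Hardy algebra and the domain algebra -/

namespace NCSeries

variable {n : ℕ}

/-- The indeterminate `Z_i` as a series. -/
def X (i : Fin n) : NCSeries n ℂ :=
  ⟨fun α => if α = FreeMonoid.of i then 1 else 0⟩

theorem homog_X {A : Type*} [Ring A] [Algebra ℂ A] (i : Fin n)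
    (Y : Fin n → A) (k : ℕ) : (X i).homog Y k = if k = 1 then Y i else 0 := by
  simp only [homog, X, ite_smul, one_smul, zero_smul, Finset.sum_ite_eq',
    mem_words, FreeMonoid.length_of, FreeMonoid.lift_eval_of, @eq_comm _ 1 k]

theorem hasSum_X {A : Type*} [NormedRing A] [NormedAlgebra ℂ A]
    (i : Fin n) (Y : Fin n → A) : HasSum ((X i).homog Y) (Y i) :=
  (hasSum_ite_eq 1 (Y i)).congr_fun fun k => homog_X i Y k

end NCSeries

namespace RegularFunction

open ContinuousLinearMap (adjoint)

variable {n : ℕ} {f : RegularFunction n} {m : ℕ}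

/-- A correspondence `c ↔ ∑ c_β W_β` between an algebra of series and an algebra of multipliers is
an isomorphism of algebras. -/
theorem exists_algEquiv {S : Subalgebra ℂ (NCSeries n ℂ)}
    {A : Subalgebra ℂ (Fock n →L[ℂ] Fock n)} (hS : ∀ c ∈ S, ∃ φ ∈ A, f.HasFourier m φ c)
    (hA : ∀ φ ∈ A, ∃ c ∈ S, f.HasFourier m φ c) :
    ∃ Φ : S ≃ₐ[ℂ] A, ∀ G, f.HasFourier m (Φ G) G := by
  choose F hFA hF using hS
  let Φ : S →ₐ[ℂ] A :=
    { toFun := fun G => ⟨F G G.2, hFA G G.2⟩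
      map_one' := Subtype.ext ((hF _ _).op_unique (by
        simpa using hasFourier_algebraMap (f := f) (m := m) 1))
      map_mul' := fun G G' => Subtype.ext ((hF _ _).op_unique ((hF _ G.2).mul (hF _ G'.2)))
      map_zero' := Subtype.ext ((hF _ _).op_unique (by
        simpa using hasFourier_algebraMap (f := f) (m := m) 0))
      map_add' := fun G G' => Subtype.ext ((hF _ _).op_unique ((hF _ G.2).add (hF _ G'.2)))
      commutes' := fun z => Subtype.ext ((hF _ _).op_unique (hasFourier_algebraMap z)) }
  have hΦ : ∀ G, f.HasFourier m (Φ G) G := fun G => hF G G.2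
  refine ⟨AlgEquiv.ofBijective Φ ⟨fun G G' hG => ?_, fun φ => ?_⟩, hΦ⟩
  · have h := hΦ G
    rw [hG] at h
    exact Subtype.ext (h.series_unique (hΦ G'))
  · obtain ⟨c, hc, h⟩ := hA φ φ.2
    exact ⟨⟨c, hc⟩, Subtype.ext ((hΦ ⟨c, hc⟩).op_unique h)⟩

theorem X_mem_discAlgebra (i : Fin n) : NCSeries.X i ∈ discAlgebra.{u} f m :=
  ⟨fun _ _ _ _ X _ => ⟨_, (NCSeries.hasSum_X i X).tendsto_sum_nat⟩, fun _ _ _ _ =>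
    ⟨fun X => X i, (continuous_apply i).continuousOn,
      fun X _ => (NCSeries.eval_eq (NCSeries.hasSum_X i X)).symm⟩⟩

theorem tendsto_smul_nhdsWithin {A : Type*} [TopologicalSpace A] [AddCommGroup A] [Module ℂ A]
    [ContinuousSMul ℂ A] (Y : A) : Tendsto (fun r : ℝ => (r : ℂ) • Y) (𝓝[<] 1) (𝓝 Y) := by
  have hc : Continuous fun r : ℝ => (r : ℂ) • Y := by fun_prop
  have h := hc.tendsto 1
  rw [Complex.ofReal_one, one_smul] at h
  exact h.mono_left nhdsWithin_le_nhds

/-- A continuous extension to `D_f^m(K)` is the radial limit. -/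
theorem tendsto_eval_of_continuousOn (hs : IsStarlike.{u} f m) {c : NCSeries n ℂ} {K : Type u}
    [NormedAddCommGroup K] [InnerProductSpace ℂ K] [CompleteSpace K]
    {g : (Fin n → K →L[ℂ] K) → K →L[ℂ] K} (hg : ContinuousOn g (f.domain m K))
    (hgc : ∀ X ∈ f.radDomain m K, g X = c.eval X) {Y : Fin n → K →L[ℂ] K}
    (hY : Y ∈ f.domain m K) :
    Tendsto (fun r : ℝ => c.eval ((r : ℂ) • Y)) (𝓝[<] 1) (𝓝 (g Y)) := by
  have h1 : Tendsto (fun r : ℝ => (r : ℂ) • Y) (𝓝[<] 1) (𝓝[f.domain m K] Y) :=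
    tendsto_nhdsWithin_iff.2 ⟨tendsto_smul_nhdsWithin Y, by
      filter_upwards [eventually_mem_Ico] with r hr
      exact hs K Y hY r hr.1 hr.2⟩
  refine ((hg Y hY).tendsto.comp h1).congr' ?_
  filter_upwards [eventually_mem_Ico] with r hr
  exact hgc _ (smul_mem_radDomain hY hr.1 hr.2)

/-- A norm limit of multipliers with Fourier series in the domain algebra of series has its Fourier
series there: by the von Neumann inequality the continuous extensions converge uniformly. -/
theorem mem_discAlgebra_of_tendsto (hs : IsStarlike.{u} f m) (hm : 1 ≤ m)
    {φ : ℕ → Fock n →L[ℂ] Fock n} {c : ℕ → NCSeries n ℂ} {ψ : Fock n →L[ℂ] Fock n}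
    {d : NCSeries n ℂ} (hc : ∀ k, c k ∈ discAlgebra.{u} f m)
    (hφ : ∀ k, f.HasFourier m (φ k) (c k)) (hψ : f.HasFourier m ψ d)
    (hlim : Tendsto φ atTop (𝓝 ψ)) : d ∈ discAlgebra.{u} f m := by
  refine ⟨hψ.isFreeHol hs hm, fun K _ _ _ => ?_⟩
  choose g hg hgc using fun k => (hc k).2 K
  have hle : ∀ k l, ∀ Y ∈ f.domain m K, ‖g k Y - g l Y‖ ≤ ‖φ k - φ l‖ := fun k l Y hY => by
    refine le_of_tendsto ((tendsto_eval_of_continuousOn hs (hg k) (hgc k) hY).sub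
      (tendsto_eval_of_continuousOn hs (hg l) (hgc l) hY)).norm ?_
    filter_upwards [eventually_mem_Ico] with r hr
    exact (hφ k).norm_eval_sub_le hs hm (hφ l) (smul_mem_radDomain hY hr.1 hr.2)
  have hcau : UniformCauchySeqOn g atTop (f.domain m K) := by
    rw [Metric.uniformCauchySeqOn_iff]
    intro ε hε
    obtain ⟨N, hN⟩ := Metric.cauchySeq_iff.1 hlim.cauchySeq ε hε
    refine ⟨N, fun k hk l hl Y hY => ?_⟩
    have h := hN k hk l hl
    rw [dist_eq_norm] at h ⊢
    exact (hle k l Y hY).trans_lt h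
  have hpt : ∀ Y ∈ f.domain m K, ∃ T, Tendsto (fun k => g k Y) atTop (𝓝 T) := fun Y hY =>
    cauchySeq_tendsto_of_complete (hcau.cauchySeq hY)
  choose! G hG using hpt
  refine ⟨G, (hcau.tendstoUniformlyOn_of_tendsto hG).continuousOn
    (Frequently.of_forall hg), fun X hX => ?_⟩
  refine tendsto_nhds_unique (hG X (hs.mem_domain hX)) ?_
  rw [tendsto_iff_norm_sub_tendsto_zero]
  refine squeeze_zero (fun _ => norm_nonneg _) (fun k => ?_)
    (tendsto_iff_norm_sub_tendsto_zero.1 hlim)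
  rw [hgc k X hX]
  exact (hφ k).norm_eval_sub_le hs hm hψ hX

/-- The operators whose Fourier series lie in `discAlgebra` form a norm closed algebra that contains
the `W_i`. -/
theorem exists_hasFourier_of_mem_domainAlgebra (hs : IsStarlike.{u} f m) (hm : 1 ≤ m)
    {φ : Fock n →L[ℂ] Fock n} (hφ : φ ∈ f.domainAlgebra m) :
    ∃ c ∈ discAlgebra.{u} f m, f.HasFourier m φ c := by
  let S : Subalgebra ℂ (Fock n →L[ℂ] Fock n) :=
    { carrier := {φ | ∃ c ∈ discAlgebra.{u} f m, f.HasFourier m φ c}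
      mul_mem' := fun ⟨c, hc, h⟩ ⟨d, hd, h'⟩ => ⟨c * d, mul_mem hc hd, h.mul h'⟩
      add_mem' := fun ⟨c, hc, h⟩ ⟨d, hd, h'⟩ => ⟨c + d, add_mem hc hd, h.add h'⟩
      algebraMap_mem' := fun z => ⟨_, Subalgebra.algebraMap_mem _ z, hasFourier_algebraMap z⟩ }
  have hS : IsClosed (S : Set (Fock n →L[ℂ] Fock n)) := by
    refine isClosed_of_closure_subset fun ψ hψ => ?_
    obtain ⟨φ, hφ, hlim⟩ := mem_closure_iff_seq_limit.1 hψ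
    choose c hc h using hφ
    obtain ⟨d, hd⟩ : ψ ∈ f.hardyOperators m := (isClosed_hardyOperators (f := f)
      (m := m)).mem_of_tendsto hlim (Eventually.of_forall fun k => ⟨c k, h k⟩)
    exact ⟨d, mem_discAlgebra_of_tendsto hs hm hc h hd hlim, hd⟩
  have hle : f.domainAlgebra m ≤ S := Subalgebra.topologicalClosure_minimal
    (Algebra.adjoin_le (by
      rintro _ ⟨i, rfl⟩
      exact ⟨NCSeries.X i, X_mem_discAlgebra i, hasFourier_of_hasSum (NCSeries.hasSum_X i _)⟩)) hS
  exact hle hφ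

theorem lift_W_mem_domainAlgebra (α : Word n) :
    FreeMonoid.lift (f.W m) α ∈ f.domainAlgebra m := by
  induction α using FreeMonoid.inductionOn' with
  | one => rw [map_one]; exact one_mem _
  | of_mul i β ih =>
    rw [map_mul, FreeMonoid.lift_eval_of]
    exact mul_mem (Subalgebra.le_topologicalClosure _ (Algebra.subset_adjoin ⟨i, rfl⟩)) ih

theorem mem_domainAlgebra_of_hasSum {c : NCSeries n ℂ} {S : Fock n →L[ℂ] Fock n}
    (h : HasSum (c.homog (f.W m)) S) : S ∈ f.domainAlgebra m := by
  have hcl : IsClosed (f.domainAlgebra m : Set (Fock n →L[ℂ] Fock n)) :=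
    Subalgebra.isClosed_topologicalClosure _
  refine hcl.mem_of_tendsto h.tendsto_sum_nat (Eventually.of_forall fun N => ?_)
  exact sum_mem fun k _ => sum_mem fun α _ =>
    Subalgebra.smul_mem _ (lift_W_mem_domainAlgebra α) _

section Model

variable {H : Type u} [NormedAddCommGroup H] [InnerProductSpace ℂ H] [CompleteSpace H]
  {T : Fock n →L[ℂ] H} {c : NCSeries n ℂ}

theorem hasFourier_of_tendsto_eval (hc : IsFreeHol.{u} f m c)
    (hT : ∀ ξ, adjoint T (T ξ) = ξ) (hZ : transport T (f.W m) ∈ f.domain m H)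
    {S : Fock n →L[ℂ] Fock n}
    (hlim : Tendsto (fun r : ℝ => c.eval ((r : ℂ) • f.W m)) (𝓝[<] 1) (𝓝 S)) :
    f.HasFourier m S c := by
  refine hasFourier_of_tendsto (c := fun r : ℝ => c.dilate r) ?_ hlim fun α => ?_
  · filter_upwards [eventually_mem_Ico] with r hr
    exact hc.hasFourier_eval hT hZ hr.1 hr.2
  · have hcont : Continuous fun r : ℝ => (c.dilate r).coeff α := by
      simp only [NCSeries.dilate]
      fun_prop
    have h := hcont.tendsto 1
    simp only [NCSeries.dilate, Complex.ofReal_one, one_pow, one_mul] at h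
    exact h.mono_left nhdsWithin_le_nhds

theorem mem_domainAlgebra_of_tendsto_eval (hc : IsFreeHol.{u} f m c)
    (hT : ∀ ξ, adjoint T (T ξ) = ξ) (hZ : transport T (f.W m) ∈ f.domain m H)
    {S : Fock n →L[ℂ] Fock n}
    (hlim : Tendsto (fun r : ℝ => c.eval ((r : ℂ) • f.W m)) (𝓝[<] 1) (𝓝 S)) :
    S ∈ f.domainAlgebra m := by
  have hcl : IsClosed (f.domainAlgebra m : Set (Fock n →L[ℂ] Fock n)) :=
    Subalgebra.isClosed_topologicalClosure _
  refine hcl.mem_of_tendsto hlim ?_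
  filter_upwards [eventually_mem_Ico] with r hr
  rw [hc.eval_model hT hZ hr.1 hr.2]
  exact mem_domainAlgebra_of_hasSum (c := c.dilate r)
    ((hc.hasSum_model hT hZ hr.1 hr.2).congr_fun fun k => NCSeries.homog_dilate c r _ k)

/-- The limit is the compression of the value of the continuous extension at the copy of `W`. -/
theorem exists_tendsto_eval_of_mem_discAlgebra (hs : IsStarlike.{u} f m)
    (hc : c ∈ discAlgebra.{u} f m)
    (hT : ∀ ξ, adjoint T (T ξ) = ξ) (hZ : transport T (f.W m) ∈ f.domain m H) :
    ∃ S : Fock n →L[ℂ] Fock n,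
      Tendsto (fun r : ℝ => c.eval ((r : ℂ) • f.W m)) (𝓝[<] 1) (𝓝 S) := by
  obtain ⟨g, hg, hgc⟩ := hc.2 H
  have h := ((compression T).continuous.tendsto _).comp
    (tendsto_eval_of_continuousOn hs hg hgc hZ)
  refine ⟨_, h.congr' ?_⟩
  filter_upwards [eventually_mem_Ico] with r hr
  exact (hc.1.eval_model hT hZ hr.1 hr.2).symm

end Model

theorem mem_hardyAlgebra_of_eval_eq {c d : NCSeries n ℂ} (hc : c ∈ hardyAlgebra.{u} f m)
    (hd : IsFreeHol.{u} f m d)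
    (h : ∀ (K : Type u) [NormedAddCommGroup K] [InnerProductSpace ℂ K] [CompleteSpace K],
      ∀ X ∈ f.radDomain m K, d.eval X = c.eval X) : d ∈ hardyAlgebra.{u} f m := by
  refine ⟨hd, lt_of_le_of_lt ?_ hc.2⟩
  refine iSup_le fun K => iSup_le fun _ => iSup_le fun _ => iSup_le fun _ => iSup_le fun X =>
    iSup_le fun hX => ?_
  rw [h K X hX]
  exact enorm_eval_le_supNorm c hX

theorem mem_discAlgebra_of_eval_eq {c d : NCSeries n ℂ} (hc : c ∈ discAlgebra.{u} f m)
    (hd : IsFreeHol.{u} f m d)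
    (h : ∀ (K : Type u) [NormedAddCommGroup K] [InnerProductSpace ℂ K] [CompleteSpace K],
      ∀ X ∈ f.radDomain m K, d.eval X = c.eval X) : d ∈ discAlgebra.{u} f m := by
  refine ⟨hd, fun K _ _ _ => ?_⟩
  obtain ⟨g, hg, hgc⟩ := hc.2 K
  exact ⟨g, hg, fun X hX => by rw [hgc X hX, h K X hX]⟩

end RegularFunction

end FreeHol

end

theorem theorem2p1 {n : ℕ} (hn : 1 ≤ n) {m : ℕ} (hm : 1 ≤ m) (f : RegularFunction n)
    (H : Type u) [NormedAddCommGroup H] [InnerProductSpace ℂ H] [CompleteSpace H]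
    [TopologicalSpace.SeparableSpace H] (hH : ¬ FiniteDimensional ℂ H)
    (hclosed : IsClosed (f.domain m H))
    (hstar : ∀ X ∈ f.domain m H, ∀ r : ℝ, 0 ≤ r → r < 1 → (r : ℂ) • X ∈ f.domain m H) :
    -- the Hardy algebra
    (∃ Φ : hardyAlgebra.{u} f m ≃ₐ[ℂ] f.hardyOperators m,
      (∀ G, f.HasFourier m (Φ G) G) ∧
      (∀ (p : ℕ) (F : Matrix (Fin p) (Fin p) (hardyAlgebra.{u} f m)),
        supMatrixNorm.{u} f m (F.map fun G => (G : NCSeries n ℂ)) =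
          ‖matrixOp (F.map fun G => (Φ G : Fock n →L[ℂ] Fock n))‖ₑ) ∧
      (∀ (G : hardyAlgebra.{u} f m) (ξ : Fock n),
        Tendsto (fun r : ℝ => (G : NCSeries n ℂ).eval ((r : ℂ) • f.W m) ξ) (𝓝[<] 1)
          (𝓝 ((Φ G : Fock n →L[ℂ] Fock n) ξ))) ∧
      (∀ (φ : f.hardyOperators m) (K : Type u) [NormedAddCommGroup K] [InnerProductSpace ℂ K]
        [CompleteSpace K], ∀ X ∈ f.radDomain m K,
          (Φ.symm φ : NCSeries n ℂ).eval X = f.berezin m X φ)) ∧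
    (∀ G : NCSeries n ℂ, IsFreeHol.{u} f m G → List.TFAE [
      G ∈ hardyAlgebra.{u} f m,
      BddAbove ((fun r : ℝ => ‖G.eval ((r : ℂ) • f.W m)‖) '' Set.Ico 0 1),
      ∃ φ ∈ f.hardyOperators m, ∀ (K : Type u) [NormedAddCommGroup K] [InnerProductSpace ℂ K]
        [CompleteSpace K], ∀ X ∈ f.radDomain m K, G.eval X = f.berezin m X φ]) ∧
    -- the domain algebra
    (∃ Φ : discAlgebra.{u} f m ≃ₐ[ℂ] f.domainAlgebra m,
      (∀ G, f.HasFourier m (Φ G) G) ∧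
      (∀ (p : ℕ) (F : Matrix (Fin p) (Fin p) (discAlgebra.{u} f m)),
        supMatrixNorm.{u} f m (F.map fun G => (G : NCSeries n ℂ)) =
          ‖matrixOp (F.map fun G => (Φ G : Fock n →L[ℂ] Fock n))‖ₑ) ∧
      (∀ G : discAlgebra.{u} f m,
        Tendsto (fun r : ℝ => (G : NCSeries n ℂ).eval ((r : ℂ) • f.W m)) (𝓝[<] 1)
          (𝓝 (Φ G : Fock n →L[ℂ] Fock n))) ∧
      (∀ (φ : f.domainAlgebra m) (K : Type u) [NormedAddCommGroup K] [InnerProductSpace ℂ K]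
        [CompleteSpace K], ∀ X ∈ f.radDomain m K,
          (Φ.symm φ : NCSeries n ℂ).eval X = f.berezin m X φ)) ∧
    (∀ G : NCSeries n ℂ, IsFreeHol.{u} f m G → List.TFAE [
      G ∈ discAlgebra.{u} f m,
      ∃ T : Fock n →L[ℂ] Fock n,
        Tendsto (fun r : ℝ => G.eval ((r : ℂ) • f.W m)) (𝓝[<] 1) (𝓝 T),
      ∃ φ ∈ f.domainAlgebra m, ∀ (K : Type u) [NormedAddCommGroup K] [InnerProductSpace ℂ K]
        [CompleteSpace K], ∀ X ∈ f.radDomain m K, G.eval X = f.berezin m X φ]) := by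
  have hs : RegularFunction.IsStarlike.{u} f m := fun K _ _ _ Y hY r h0 h1 =>
    smul_mem_domain hm hH hstar hY h0 h1
  -- `T W T^*` is a copy of the model on `H`, in the universe over which the series are evaluated.
  obtain ⟨T, hT, hZ⟩ := exists_transport_W_mem_domain f hm hH
  have hfwd : ∀ c ∈ discAlgebra.{u} f m, ∃ φ ∈ f.domainAlgebra m, f.HasFourier m φ c ∧
      Tendsto (fun r : ℝ => c.eval ((r : ℂ) • f.W m)) (𝓝[<] 1) (𝓝 φ) := fun c hc => by
    obtain ⟨S, hS⟩ := RegularFunction.exists_tendsto_eval_of_mem_discAlgebra hs hc hT hZ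
    exact ⟨S, RegularFunction.mem_domainAlgebra_of_tendsto_eval hc.1 hT hZ hS,
      RegularFunction.hasFourier_of_tendsto_eval hc.1 hT hZ hS, hS⟩
  refine ⟨?_, fun G hG => ?_, ?_, fun G hG => ?_⟩
  · obtain ⟨Φ, hΦ⟩ := RegularFunction.exists_algEquiv (f := f) (m := m)
      (S := hardyAlgebra.{u} f m) (A := f.hardyOperators m)
      (fun c hc => by
        obtain ⟨φ, hφ⟩ := RegularFunction.exists_hasFourier_of_bddAbove hc.1 hT hZ
          (RegularFunction.bddAbove_of_mem_hardyAlgebra hc hT hZ)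
        exact ⟨φ, ⟨c, hφ⟩, hφ⟩)
      (fun φ ⟨c, hφ⟩ => ⟨c, hφ.mem_hardyAlgebra hs hm, hφ⟩)
    refine ⟨Φ, hΦ, fun p F => ?_, fun G ξ => (hΦ G).tendsto_eval hs hm hT hZ ξ,
      fun φ K _ _ _ X hX => ?_⟩
    · exact le_antisymm (RegularFunction.supMatrixNorm_le hs hm fun i j => hΦ (F i j))
        (RegularFunction.le_supMatrixNorm hs hm hT hZ fun i j => hΦ (F i j))
    · have h := hΦ (Φ.symm φ)
      rw [Φ.apply_symm_apply] at h
      exact h.eval_eq_berezin hs hm hX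
  · tfae_have 1 → 2 := fun h => RegularFunction.bddAbove_of_mem_hardyAlgebra h hT hZ
    tfae_have 2 → 3 := fun h => by
      obtain ⟨φ, hφ⟩ := RegularFunction.exists_hasFourier_of_bddAbove hG hT hZ h
      exact ⟨φ, ⟨G, hφ⟩, fun K _ _ _ X hX => hφ.eval_eq_berezin hs hm hX⟩
    -- The Fourier series of `φ` and the given series have the same values on the radial domain.
    tfae_have 3 → 1 := by
      rintro ⟨φ, ⟨c, hφ⟩, h⟩
      exact RegularFunction.mem_hardyAlgebra_of_eval_eq (hφ.mem_hardyAlgebra hs hm) hG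
        fun K _ _ _ X hX => by rw [h K X hX, hφ.eval_eq_berezin hs hm hX]
    tfae_finish
  · obtain ⟨Φ, hΦ⟩ := RegularFunction.exists_algEquiv (f := f) (m := m)
      (S := discAlgebra.{u} f m) (A := f.domainAlgebra m)
      (fun c hc => by
        obtain ⟨φ, hφ, h, -⟩ := hfwd c hc
        exact ⟨φ, hφ, h⟩)
      (fun φ hφ => RegularFunction.exists_hasFourier_of_mem_domainAlgebra hs hm hφ)
    refine ⟨Φ, hΦ, fun p F => ?_, fun G => ?_, fun φ K _ _ _ X hX => ?_⟩
    · exact le_antisymm (RegularFunction.supMatrixNorm_le hs hm fun i j => hΦ (F i j))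
        (RegularFunction.le_supMatrixNorm hs hm hT hZ fun i j => hΦ (F i j))
    · obtain ⟨φ, -, h, hlim⟩ := hfwd G G.2
      rwa [h.op_unique (hΦ G)] at hlim
    · have h := hΦ (Φ.symm φ)
      rw [Φ.apply_symm_apply] at h
      exact h.eval_eq_berezin hs hm hX
  · tfae_have 1 → 2 := fun h => by
      obtain ⟨S, -, -, hS⟩ := hfwd G h
      exact ⟨S, hS⟩
    tfae_have 2 → 3 := by
      rintro ⟨S, hS⟩
      have h := RegularFunction.hasFourier_of_tendsto_eval hG hT hZ hS
      exact ⟨S, RegularFunction.mem_domainAlgebra_of_tendsto_eval hG hT hZ hS,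
        fun K _ _ _ X hX => h.eval_eq_berezin hs hm hX⟩
    tfae_have 3 → 1 := by
      rintro ⟨φ, hφ, h⟩
      obtain ⟨c, hc, hφc⟩ := RegularFunction.exists_hasFourier_of_mem_domainAlgebra hs hm hφ
      exact RegularFunction.mem_discAlgebra_of_eval_eq hc hG
        fun K _ _ _ X hX => by rw [h K X hX, hφc.eval_eq_berezin hs hm hX]
    tfae_finish
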